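/- Let $\mathbb K$ be an algebraically closed field of characteristic $0$, $T=(\mathbb K^*)^n$ with character lattice $M=\mathbb Z^n$, and let $P\subseteq M_{\mathbb R}$ be a full-dimensional normal lattice polytope. Put $\Lambda=P\cap M$, $V=\mathbb K^{\Lambda}$ with coordinates $x_\chi$, and let $X_P\subseteq\mathbb P(V)$ be the Zariski closure of $\{[\sum_{\chi\in\Lambda}\chi(t)e_\chi]\mid t\in T\}$, with vanishing ideal $I(X_P)$ and homogeneous coordinate ring $\mathbb K[\hat X_P]=\mathbb K[V]/I(X_P)$. The torus $\hat T=\mathbb K^*\times T$ acts on $\mathbb K[\hat X_P]$, the class of $x_\chi$ having weight $(-1,-\chi)$; let $S\subseteq\mathbb Z\times M$ be the monoid generated by the $(1,\chi)$, $\chi\in\Lambda$, and for $(m,\eta)=\sum_\chi a_\chi(1,\chi)\in S$ let $f_{m,\eta}\in\mathbb K[\hat X_P]$ be the class of $\prod_\chi x_\chi^{a_\chi}$. Let $A$ be the set of nonempty faces of $P$, ordered by inclusion. For every $\sigma\in A$ let $f_\sigma\in\mathbb K[\hat X_P]$ be a nonzero $\hat T$-eigenfunction, of weight $\mu_\sigma$,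 which is linear (of degree one) and such that $-\mu_\sigma=(1,u_\sigma)$ with $u_\sigma$ a (lattice) point in the relative interior of $\sigma$. For a maximal chain $\mathfrak C$ in $A$ let $\Delta_{\mathfrak C}$ be the simplex with vertices $u_\sigma$, $\sigma\in\mathfrak C$, and let $X_{\Delta_{\mathfrak C}}\subseteq\mathbb P(\mathbb K^{\Delta_{\mathfrak C}\cap M})\subseteq\mathbb P(V)$ be the Zariski closure of $\{[\sum_{\chi\in\Delta_{\mathfrak C}\cap M}\chi(t)e_\chi]\mid t\in T\}$. Fix a total order $>^t$ on $A$ refining the partial order, and order $\mathbb Q^A$ lexicographically, larger faces first. For a maximal chain $\mathfrak C$ and a $\hat T$-eigenfunction $g\neq0$ of weight $\sum_{\sigma\in\mathfrak C}a_\sigma\mu_\sigma$ set $\nu_{\mathfrak C}(g)=\sum_{\sigma\in\mathfrak C}a_\sigma e_\sigma\in\mathbb Q^A$; for general $g\ne 0$ let $\nu_{\mathfrak C}(g)$ be the minimum over the $\hat T$-eigencomponents of $g$, and let $\nu(g)=\min_{\mathfrak C}\nu_{\mathfrak C}(g)$. This is a quasi-valuation; let $\mathrm{gr}_\nu\mathbb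 K[\hat X_P]$ be its associated graded algebra. Write $\Lambda=\{\chi_1,\dots,\chi_r\}$, $m_1=\dots=m_r=1$, and choose $(m_i,\chi_i)\in S$ with $m_i>1$, $r<i\le p$, such that the classes $\bar f_{m_i,\chi_i}$, $1\le i\le p$, generate $\mathrm{gr}_\nu\mathbb K[\hat X_P]$. Let $$\theta:\mathbb K[x_1,\dots,x_p]\to\mathbb K[\hat X_P],\ x_i\mapsto f_{m_i,\chi_i},\qquad \bar\theta:\mathbb K[x_1,\dots,x_p]\to\mathrm{gr}_\nu\mathbb K[\hat X_P],\ x_i\mapsto\bar f_{m_i,\chi_i}.$$ For $g\neq 0$ let $\mathrm{in}_\nu g$ be the sum of the terms of $g$ whose monomial $x^\alpha$ has the greatest value of $\big(\sum_i\alpha_im_i,\ \sum_i\alpha_i\nu(f_{m_i,\chi_i})\big)$, where one compares the first entry, and then the second entry in the reverse of the order of $\mathbb Q^A$. For $\lambda\in\mathbb Z^p$ let $\mathrm{in}_\lambda g$ be the sum of the terms of $g$ with the greatest value of $\lambda\cdot\alpha$; initial ideals are generated by the initial forms of the nonzero elements. Let $\lambda\in\mathbb Z^p$ be such that $\mathrm{in}_\nu(\ker\theta)=\mathrm{in}_\lambda(\ker\theta)$,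 and set $\lambda^\dagger=(\lambda_1,\dots,\lambda_r)$. Let $\mathbb G_m$ act on $V$ by $s\cdot e_{\chi_i}=s^{\lambda_i}e_{\chi_i}$, and let $\lim_{s\to0}s\cdot X_P\subseteq\mathbb P(V)$ denote the zero set of $\lim_{s\to 0}s\cdot I(X_P)=\mathrm{in}_{\lambda^\dagger}I(X_P)$. Then: (i) $\sqrt{\mathrm{in}_{\lambda^\dagger}I(X_P)}=\ker\bar\theta\cap\mathbb K[x_1,\dots,x_r]$; (ii) $\displaystyle\lim_{s\to0}s\cdot X_P=\bigcup_{\mathfrak C}X_{\Delta_{\mathfrak C}}$ in $\mathbb P(V)$, the union running over all maximal chains $\mathfrak C$ in $A$. -/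

import Mathlib

namespace SeshadriToric

open MvPolynomial
open scoped Pointwise

/-! ### Closed subsets of projective space -/

noncomputable section Projective

variable {ι K : Type*} [Field K]

/-- The polynomial `f` vanishes at all representatives of the point `p` of `ℙ(K^ι)`. -/
def VanishesAt (f : MvPolynomial ι K) (p : Projectivization K (ι → K)) : Prop :=
  ∀ (v : ι → K) (hv : v ≠ 0), Projectivization.mk K v hv = p → eval v f = 0

/-- The homogeneous vanishing ideal `I(Y)` of `Y ⊆ ℙ(K^ι)`. -/
def vanishingIdeal (Y : Set (Projectivization K (ι → K))) : Ideal (MvPolynomial ι K) :=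
  Ideal.span {f | ∃ d : ℕ, f.IsHomogeneous d ∧ ∀ p ∈ Y, VanishesAt f p}

/-- The common zeros in `ℙ(K^ι)` of the homogeneous elements of `I`. -/
def zeroLocus (I : Ideal (MvPolynomial ι K)) : Set (Projectivization K (ι → K)) :=
  {p | ∀ (d : ℕ), ∀ f ∈ I, f.IsHomogeneous d → VanishesAt f p}

/-- Zariski closure in `ℙ(K^ι)`. -/
def zariskiClosure (Y : Set (Projectivization K (ι → K))) : Set (Projectivization K (ι → K)) :=
  zeroLocus (vanishingIdeal Y)

end Projective

/-! ### Initial ideals with respect to a (pre)order on monomials given by a degree map -/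

section Initial

variable {ι K D : Type*} [Field K] [LinearOrder D]

open Classical in
/-- The sum of the terms of `g` whose monomials have the greatest value of `deg`. -/
noncomputable def initialForm (deg : (ι →₀ ℕ) → D) (g : MvPolynomial ι K) : MvPolynomial ι K :=
  ∑ α ∈ g.support with ∀ β ∈ g.support, deg β ≤ deg α, monomial α (g.coeff α)

/-- The ideal generated by the initial forms of the nonzero elements of `I`. -/
noncomputable def initialIdeal (deg : (ι →₀ ℕ) → D) (I : Ideal (MvPolynomial ι K)) :
    Ideal (MvPolynomial ι K) :=
  Ideal.span {f | ∃ g ∈ I, g ≠ 0 ∧ f = initialForm deg g}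

/-- `α ↦ w · α`, the degree map of the integral weight order defined by `w`. -/
def weightDeg (w : ι → ℤ) (α : ι →₀ ℕ) : ℤ := α.sum fun i k => (k : ℤ) * w i

/-- The limit `lim_{s → 0} s · Y` in `ℙ(K^ι)`, where `s ∈ 𝔾_m` acts by `s · e_i = s ^ (w i) e_i`:
the zero set of the limit `in_w I(Y)` of the ideals `s · I(Y)`. -/
noncomputable def limitVariety (w : ι → ℤ) (Y : Set (Projectivization K (ι → K))) :
    Set (Projectivization K (ι → K)) :=
  zeroLocus (initialIdeal (weightDeg w) (vanishingIdeal Y))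

end Initial

/-! ### Tori and projective toric varieties -/

section Torus

variable {n : ℕ} {ι K : Type*} [Field K]

/-- The character of `T = (Kˣ)^n` given by `χ ∈ M = ℤ^n`. -/
def character (χ : Fin n → ℤ) (t : Fin n → Kˣ) : Kˣ := ∏ i, t i ^ χ i

/-- The character of `T̂ = Kˣ × T` given by `μ ∈ M̂ = ℤ × M`. -/
def characterHat (μ : ℤ × (Fin n → ℤ)) (t : Kˣ × (Fin n → Kˣ)) : Kˣ :=
  t.1 ^ μ.1 * character μ.2 t.2

/-- The vector with coordinates `χ(t)`, `χ` running through the family `a`. -/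
def orbitVector (K : Type*) [Field K] (a : ι → Fin n → ℤ) (t : Fin n → Kˣ) : ι → K :=
  fun i => (character (a i) t : K)

/-- The torus orbit `{[∑ χ(t) e_χ] | t ∈ T}` in `ℙ(K^ι)`. -/
def torusOrbit (K : Type*) [Field K] (a : ι → Fin n → ℤ) : Set (Projectivization K (ι → K)) :=
  {p | ∃ (t : Fin n → Kˣ) (h : orbitVector K a t ≠ 0),
    p = Projectivization.mk K (orbitVector K a t) h}

/-- The embedded projective toric variety of the family `a` of lattice points. -/
def toricVariety (K : Type*) [Field K] (a : ι → Fin n → ℤ) : Set (Projectivization K (ι → K)) :=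
  zariskiClosure (torusOrbit K a)

/-- The `T̂`-weight `(-1, -χ)` of the coordinate function `x_χ`. -/
def coordWeight (a : ι → Fin n → ℤ) (i : ι) : ℤ × (Fin n → ℤ) := (-1, -a i)

/-- The action of `t ∈ T̂` on polynomials, `(t · g)(x) = g(t⁻¹ x)`: it multiplies `x_χ` by the value
at `t` of the character `(-1, -χ)`. -/
noncomputable def torusAct (a : ι → Fin n → ℤ) (t : Kˣ × (Fin n → Kˣ)) :
    MvPolynomial ι K →ₐ[K] MvPolynomial ι K :=
  aeval fun i => C (characterHat (coordWeight a i) t : K) * X i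

/-- The homogeneous coordinate ring of the toric variety of `a`. -/
abbrev CoordRing (K : Type*) [Field K] (a : ι → Fin n → ℤ) : Type _ :=
  MvPolynomial ι K ⧸ vanishingIdeal (toricVariety K a)

lemma characterHat_add (μ ν : ℤ × (Fin n → ℤ)) (t : Kˣ × (Fin n → Kˣ)) :
    characterHat (μ + ν) t = characterHat μ t * characterHat ν t := by
  simp only [characterHat, character, Prod.fst_add, Prod.snd_add, Pi.add_apply, zpow_add,
    Finset.prod_mul_distrib]
  exact mul_mul_mul_comm _ _ _ _

/-- `characterHat` as a homomorphism in the weight. -/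
def characterHatHom (t : Kˣ × (Fin n → Kˣ)) : Multiplicative (ℤ × (Fin n → ℤ)) →* Kˣ where
  toFun μ := characterHat μ.toAdd t
  map_one' := by simp [characterHat, character]
  map_mul' μ ν := characterHat_add _ _ _

lemma prod_characterHat (a : ι → Fin n → ℤ) (t : Kˣ × (Fin n → Kˣ)) (d : ι →₀ ℕ) :
    (d.prod fun i k => (characterHat (coordWeight a i) t : K) ^ k) =
      (characterHat (Finsupp.weight (coordWeight a) d) t : K) := by
  have h : characterHat (Finsupp.weight (coordWeight a) d) t =
      ∏ i ∈ d.support, characterHat (coordWeight a i) t ^ d i := by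
    have h1 := map_prod (characterHatHom t)
      (fun i => Multiplicative.ofAdd (d i • coordWeight a i)) d.support
    rw [← ofAdd_sum] at h1
    rw [Finsupp.weight_apply, Finsupp.sum]
    refine h1.trans (Finset.prod_congr rfl fun i _ => ?_)
    rw [ofAdd_nsmul, map_pow]
    rfl
  rw [h, Finsupp.prod]
  push_cast
  rfl

lemma torusAct_monomial (a : ι → Fin n → ℤ) (t : Kˣ × (Fin n → Kˣ)) (d : ι →₀ ℕ) (r : K) :
    torusAct a t (monomial d r) =
      (characterHat (Finsupp.weight (coordWeight a) d) t : K) • monomial d r := by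
  rw [torusAct, aeval_monomial, ← prod_characterHat, monomial_eq, smul_eq_C_mul]
  simp only [mul_pow, Finsupp.prod, map_prod, map_pow, algebraMap_eq, Finset.prod_mul_distrib]
  ring

lemma coeff_torusAct (a : ι → Fin n → ℤ) (t : Kˣ × (Fin n → Kˣ)) (f : MvPolynomial ι K)
    (d : ι →₀ ℕ) : (torusAct a t f).coeff d =
      (characterHat (Finsupp.weight (coordWeight a) d) t : K) * f.coeff d := by
  classical
  induction f using MvPolynomial.induction_on' with
  | monomial e r =>
    rw [torusAct_monomial, coeff_smul, coeff_monomial, smul_eq_mul]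
    split_ifs with h
    · rw [h]
    · simp
  | add p q hp hq => rw [map_add, coeff_add, hp, hq, coeff_add, mul_add]

lemma eval_characterHat (a : ι → Fin n → ℤ) (t : Kˣ × (Fin n → Kˣ)) (f : MvPolynomial ι K) :
    eval (fun i => (characterHat (coordWeight a i) t : K)) f =
      ∑ d ∈ f.support, f.coeff d * (characterHat (Finsupp.weight (coordWeight a) d) t : K) := by
  rw [eval_eq]
  refine Finset.sum_congr rfl fun d _ => ?_
  rw [← prod_characterHat]
  rfl

lemma characterHat_injective [CharZero K] {μ ν : ℤ × (Fin n → ℤ)}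
    (h : ∀ t : Kˣ × (Fin n → Kˣ), characterHat μ t = characterHat ν t) : μ = ν := by
  classical
  have key : ∀ k l : ℤ, (Units.mk0 (2 : K) two_ne_zero) ^ k = (Units.mk0 (2 : K) two_ne_zero) ^ l →
      k = l := by
    intro k l hkl
    have h1 : (2 : K) ^ k = (2 : K) ^ l := by
      have := congrArg (fun u : Kˣ => (u : K)) hkl
      simpa using this
    have h2 : (2 : ℚ) ^ k = (2 : ℚ) ^ l := by
      have h3 : (((2 : ℚ) ^ k : ℚ) : K) = (((2 : ℚ) ^ l : ℚ) : K) := by push_cast; exact h1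
      exact_mod_cast h3
    exact zpow_right_injective₀ (by norm_num) (by norm_num) h2
  refine Prod.ext ?_ (funext fun i => ?_)
  · have := h (Units.mk0 (2 : K) two_ne_zero, 1)
    simp only [characterHat, character, Pi.one_apply, one_zpow, Finset.prod_const_one,
      mul_one] at this
    exact key _ _ this
  · have := h (1, Function.update 1 i (Units.mk0 (2 : K) two_ne_zero))
    simp only [characterHat, character, one_zpow, one_mul] at this
    rw [Finset.prod_eq_single i, Finset.prod_eq_single i] at this
    · simpa using key _ _ (by simpa using this)
    all_goals simp +contextual [Function.update_of_ne]

/-- A polynomial vanishing at all points `t · (1, …, 1)`, `t ∈ T̂`, has weight components with the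
same property. -/
lemma eval_component [CharZero K] (a : ι → Fin n → ℤ) (f : MvPolynomial ι K)
    (hf : ∀ t : Kˣ × (Fin n → Kˣ), eval (fun i => (characterHat (coordWeight a i) t : K)) f = 0)
    (μ : ℤ × (Fin n → ℤ)) (t : Kˣ × (Fin n → Kˣ)) :
    eval (fun i => (characterHat (coordWeight a i) t : K))
      (weightedHomogeneousComponent (coordWeight a) μ f) = 0 := by
  classical
  let χ : (ℤ × (Fin n → ℤ)) → (Kˣ × (Fin n → Kˣ) →* K) := fun ν =>
    { toFun := fun t => (characterHat ν t : K)
      map_one' := by simp [characterHat, character]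
      map_mul' := fun s t => by
        simp only [characterHat, character, Prod.fst_mul, Prod.snd_mul, Pi.mul_apply, mul_zpow,
          Finset.prod_mul_distrib]
        push_cast
        ring }
  have hχ : Function.Injective χ := by
    intro ν ν' h
    refine characterHat_injective (K := K) fun t => Units.ext ?_
    exact DFunLike.congr_fun h t
  have hli := (linearIndependent_monoidHom (Kˣ × (Fin n → Kˣ)) K).comp χ hχ
  have hsum : ∑ ν ∈ f.support.image (Finsupp.weight (coordWeight a)),
      (∑ d ∈ f.support with Finsupp.weight (coordWeight a) d = ν, f.coeff d) •
        ((χ ν : Kˣ × (Fin n → Kˣ) →* K) : Kˣ × (Fin n → Kˣ) → K) = 0 := by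
    funext s
    rw [Finset.sum_apply, Pi.zero_apply, ← hf s, eval_characterHat,
      ← Finset.sum_fiberwise_of_maps_to (g := Finsupp.weight (coordWeight a))
        (fun d hd => Finset.mem_image_of_mem _ hd)]
    refine Finset.sum_congr rfl fun ν _ => ?_
    rw [Pi.smul_apply, smul_eq_mul, Finset.sum_mul]
    refine Finset.sum_congr rfl fun d hd => ?_
    rw [(Finset.mem_filter.mp hd).2]
    rfl
  have hz := linearIndependent_iff'.mp hli _ _ hsum
  have hc : (∑ d ∈ f.support with Finsupp.weight (coordWeight a) d = μ, f.coeff d) = 0 := by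
    by_cases hμ : μ ∈ f.support.image (Finsupp.weight (coordWeight a))
    · exact hz μ hμ
    · rw [Finset.filter_eq_empty_iff.mpr, Finset.sum_empty]
      intro d hd h
      exact hμ (Finset.mem_image.mpr ⟨d, hd, h⟩)
  rw [weightedHomogeneousComponent_apply, map_sum]
  have : ∀ d ∈ f.support.filter (fun d => Finsupp.weight (coordWeight a) d = μ),
      eval (fun i => (characterHat (coordWeight a i) t : K)) (monomial d (f.coeff d)) =
        f.coeff d * (characterHat μ t : K) := by
    intro d hd
    rw [eval_monomial, prod_characterHat, (Finset.mem_filter.mp hd).2]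
  rw [Finset.sum_congr rfl this, ← Finset.sum_mul, hc, zero_mul]

lemma characterHat_coordWeight (a : ι → Fin n → ℤ) (t : Kˣ × (Fin n → Kˣ)) :
    (fun i => (characterHat (coordWeight a i) t : K)) =
      ((t.1⁻¹ : Kˣ) : K) • orbitVector K a (t.2⁻¹) := by
  funext i
  simp [characterHat, coordWeight, orbitVector, character]

/-- Membership in the vanishing ideal forces vanishing on the orbit `T̂ · (1, …, 1)`. -/
lemma eval_of_mem (a : ι → Fin n → ℤ) {f : MvPolynomial ι K} [Nonempty ι]
    (hf : f ∈ vanishingIdeal (toricVariety K a)) (t : Kˣ × (Fin n → Kˣ)) :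
    eval (fun i => (characterHat (coordWeight a i) t : K)) f = 0 := by
  have hle : vanishingIdeal (toricVariety K a) ≤
      RingHom.ker (eval (fun i => (characterHat (coordWeight a i) t : K))) := by
    refine Ideal.span_le.mpr ?_
    rintro g ⟨d, hg, hv⟩
    obtain ⟨i⟩ := ‹Nonempty ι›
    have h0 : orbitVector K a t.2⁻¹ ≠ 0 := fun h =>
      (character (a i) (t.2⁻¹)).ne_zero (congrFun h i)
    have h1 : (fun i => (characterHat (coordWeight a i) t : K)) ≠ 0 := fun h =>
      (characterHat (coordWeight a i) t).ne_zero (congrFun h i)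
    refine hv (Projectivization.mk K _ h0) ?_ _ h1 ?_
    · intro e p hp hpe v hv' hvp
      have : vanishingIdeal (torusOrbit K a) ≤ RingHom.ker (eval v) := by
        refine Ideal.span_le.mpr ?_
        rintro q ⟨_, _, hq⟩
        exact hq _ ⟨_, h0, rfl⟩ v hv' hvp
      exact this hp
    · exact (Projectivization.mk_eq_mk_iff' K _ _ h1 h0).mpr
        ⟨_, (characterHat_coordWeight a t).symm⟩
  exact hle hf

lemma weight_coordWeight_fst (a : ι → Fin n → ℤ) (d : ι →₀ ℕ) :
    (Finsupp.weight (coordWeight a) d).1 = -(d.degree : ℤ) := by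
  rw [Finsupp.weight_apply, Finsupp.sum, Prod.fst_sum, Finsupp.degree_apply]
  simp [coordWeight]

/-- The vanishing ideal of a toric variety is `T̂`-homogeneous. -/
lemma component_mem [CharZero K] (a : ι → Fin n → ℤ) (μ : ℤ × (Fin n → ℤ))
    {f : MvPolynomial ι K} (hf : f ∈ vanishingIdeal (toricVariety K a)) :
    weightedHomogeneousComponent (coordWeight a) μ f ∈ vanishingIdeal (toricVariety K a) := by
  classical
  have hhom : (weightedHomogeneousComponent (coordWeight a) μ f).IsHomogeneous
      (-μ.1).toNat := by
    intro d hd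
    have h1 := weightedHomogeneousComponent_isWeightedHomogeneous (w := coordWeight a) μ f hd
    have h2 := weight_coordWeight_fst a d
    rw [h1] at h2
    rw [h2, neg_neg, Int.toNat_natCast, Finsupp.degree_eq_weight_one]
    rfl
  refine Ideal.subset_span ⟨_, hhom, fun p hp => ?_⟩
  refine hp _ _ (Ideal.subset_span ⟨_, hhom, ?_⟩) hhom
  rintro _ ⟨t, h0, rfl⟩ v hv hvp
  obtain ⟨c, hc⟩ := (Projectivization.mk_eq_mk_iff K _ _ hv h0).mp hvp
  have : Nonempty ι := by
    by_contra hne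
    rw [not_nonempty_iff] at hne
    exact hv (Subsingleton.elim _ _)
  have h := eval_component a f (eval_of_mem a hf) μ (c⁻¹, t⁻¹)
  rw [characterHat_coordWeight] at h
  simp only [inv_inv] at h
  rw [← hc]
  exact h

lemma torusAct_mem [CharZero K] (a : ι → Fin n → ℤ) (t : Kˣ × (Fin n → Kˣ))
    {f : MvPolynomial ι K} (hf : f ∈ vanishingIdeal (toricVariety K a)) :
    torusAct a t f ∈ vanishingIdeal (toricVariety K a) := by
  classical
  have : torusAct a t f = ∑ μ ∈ f.support.image (Finsupp.weight (coordWeight a)),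
      (characterHat μ t : K) • weightedHomogeneousComponent (coordWeight a) μ f := by
    ext d
    simp only [coeff_torusAct, coeff_sum, coeff_smul, coeff_weightedHomogeneousComponent,
      smul_eq_mul, mul_ite, mul_zero]
    rw [Finset.sum_ite_eq]
    split_ifs with h
    · rfl
    · by_cases hd : d ∈ f.support
      · exact absurd (Finset.mem_image_of_mem _ hd) h
      · rw [notMem_support_iff.mp hd, mul_zero]
  rw [this]
  exact Submodule.sum_mem _ fun μ _ => (vanishingIdeal (toricVariety K a)).smul_of_tower_mem _
    (component_mem a μ hf)

/-- The induced action of `T̂` on the homogeneous coordinate ring. -/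
noncomputable def torusActQuot [CharZero K] (a : ι → Fin n → ℤ) (t : Kˣ × (Fin n → Kˣ)) :
    CoordRing K a →ₐ[K] CoordRing K a :=
  Ideal.quotientMapₐ _ (torusAct a t) fun _ hf => torusAct_mem a t hf

/-- `g` is a `T̂`-eigenvector of weight `μ` in the homogeneous coordinate ring. -/
def IsEigenfunction [CharZero K] (a : ι → Fin n → ℤ) (μ : ℤ × (Fin n → ℤ))
    (g : CoordRing K a) : Prop :=
  ∀ t : Kˣ × (Fin n → Kˣ), torusActQuot a t g = (characterHat μ t : K) • g

/-- The component of weight `μ` of an element of the homogeneous coordinate ring. -/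
noncomputable def eigenComponent [CharZero K] (a : ι → Fin n → ℤ) (μ : ℤ × (Fin n → ℤ)) :
    CoordRing K a →ₗ[K] CoordRing K a :=
  Submodule.mapQ ((vanishingIdeal (toricVariety K a)).restrictScalars K)
    ((vanishingIdeal (toricVariety K a)).restrictScalars K)
    (weightedHomogeneousComponent (coordWeight a) μ) fun _ hf => component_mem a μ hf

lemma eigenComponent_mk [CharZero K] (a : ι → Fin n → ℤ) (μ : ℤ × (Fin n → ℤ))
    (f : MvPolynomial ι K) :
    eigenComponent a μ (Ideal.Quotient.mk (vanishingIdeal (toricVariety K a)) f) =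
      Ideal.Quotient.mk _ (weightedHomogeneousComponent (coordWeight a) μ f) := rfl

lemma isEigenfunction_eigenComponent [CharZero K] (a : ι → Fin n → ℤ) (μ : ℤ × (Fin n → ℤ))
    (g : CoordRing K a) : IsEigenfunction a μ (eigenComponent a μ g) := by
  classical
  obtain ⟨f, rfl⟩ := Ideal.Quotient.mk_surjective g
  intro t
  rw [eigenComponent_mk]
  have : torusAct a t (weightedHomogeneousComponent (coordWeight a) μ f) =
      (characterHat μ t : K) • weightedHomogeneousComponent (coordWeight a) μ f := by
    ext d
    rw [coeff_torusAct, coeff_smul, coeff_weightedHomogeneousComponent, smul_eq_mul]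
    split_ifs with h
    · rw [h]
    · simp
  change Ideal.Quotient.mk _ (torusAct a t (weightedHomogeneousComponent (coordWeight a) μ f)) = _
  rw [this]
  rfl

lemma finite_eigenSupport [CharZero K] (a : ι → Fin n → ℤ) (g : CoordRing K a) :
    {μ | eigenComponent a μ g ≠ 0}.Finite := by
  classical
  obtain ⟨f, rfl⟩ := Ideal.Quotient.mk_surjective g
  refine (f.support.image (Finsupp.weight (coordWeight a))).finite_toSet.subset fun μ hμ => ?_
  by_contra h
  refine hμ ?_
  rw [eigenComponent_mk, weightedHomogeneousComponent_eq_zero', map_zero]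
  intro d hd hdμ
  exact h (Finset.mem_coe.mpr (Finset.mem_image.mpr ⟨d, hd, hdμ⟩))

/-- The finite set of weights occurring in `g`. -/
noncomputable def eigenSupport [CharZero K] (a : ι → Fin n → ℤ) (g : CoordRing K a) :
    Finset (ℤ × (Fin n → ℤ)) :=
  (finite_eigenSupport a g).toFinset

lemma mem_eigenSupport [CharZero K] (a : ι → Fin n → ℤ) {g : CoordRing K a}
    {μ : ℤ × (Fin n → ℤ)} : μ ∈ eigenSupport a g ↔ eigenComponent a μ g ≠ 0 := by
  simp [eigenSupport]

/-- Together with `isEigenfunction_eigenComponent`: the components of `g` are its decomposition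
into `T̂`-eigenfunctions of pairwise distinct weights. -/
lemma sum_eigenComponent [CharZero K] (a : ι → Fin n → ℤ) (g : CoordRing K a) :
    ∑ μ ∈ eigenSupport a g, eigenComponent a μ g = g := by
  classical
  obtain ⟨f, rfl⟩ := Ideal.Quotient.mk_surjective g
  have h := sum_weightedHomogeneousComponent (coordWeight a) f
  rw [finsum_eq_sum_of_support_subset (s := f.support.image (Finsupp.weight (coordWeight a)))] at h
  · conv_rhs => rw [← h]
    rw [map_sum]
    refine Finset.sum_subset_zero_on_sdiff (fun μ hμ => ?_) (fun μ hμ => ?_) (fun μ _ => rfl)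
    · by_contra hn
      refine mem_eigenSupport a |>.mp hμ ?_
      rw [eigenComponent_mk, weightedHomogeneousComponent_eq_zero', map_zero]
      intro d hd hdμ
      exact hn (Finset.mem_image.mpr ⟨d, hd, hdμ⟩)
    · have := (Finset.mem_sdiff.mp hμ).2
      rw [mem_eigenSupport, not_not] at this
      exact this
  · intro μ hμ
    by_contra hn
    refine hμ (weightedHomogeneousComponent_eq_zero' _ _ fun d hd hdμ => hn ?_)
    exact Finset.mem_coe.mpr (Finset.mem_image.mpr ⟨d, hd, hdμ⟩)

lemma eigenSupport_add [CharZero K] (a : ι → Fin n → ℤ) {g h : CoordRing K a}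
    {μ : ℤ × (Fin n → ℤ)} (hμ : μ ∈ eigenSupport a (g + h)) :
    μ ∈ eigenSupport a g ∨ μ ∈ eigenSupport a h := by
  simp only [mem_eigenSupport, map_add] at *
  by_contra! hc
  exact hμ (by rw [hc.1, hc.2, add_zero])

lemma eigenSupport_smul [CharZero K] (a : ι → Fin n → ℤ) {c : K} {g : CoordRing K a}
    {μ : ℤ × (Fin n → ℤ)} (hμ : μ ∈ eigenSupport a (c • g)) : μ ∈ eigenSupport a g := by
  simp only [mem_eigenSupport, map_smul] at *
  exact fun hc => hμ (by rw [hc, smul_zero])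

lemma eigenSupport_one [CharZero K] (a : ι → Fin n → ℤ)
    {μ : ℤ × (Fin n → ℤ)} (hμ : μ ∈ eigenSupport a (1 : CoordRing K a)) : μ = 0 := by
  by_contra hne
  refine (mem_eigenSupport a).mp hμ ?_
  rw [← map_one (Ideal.Quotient.mk (vanishingIdeal (toricVariety K a))), eigenComponent_mk,
    (isWeightedHomogeneous_one K (coordWeight a)).weightedHomogeneousComponent_ne μ
      hne, map_zero]

lemma eigenSupport_mul [CharZero K] (a : ι → Fin n → ℤ) {g h : CoordRing K a}
    {μ : ℤ × (Fin n → ℤ)} (hμ : μ ∈ eigenSupport a (g * h)) :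
    ∃ μ₁ ∈ eigenSupport a g, ∃ μ₂ ∈ eigenSupport a h, μ = μ₁ + μ₂ := by
  classical
  by_contra! hc
  refine (mem_eigenSupport a).mp hμ ?_
  rw [← sum_eigenComponent a g, ← sum_eigenComponent a h, Finset.sum_mul_sum, map_sum]
  refine Finset.sum_eq_zero fun μ₁ h₁ => ?_
  rw [map_sum]
  refine Finset.sum_eq_zero fun μ₂ h₂ => ?_
  obtain ⟨f₁, hf₁⟩ := Ideal.Quotient.mk_surjective g
  obtain ⟨f₂, hf₂⟩ := Ideal.Quotient.mk_surjective h
  rw [← hf₁, ← hf₂, eigenComponent_mk, eigenComponent_mk, ← map_mul, eigenComponent_mk,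
    ((weightedHomogeneousComponent_isWeightedHomogeneous (w := coordWeight a) μ₁ f₁).mul
      (weightedHomogeneousComponent_isWeightedHomogeneous (w := coordWeight a) μ₂ f₂)
      ).weightedHomogeneousComponent_ne μ (hc μ₁ h₁ μ₂ h₂), map_zero]

end Torus

/-! ### Quasi-valuations and associated graded algebras -/

section QuasiValuation

/-- A quasi-valuation on the `K`-algebra `R` with values in the totally ordered abelian group `G`;
`⊤` is the value of `0` only. The last condition, which makes the associated graded ring unital,
holds for every homogeneous quasi-valuation. -/
structure QuasiValuation (K R G : Type*) [Field K] [CommRing R] [Algebra K R]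
    [AddCommGroup G] [LinearOrder G] [IsOrderedAddMonoid G] where
  /-- The underlying function. -/
  toFun : R → WithTop G
  eq_top_iff : ∀ g, toFun g = ⊤ ↔ g = 0
  min_le_add : ∀ g h, min (toFun g) (toFun h) ≤ toFun (g + h)
  smul : ∀ (c : K) (g), c ≠ 0 → toFun (c • g) = toFun g
  add_le_mul : ∀ g h, toFun g + toFun h ≤ toFun (g * h)
  zero_le_one : 0 ≤ toFun 1

namespace QuasiValuation

variable {K R G : Type*} [Field K] [CommRing R] [Algebra K R]
  [AddCommGroup G] [LinearOrder G] [IsOrderedAddMonoid G] (ν : QuasiValuation K R G)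

lemma map_zero : ν.toFun 0 = ⊤ := (ν.eq_top_iff 0).mpr rfl

/-- `{g | ν g ≥ a}`. -/
def filtrationGE (a : G) : Submodule K R where
  carrier := {g | (a : WithTop G) ≤ ν.toFun g}
  zero_mem' := by simp [ν.map_zero]
  add_mem' hg hh := (le_min hg hh).trans (ν.min_le_add _ _)
  smul_mem' c g hg := by
    rcases eq_or_ne c 0 with rfl | hc
    · simp [ν.map_zero]
    · simpa [ν.smul c g hc] using hg

/-- `{g | ν g > a}`. -/
def filtrationGT (a : G) : Submodule K R where
  carrier := {g | (a : WithTop G) < ν.toFun g}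
  zero_mem' := by simp [ν.map_zero]
  add_mem' hg hh := (lt_min hg hh).trans_le (ν.min_le_add _ _)
  smul_mem' c g hg := by
    rcases eq_or_ne c 0 with rfl | hc
    · simp [ν.map_zero]
    · simpa [ν.smul c g hc] using hg

lemma mem_filtrationGE {a : G} {g : R} : g ∈ ν.filtrationGE a ↔ (a : WithTop G) ≤ ν.toFun g :=
  Iff.rfl

lemma mem_filtrationGT {a : G} {g : R} : g ∈ ν.filtrationGT a ↔ (a : WithTop G) < ν.toFun g :=
  Iff.rfl

lemma mul_mem_GE {a b : G} {g h : R} (hg : g ∈ ν.filtrationGE a) (hh : h ∈ ν.filtrationGE b) :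
    g * h ∈ ν.filtrationGE (a + b) := by
  rw [mem_filtrationGE] at *
  exact (by push_cast; exact add_le_add hg hh : ((a + b : G) : WithTop G) ≤ _).trans
    (ν.add_le_mul _ _)

lemma mul_mem_GT {a b : G} {g h : R} (hg : g ∈ ν.filtrationGE a) (hh : h ∈ ν.filtrationGT b) :
    g * h ∈ ν.filtrationGT (a + b) := by
  rw [mem_filtrationGE] at hg
  rw [mem_filtrationGT] at *
  refine lt_of_lt_of_le ?_ (ν.add_le_mul _ _)
  generalize ν.toFun g = x at *
  generalize ν.toFun h = y at *
  cases x with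
  | top => simp
  | coe x =>
    cases y with
    | top => simp
    | coe y =>
      norm_cast at *
      exact add_lt_add_of_le_of_lt hg hh

/-- The Rees algebra `⨁_a R_{≥ a} T^a` inside `R[G]`. -/
def rees : Subalgebra K (AddMonoidAlgebra R G) where
  carrier := {p | ∀ a, p.coeff a ∈ ν.filtrationGE a}
  zero_mem' a := by simp
  add_mem' hp hq a := by
    rw [AddMonoidAlgebra.coeff_add]
    exact add_mem (hp a) (hq a)
  mul_mem' {p q} hp hq a := by
    classical
    rw [AddMonoidAlgebra.coeff_mul]
    refine Submodule.sum_mem _ fun b _ => Submodule.sum_mem _ fun c _ => ?_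
    dsimp only
    split_ifs with h
    · exact h ▸ ν.mul_mem_GE (hp b) (hq c)
    · exact zero_mem _
  algebraMap_mem' c a := by
    classical
    rw [AddMonoidAlgebra.coe_algebraMap, Function.comp_apply, AddMonoidAlgebra.coeff_single,
      Finsupp.single_apply]
    split_ifs with h
    · subst h
      rw [Algebra.algebraMap_eq_smul_one]
      exact Submodule.smul_mem _ _ ν.zero_le_one
    · exact zero_mem _

/-- The ideal `⨁_a R_{> a} T^a` of the Rees algebra. -/
def reesIdeal : Ideal ν.rees where
  carrier := {p | ∀ a, (p : AddMonoidAlgebra R G).coeff a ∈ ν.filtrationGT a}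
  zero_mem' a := by simp
  add_mem' hp hq a := by
    rw [Subalgebra.coe_add, AddMonoidAlgebra.coeff_add]
    exact add_mem (hp a) (hq a)
  smul_mem' p q hq a := by
    classical
    rw [smul_eq_mul, Subalgebra.coe_mul, AddMonoidAlgebra.coeff_mul]
    refine Submodule.sum_mem _ fun b _ => Submodule.sum_mem _ fun c _ => ?_
    dsimp only
    split_ifs with h
    · exact h ▸ ν.mul_mem_GT (p.2 b) (hq c)
    · exact zero_mem _

/-- The associated graded algebra `gr_ν R = ⨁_a R_{≥ a} / R_{> a}`. -/
abbrev Gr : Type _ := ν.rees ⧸ ν.reesIdeal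

/-- The value of a nonzero element, in `G`. -/
def value (g : R) : G := (ν.toFun g).untopD 0

/-- The class of `g` in the leaf `R_{≥ a} / R_{> a}` with `a = ν g`. -/
noncomputable def symb (g : R) : ν.Gr :=
  Ideal.Quotient.mk _ ⟨AddMonoidAlgebra.single (ν.value g) g, fun a => by
    classical
    rw [AddMonoidAlgebra.coeff_single, Finsupp.single_apply]
    split_ifs with h
    · subst h
      rw [mem_filtrationGE, value]
      cases ν.toFun g <;> simp
    · exact zero_mem _⟩

end QuasiValuation

end QuasiValuation

/-! ### Polytopes, faces and combinatorial Seshadri stratifications -/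

section Polytope

variable {n : ℕ}

/-- The inclusion `M → M_ℝ`. -/
def toReal (χ : Fin n → ℤ) : Fin n → ℝ := fun i => χ i

/-- The lattice points of `Q ⊆ M_ℝ`. -/
def latticePoints (Q : Set (Fin n → ℝ)) : Set (Fin n → ℤ) := {χ | toReal χ ∈ Q}

/-- Full dimensional normal lattice polytopes in `M_ℝ = ℝ^n`. -/
structure NormalLatticePolytope (n : ℕ) where
  /-- The underlying set. -/
  carrier : Set (Fin n → ℝ)
  lattice : ∃ F : Finset (Fin n → ℤ), carrier = convexHull ℝ (toReal '' (F : Set (Fin n → ℤ)))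
  full_dim : affineSpan ℝ carrier = ⊤
  normal : ∀ k l : ℕ, latticePoints ((k : ℝ) • carrier) + latticePoints ((l : ℝ) • carrier) =
    latticePoints (((k + l : ℕ) : ℝ) • carrier)

namespace NormalLatticePolytope

variable (P : NormalLatticePolytope n)

/-- `Λ = P ∩ M`. -/
abbrev Pts : Type := latticePoints P.carrier

/-- The points of `Λ` as elements of `M`. -/
def pt (χ : P.Pts) : Fin n → ℤ := χ.1

/-- The poset `A` of (nonempty) faces of `P`, ordered by inclusion. -/
abbrev Face : Type := {σ : Set (Fin n → ℝ) // σ.Nonempty ∧ IsExposed ℝ P.carrier σ}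

instance finite_face : Finite P.Face := by
  obtain ⟨F, hF⟩ := P.lattice
  have hfin : (toReal '' (F : Set (Fin n → ℤ))).Finite := F.finite_toSet.image _
  have hc : IsCompact P.carrier := hF ▸ hfin.isCompact_convexHull ℝ
  have hconv : Convex ℝ P.carrier := hF ▸ convex_convexHull ℝ _
  have : Finite (𝒫 (toReal '' (F : Set (Fin n → ℤ)))) := hfin.finite_subsets
  refine Finite.of_injective
    (fun σ : P.Face => (⟨σ.1.extremePoints ℝ, fun x hx => ?_⟩ :
      𝒫 (toReal '' (F : Set (Fin n → ℤ))))) ?_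
  · have := σ.2.2.isExtreme.extremePoints_subset_extremePoints hx
    rw [hF] at this
    exact extremePoints_convexHull_subset this
  · intro σ τ h
    have h' : σ.1.extremePoints ℝ = τ.1.extremePoints ℝ := congrArg Subtype.val h
    refine Subtype.ext ?_
    rw [← closure_convexHull_extremePoints (σ.2.2.isCompact hc) (σ.2.2.convex hconv),
      ← closure_convexHull_extremePoints (τ.2.2.isCompact hc) (τ.2.2.convex hconv), h']

instance finite_flag : Finite (Flag P.Face) :=
  Finite.of_injective (fun C : Flag P.Face => (C : Set P.Face)) SetLike.coe_injective

/-- The embedded toric variety `X_P ⊆ ℙ(V)`, `V = K^Λ`. -/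
def variety (K : Type*) [Field K] : Set (Projectivization K (P.Pts → K)) :=
  toricVariety K P.pt

/-- `K[V] → K[X̂_P]`; the kernel is the vanishing ideal of `X_P`. -/
noncomputable def thetaV (K : Type*) [Field K] : MvPolynomial P.Pts K →ₐ[K] CoordRing K P.pt :=
  Ideal.Quotient.mkₐ K _

/-- For `Q ⊆ P`, the toric variety `X_Q ⊆ ℙ(K^(Q ∩ M))`, viewed as a subset of `ℙ(V)` via the
inclusion `K^(Q ∩ M) ⊆ K^Λ = V`. -/
noncomputable def subVariety (K : Type*) [Field K] (Q : Set (Fin n → ℝ)) :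
    Set (Projectivization K (P.Pts → K)) :=
  Projectivization.map
      (Function.ExtendByZero.linearMap K (Subtype.val : {χ : P.Pts // toReal χ.1 ∈ Q} → P.Pts))
      (Function.extend_injective Subtype.val_injective (0 : P.Pts → K)) ''
    toricVariety K (fun χ : {χ : P.Pts // toReal χ.1 ∈ Q} => P.pt χ.1)

/-- The weight monoid `S`, generated by the `(1, χ)`, `χ ∈ Λ`. -/
def weightMonoid : AddSubmonoid (ℤ × (Fin n → ℤ)) :=
  AddSubmonoid.closure (Set.range fun χ : P.Pts => ((1, P.pt χ) : ℤ × (Fin n → ℤ)))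

lemma exists_decomposition (s : P.weightMonoid) :
    ∃ a : P.Pts →₀ ℕ, (a.sum fun χ k => k • ((1, P.pt χ) : ℤ × (Fin n → ℤ))) = s.1 := by
  obtain ⟨a, ha⟩ := AddSubmonoid.exists_finsupp_of_mem_closure_range _ _ s.2
  exact ⟨a, ha.symm⟩

/-- The function `f_{m,η} = ∏ x_χ ^ a_χ` on `X̂_P` for a chosen decomposition
`(m, η) = ∑ a_χ (1, χ)`. -/
noncomputable def basisFun (K : Type*) [Field K] (s : P.weightMonoid) : CoordRing K P.pt :=
  P.thetaV K (monomial (P.exists_decomposition s).choose 1)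

/-- `(1, χ)` as an element of the weight monoid. -/
def degreeOne (χ : P.Pts) : P.weightMonoid :=
  ⟨(1, P.pt χ), AddSubmonoid.subset_closure ⟨χ, rfl⟩⟩

end NormalLatticePolytope

/-- A combinatorial Seshadri stratification on `X_P`: a choice, for every face `σ`, of an extremal
function on `X̂_P` that is a `T̂`-eigenfunction of positive degree whose normalized weight is a point
in the relative interior of `σ`. (The subvarieties of the stratification are the orbit closures
of the faces.) -/
structure CombinatorialSeshadriStratification (K : Type*) [Field K] [CharZero K]
    (P : NormalLatticePolytope n) where
  /-- The extremal function `f_σ`. -/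
  extremal : P.Face → CoordRing K P.pt
  /-- The `T̂`-weight `μ_σ = (-deg f_σ, μ̃_σ)`. -/
  weight : P.Face → ℤ × (Fin n → ℤ)
  extremal_ne_zero : ∀ σ, extremal σ ≠ 0
  isEigenfunction : ∀ σ, IsEigenfunction P.pt (weight σ) (extremal σ)
  degree_pos : ∀ σ, 1 ≤ -(weight σ).1
  mem_interior : ∀ σ : P.Face,
    (((-(weight σ).1 : ℤ) : ℝ)⁻¹ • toReal (-(weight σ).2)) ∈ intrinsicInterior ℝ σ.1

namespace CombinatorialSeshadriStratification

variable {K : Type*} [Field K] [CharZero K] {P : NormalLatticePolytope n}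
  (S : CombinatorialSeshadriStratification K P)

/-- `deg f_σ`. -/
def degree (σ : P.Face) : ℤ := -(S.weight σ).1

/-- The vertex `-μ_σ / deg f_σ` of the associated triangulation. -/
noncomputable def marking (σ : P.Face) : Fin n → ℝ :=
  ((S.degree σ : ℤ) : ℝ)⁻¹ • toReal (-(S.weight σ).2)

/-- The simplex `Δ_C` of the associated triangulation. -/
noncomputable def simplex (C : Flag P.Face) : Set (Fin n → ℝ) :=
  convexHull ℝ (S.marking '' (C : Set P.Face))

/-- The inclusion `M̂ → M̂_ℚ`. -/
def toRat : ℤ × (Fin n → ℤ) →+ ℚ × (Fin n → ℚ) :=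
  AddMonoidHom.prodMap (Int.castAddHom ℚ) ((Int.castAddHom ℚ).compLeft (Fin n))

open Classical in
/-- The coordinates of elements of `M̂_ℚ` with respect to the basis `(μ_σ)_{σ ∈ C}`. (For every
maximal chain `C` these weights do form a basis of `M̂_ℚ`; the value `0` is never used.) -/
noncomputable def chainCoord (C : Flag P.Face) :
    (ℚ × (Fin n → ℚ)) →ₗ[ℚ] ((C : Set P.Face) →₀ ℚ) :=
  if h : ∃ b : Module.Basis (C : Set P.Face) ℚ (ℚ × (Fin n → ℚ)), ∀ σ, b σ = toRat (S.weight σ.1)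
  then h.choose.repr.toLinearMap else 0

variable {N : ℕ} (t : P.Face ≃ Fin N)

open Classical in
/-- The vector `∑_{σ ∈ C} a_σ e_σ` of `ℚ^A` for a weight `∑_{σ ∈ C} a_σ μ_σ`. Via the enumeration
`t` of `A`, the space `ℚ^A` is identified with `ℚ^N`, ordered lexicographically
(the largest face comes first). -/
noncomputable def nuWeight (C : Flag P.Face) :
    ℤ × (Fin n → ℤ) →+ Lex (Fin N → ℚ) where
  toFun μ := toLex fun i =>
    if h : t.symm i ∈ (C : Set P.Face) then S.chainCoord C (toRat μ) ⟨t.symm i, h⟩ else 0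
  map_zero' := congrArg toLex (a₂ := (0 : Fin N → ℚ)) (_root_.funext fun i => by simp)
  map_add' μ μ' := by
    have h : ∀ x y z : Fin N → ℚ, (∀ i, x i = y i + z i) → toLex x = toLex y + toLex z :=
      fun x y z hxyz => congrArg toLex (a₂ := y + z) (_root_.funext hxyz)
    refine h _ _ _ fun i => ?_
    split_ifs <;> simp

/-- The valuation `ν_C` of a maximal chain `C`: the minimum over the weights occurring in `g`. -/
noncomputable def nuChain (C : Flag P.Face) (g : CoordRing K P.pt) :
    WithTop (Lex (Fin N → ℚ)) :=
  (eigenSupport P.pt g).inf fun μ => ((S.nuWeight t C μ : Lex (Fin N → ℚ)) : WithTop _)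

lemma le_nuChain_iff (C : Flag P.Face) (g : CoordRing K P.pt) (a : WithTop (Lex (Fin N → ℚ))) :
    a ≤ S.nuChain t C g ↔ ∀ μ ∈ eigenSupport P.pt g, a ≤ (S.nuWeight t C μ : WithTop _) :=
  Finset.le_inf_iff

open Classical in
/-- The function `ν = min_C ν_C`. -/
noncomputable def nuFun (g : CoordRing K P.pt) : WithTop (Lex (Fin N → ℚ)) :=
  letI := Fintype.ofFinite (Flag P.Face)
  Finset.univ.inf fun C : Flag P.Face => S.nuChain t C g

lemma le_nuFun_iff (g : CoordRing K P.pt) (a : WithTop (Lex (Fin N → ℚ))) :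
    a ≤ S.nuFun t g ↔ ∀ C, ∀ μ ∈ eigenSupport P.pt g, a ≤ (S.nuWeight t C μ : WithTop _) := by
  rw [nuFun, Finset.le_inf_iff]
  simp only [le_nuChain_iff, Finset.mem_univ, true_imp_iff]

/-- The quasi-valuation `ν` with values in `ℚ^A` associated to the stratification and to the
linearization `t` of `A`. -/
noncomputable def nu : QuasiValuation K (CoordRing K P.pt) (Lex (Fin N → ℚ)) where
  toFun := S.nuFun t
  eq_top_iff g := by
    constructor
    · intro h
      by_contra hg
      have hne : (eigenSupport P.pt g).Nonempty := by
        by_contra he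
        rw [Finset.not_nonempty_iff_eq_empty] at he
        rw [← sum_eigenComponent P.pt g, he, Finset.sum_empty] at hg
        exact hg rfl
      obtain ⟨μ, hμ⟩ := hne
      obtain ⟨C⟩ : Nonempty (Flag P.Face) := inferInstance
      have := (S.le_nuFun_iff t g ⊤).mp h.ge C μ hμ
      simp at this
    · rintro rfl
      refine top_le_iff.mp ((S.le_nuFun_iff t _ _).mpr fun C μ hμ => ?_)
      simp [mem_eigenSupport] at hμ
  min_le_add g h := by
    refine (S.le_nuFun_iff t _ _).mpr fun C μ hμ => ?_
    rcases eigenSupport_add _ hμ with h1 | h1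
    · exact (min_le_left _ _).trans ((S.le_nuFun_iff t g _).mp le_rfl C μ h1)
    · exact (min_le_right _ _).trans ((S.le_nuFun_iff t h _).mp le_rfl C μ h1)
  smul c g hc := by
    refine le_antisymm ?_ ?_
    · refine (S.le_nuFun_iff t _ _).mpr fun C μ hμ => ?_
      refine (S.le_nuFun_iff t (c • g) _).mp le_rfl C μ ?_
      refine eigenSupport_smul P.pt (c := c⁻¹) ?_
      rwa [smul_smul, inv_mul_cancel₀ hc, one_smul]
    · exact (S.le_nuFun_iff t _ _).mpr fun C μ hμ =>
        (S.le_nuFun_iff t g _).mp le_rfl C μ (eigenSupport_smul P.pt hμ)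
  add_le_mul g h := by
    refine (S.le_nuFun_iff t _ _).mpr fun C μ hμ => ?_
    obtain ⟨μ₁, h₁, μ₂, h₂, rfl⟩ := eigenSupport_mul _ hμ
    rw [map_add, WithTop.coe_add]
    exact add_le_add ((S.le_nuFun_iff t g _).mp le_rfl C μ₁ h₁)
      ((S.le_nuFun_iff t h _).mp le_rfl C μ₂ h₂)
  zero_le_one := by
    refine (S.le_nuFun_iff t _ _).mpr fun C μ hμ => ?_
    rw [eigenSupport_one _ hμ, _root_.map_zero, WithTop.coe_zero]

/-! The two presentations attached to a generating system: the variables are indexed by `Λ` (the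
degree one functions) and by a finite set `H` of further elements of the weight monoid. -/

variable (H : Finset P.weightMonoid)

/-- The elements `(m_i, χ_i)` of the weight monoid. -/
def gen : P.Pts ⊕ H → P.weightMonoid := Sum.elim P.degreeOne Subtype.val

variable {H} in
/-- The classes `f̄_{m_i, χ_i}` in the associated graded algebra. -/
noncomputable def genClass (i : P.Pts ⊕ H) : (S.nu t).Gr :=
  (S.nu t).symb (P.basisFun K (gen H i))

variable (K) in
/-- `θ : K[x_1, …, x_p] → K[X̂_P]`, `x_i ↦ f_{m_i, χ_i}`. -/
noncomputable def theta : MvPolynomial (P.Pts ⊕ H) K →ₐ[K] CoordRing K P.pt :=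
  aeval fun i => P.basisFun K (gen H i)

/-- `θ̄ : K[x_1, …, x_p] → gr_ν K[X̂_P]`, `x_i ↦ f̄_{m_i, χ_i}`. -/
noncomputable def thetaBar : MvPolynomial (P.Pts ⊕ H) K →ₐ[K] (S.nu t).Gr :=
  aeval fun i => S.genClass t i

/-- The map `deg_A`, which sends `x_i` to `(m_i, ν(f_{m_i, χ_i}))`. Values are compared first by
the total degree, then by the reversed order of `ℚ^A`. -/
noncomputable def degA (α : (P.Pts ⊕ H) →₀ ℕ) : Lex (ℤ × (Lex (Fin N → ℚ))ᵒᵈ) :=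
  toLex (α.sum fun i k => k • (gen H i).1.1,
    OrderDual.toDual (α.sum fun i k => k • (S.nu t).value (P.basisFun K (gen H i))))

end CombinatorialSeshadriStratification

end Polytope

end SeshadriToric

namespace SeshadriToric

open MvPolynomial
open scoped Pointwise

/-! ### Farkas' lemma for finitely generated cones -/

/-! The coordinate ring behaves like a semigroup algebra: the monomials of weight (-m, -η) all have
the class f_s, s = (m, η), and an element is determined by its coefficients at the characters. So
everything reduces to comparing exponents.

Geometry of the triangulation: for a flag C the vectors (1, u_σ), σ ∈ C, form a basis of ℝ × ℝ^n
(`linearIndependent_flag`, `span_flag`), and the simplices of the flags cover P (`exists_flag`). If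
τ is not in C, the leading coordinate of (1, u_τ) in this basis is positive and sits at a face
larger than τ (`coord_flag`). As larger faces come first in the lexicographic order, e_τ ≤ ν_C(f_τ),
with equality for τ ∈ C (`single_le_nuWeight`). Hence among all ν_C(f_s) the smallest value is
attained exactly by the flags whose cone contains s (`InCone.nuWeight_le`, `InCone.of_nuWeight_eq`).

Algebra: the values of the factors of a monomial add up to at most the value of the product, with
equality exactly for standard monomials, whose factors lie in a common cone (`isStandard_iff`). Thus
ker θ̄ is spanned by the nonstandard monomials and the differences of standard monomials of equal
weight (`mem_ker_thetaBar_iff`), and it equals in_ν(ker θ) (`initialIdeal_degA`), hence in_λ(ker θ).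

In the degree one variables, ker θ̄ ∩ K[x_1, …, x_r] is the ideal of polynomials vanishing on the
torus orbits of all simplices, so it is radical (`isRadical_kerBar`). It contains in_{λ†} I(X_P).
Conversely, its binomials already lie in the initial ideal, while for a nonstandard monomial x^α
only a power need do so: the standard monomial of the same weight may involve generators of higher
degree, but some multiple of the weight is a combination of vertices u_σ, which are variables of
degree one because the extremal functions are linear (`monomial_mem_radical`). This proves (i). A
point killed by all nonstandard monomials has its nonzero coordinates in one simplex and satisfies
the binomial equations there (`zeroLocus_kerBar`), which proves (ii). -/

lemma farkas {ι V : Type*} [AddCommGroup V] [Module ℝ V] (s : Finset ι) :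
    ∀ (v : ι → V) (b : V), (∃ c : ι → ℝ, (∀ i ∈ s, 0 ≤ c i) ∧ ∑ i ∈ s, c i • v i = b) ∨
      ∃ g : V →ₗ[ℝ] ℝ, (∀ i ∈ s, 0 ≤ g (v i)) ∧ g b < 0 := by
  classical
  induction s using Finset.induction_on with
  | empty =>
    intro v b
    by_cases hb : b = 0
    · exact Or.inl ⟨0, by simp, by simp [hb]⟩
    · obtain ⟨g, hg⟩ : ∃ g : Module.Dual ℝ V, g b ≠ 0 := by
        by_contra! h
        exact hb ((Module.forall_dual_apply_eq_zero_iff ℝ b).mp h)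
      refine Or.inr ⟨-(g b) • g, by simp, ?_⟩
      have := mul_self_pos.mpr hg
      simpa using this
  | insert k s hk ih =>
    intro v b
    rcases ih v b with ⟨c, hc, hcb⟩ | ⟨g, hg, hgb⟩
    · refine Or.inl ⟨Function.update c k 0, ?_, ?_⟩
      · intro i hi
        rcases eq_or_ne i k with rfl | hik
        · simp
        · rw [Function.update_of_ne hik]
          exact hc i ((Finset.mem_insert.mp hi).resolve_left hik)
      · rw [Finset.sum_insert hk, Function.update_self, zero_smul, zero_add, ← hcb]
        refine Finset.sum_congr rfl fun i hi => ?_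
        rw [Function.update_of_ne (ne_of_mem_of_not_mem hi hk)]
    · by_cases hgk : 0 ≤ g (v k)
      · refine Or.inr ⟨g, fun i hi => ?_, hgb⟩
        rcases Finset.mem_insert.mp hi with rfl | hi
        · exact hgk
        · exact hg i hi
      · rw [not_le] at hgk
        -- Project along `v k` onto the kernel of `g` and use the induction hypothesis there. A
        -- conic combination lifts, the new coefficient of `v k` being nonnegative because `g b` and
        -- `g (v k)` are negative; a separating functional pulls back along `q`, which kills `v k`.
        let q : V →ₗ[ℝ] V := LinearMap.id - ((g (v k))⁻¹ • g).smulRight (v k)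
        have hq : ∀ x, q x = x - ((g (v k))⁻¹ * g x) • v k := fun x => by simp [q]
        rcases ih (fun i => q (v i)) (q b) with ⟨c, hc, hcb⟩ | ⟨h, hh, hhb⟩
        · have hcb' : ∑ i ∈ s, c i • v i +
              ((g (v k))⁻¹ * g b - ∑ i ∈ s, c i * ((g (v k))⁻¹ * g (v i))) • v k = b := by
            simp only [hq, smul_sub, Finset.sum_sub_distrib, smul_smul] at hcb
            rw [← Finset.sum_smul] at hcb
            rw [sub_smul, ← add_sub_assoc, add_sub_right_comm, hcb, sub_add_cancel]
          refine Or.inl ⟨Function.update c k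
            ((g (v k))⁻¹ * g b - ∑ i ∈ s, c i * ((g (v k))⁻¹ * g (v i))), ?_, ?_⟩
          · intro i hi
            rcases eq_or_ne i k with rfl | hik
            · rw [Function.update_self, sub_nonneg]
              refine (Finset.sum_nonpos fun j hj => ?_).trans
                (mul_pos_of_neg_of_neg (inv_lt_zero.mpr hgk) hgb).le
              exact mul_nonpos_of_nonneg_of_nonpos (hc j hj)
                (mul_nonpos_of_nonpos_of_nonneg (inv_lt_zero.mpr hgk).le (hg j hj))
            · rw [Function.update_of_ne hik]
              exact hc i ((Finset.mem_insert.mp hi).resolve_left hik)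
          · rw [Finset.sum_insert hk, Function.update_self]
            conv_rhs => rw [← hcb']
            rw [add_comm]
            congr 1
            refine Finset.sum_congr rfl fun i hi => ?_
            rw [Function.update_of_ne (ne_of_mem_of_not_mem hi hk)]
        · refine Or.inr ⟨h ∘ₗ q, fun i hi => ?_, hhb⟩
          rcases Finset.mem_insert.mp hi with rfl | hi
          · rw [LinearMap.comp_apply, hq, inv_mul_cancel₀ hgk.ne, one_smul, sub_self, map_zero]
          · exact hh i hi

namespace NormalLatticePolytope

variable {n : ℕ} (P : NormalLatticePolytope n)

/-! ### Faces of a polytope in terms of linear functionals on `ℝ × ℝ^n` -/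

lemma carrier_nonempty : P.carrier.Nonempty := by
  by_contra h
  rw [Set.not_nonempty_iff_eq_empty] at h
  have := P.full_dim
  rw [h, AffineSubspace.span_empty] at this
  exact bot_ne_top this

lemma convex_carrier : Convex ℝ P.carrier := by
  obtain ⟨F, hF⟩ := P.lattice
  exact hF ▸ convex_convexHull ℝ _

lemma isCompact_carrier : IsCompact P.carrier := by
  obtain ⟨F, hF⟩ := P.lattice
  exact hF ▸ (F.finite_toSet.image _).isCompact_convexHull ℝ

lemma exists_finset : ∃ F : Finset (Fin n → ℝ), P.carrier = convexHull ℝ (F : Set (Fin n → ℝ)) := by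
  classical
  obtain ⟨F, hF⟩ := P.lattice
  exact ⟨F.image toReal, by rw [hF, Finset.coe_image]⟩

lemma convex_nonneg (g : ℝ × (Fin n → ℝ) →ₗ[ℝ] ℝ) : Convex ℝ {x | 0 ≤ g (1, x)} := by
  intro x hx y hy a b ha hb hab
  have : ((1, a • x + b • y) : ℝ × (Fin n → ℝ)) = a • (1, x) + b • (1, y) := by
    ext <;> simp [hab]
  simp only [Set.mem_ofPred_eq] at *
  rw [this, map_add, map_smul, map_smul, smul_eq_mul, smul_eq_mul]
  positivity

variable {P}

/-- Placing the polytope at height 1 turns affine functionals into linear ones. The face is the set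
where some `l` attains its maximum, so the defect `l y - l x` for a point `y` of the face cuts it
out. -/
lemma exists_functional (σ : P.Face) : ∃ g : ℝ × (Fin n → ℝ) →ₗ[ℝ] ℝ,
    (∀ x ∈ P.carrier, 0 ≤ g (1, x)) ∧ ∀ x ∈ P.carrier, x ∈ σ.1 ↔ g (1, x) = 0 := by
  obtain ⟨l, hl⟩ := σ.2.2 σ.2.1
  obtain ⟨y, hy⟩ := σ.2.1
  rw [hl] at hy
  have hg : ∀ x, ((l y) • LinearMap.fst ℝ ℝ (Fin n → ℝ) -
      (l : (Fin n → ℝ) →ₗ[ℝ] ℝ) ∘ₗ LinearMap.snd ℝ ℝ (Fin n → ℝ)) (1, x) = l y - l x := by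
    intro x
    simp
  refine ⟨(l y) • LinearMap.fst ℝ ℝ (Fin n → ℝ) -
    (l : (Fin n → ℝ) →ₗ[ℝ] ℝ) ∘ₗ LinearMap.snd ℝ ℝ (Fin n → ℝ), fun x hx => ?_, fun x hx => ?_⟩
  · rw [hg, sub_nonneg]
    exact hy.2 x hx
  · rw [hg, sub_eq_zero, hl]
    exact ⟨fun h => le_antisymm (h.2 y hy.1) (hy.2 x hx),
      fun h => ⟨hx, fun z hz => h ▸ hy.2 z hz⟩⟩

lemma exists_face (g : ℝ × (Fin n → ℝ) →ₗ[ℝ] ℝ) (hg : ∀ x ∈ P.carrier, 0 ≤ g (1, x))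
    {y : Fin n → ℝ} (hy : y ∈ P.carrier) (hgy : g (1, y) = 0) :
    ∃ σ : P.Face, ∀ x, x ∈ σ.1 ↔ x ∈ P.carrier ∧ g (1, x) = 0 := by
  refine ⟨⟨{x | x ∈ P.carrier ∧ g (1, x) = 0}, ⟨y, hy, hgy⟩, fun _ => ?_⟩, fun x => Iff.rfl⟩
  have h1 : ∀ x, g (1, x) = g (1, 0) + g (0, x) := fun x => by
    rw [← map_add]
    simp
  refine ⟨-LinearMap.toContinuousLinearMap (g ∘ₗ LinearMap.inr ℝ ℝ (Fin n → ℝ)), ?_⟩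
  ext x
  simp only [Set.mem_ofPred_eq, neg_apply,
    LinearMap.coe_toContinuousLinearMap', LinearMap.comp_apply, LinearMap.inr_apply, neg_le_neg_iff]
  refine and_congr_right fun hx => ⟨fun h z hz => ?_, fun h => ?_⟩
  · have := hg z hz
    rw [h1] at this h
    linarith
  · have h2 := hg x hx
    have h3 := h y hy
    rw [h1] at h2 hgy ⊢
    linarith

lemma Face.subset (σ : P.Face) : σ.1 ⊆ P.carrier := σ.2.2.subset

/-- A functional which is nonnegative on the vertices of a face `σ` defines a face of `σ`. -/
lemma exists_subface {F : Finset (Fin n → ℝ)} (hF : P.carrier = convexHull ℝ (F : Set (Fin n → ℝ)))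
    (σ : P.Face) (g : ℝ × (Fin n → ℝ) →ₗ[ℝ] ℝ) (hg : ∀ v ∈ F, v ∈ σ.1 → 0 ≤ g (1, v)) :
    (∀ x ∈ σ.1, 0 ≤ g (1, x)) ∧ ∀ y ∈ σ.1, g (1, y) = 0 →
      ∃ τ : P.Face, ∀ x, x ∈ τ.1 ↔ x ∈ σ.1 ∧ g (1, x) = 0 := by
  obtain ⟨h, hh, hσ⟩ := exists_functional σ
  have hFP : ∀ v ∈ F, v ∈ P.carrier := fun v hv => hF ▸ subset_convexHull ℝ _ hv
  obtain ⟨c, hc⟩ : ∃ c : ℝ, ∀ v ∈ F, 0 ≤ g (1, v) + c * h (1, v) := by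
    obtain ⟨c, hc⟩ := (F.image fun v => -g (1, v) / h (1, v)).exists_le
    refine ⟨c, fun v hv => ?_⟩
    rcases (hh v (hFP v hv)).eq_or_lt with h0 | h0
    · rw [← h0, mul_zero, add_zero]
      exact hg v hv ((hσ v (hFP v hv)).mpr h0.symm)
    · have := hc _ (Finset.mem_image_of_mem _ hv)
      rw [div_le_iff₀ h0] at this
      linarith
  have hG : ∀ x ∈ P.carrier, 0 ≤ (g + c • h) (1, x) := by
    intro x hx
    rw [hF] at hx
    exact convexHull_min (fun v hv => by simpa using hc v hv) (convex_nonneg (g + c • h)) hx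
  -- One further copy of `h` forces the zero set of the sum to lie in `σ`.
  have hG' : ∀ x ∈ P.carrier, 0 ≤ (g + (c + 1) • h) (1, x) := by
    intro x hx
    have h1 := hG x hx
    have h2 := hh x hx
    simp only [LinearMap.add_apply, LinearMap.smul_apply, smul_eq_mul] at h1 ⊢
    linarith
  have hGσ : ∀ x ∈ σ.1, ∀ c : ℝ, (g + c • h) (1, x) = g (1, x) := by
    intro x hx c
    simp [(hσ x (σ.subset hx)).mp hx]
  refine ⟨fun x hx => hGσ x hx c ▸ hG x (σ.subset hx), fun y hy hgy => ?_⟩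
  obtain ⟨τ, hτ⟩ := exists_face _ hG' (σ.subset hy) ((hGσ y hy _).trans hgy)
  refine ⟨τ, fun x => (hτ x).trans ⟨fun hx => ?_, fun hx => ?_⟩⟩
  · have hxσ : x ∈ σ.1 := by
      refine (hσ x hx.1).mpr (le_antisymm ?_ (hh x hx.1))
      have h1 := hG x hx.1
      have h2 := hx.2
      simp only [LinearMap.add_apply, LinearMap.smul_apply, smul_eq_mul] at h1 h2
      linarith
    exact ⟨hxσ, hGσ x hxσ _ ▸ hx.2⟩
  · exact ⟨σ.subset hx.1, (hGσ x hx.1 _).trans hx.2⟩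

end NormalLatticePolytope
end SeshadriToric

/-! ### Marked points of the faces in a flag -/

namespace SeshadriToric

open MvPolynomial
open scoped Pointwise

/-- The line through `y` and `x` stays in the affine span of `A`, in which `x` is an interior point,
so the segment can be prolonged beyond `x`. -/
lemma exists_add_smul_mem {n : ℕ} {A : Set (Fin n → ℝ)} {x y : Fin n → ℝ}
    (hx : x ∈ intrinsicInterior ℝ A) (hy : y ∈ A) : ∃ ε : ℝ, 0 < ε ∧ x + ε • (x - y) ∈ A := by
  obtain ⟨x', hx', rfl⟩ := mem_intrinsicInterior.mp hx
  let f : ℝ → affineSpan ℝ A := fun t => ⟨AffineMap.lineMap (x' : Fin n → ℝ) y (-t),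
    AffineMap.lineMap_mem _ x'.2 (subset_affineSpan ℝ A hy)⟩
  have hf : Continuous f := by
    rw [continuous_induced_rng]
    change Continuous fun t : ℝ => AffineMap.lineMap (x' : Fin n → ℝ) y (-t)
    simp only [AffineMap.lineMap_apply_module]
    fun_prop
  have h0 : f 0 ∈ interior ((↑) ⁻¹' A : Set (affineSpan ℝ A)) := by simpa [f] using hx'
  obtain ⟨ε, hε, hb⟩ := Metric.mem_nhds_iff.mp
    (hf.continuousAt.preimage_mem_nhds (isOpen_interior.mem_nhds h0))
  refine ⟨ε / 2, half_pos hε, ?_⟩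
  have h2 : ε / 2 ∈ Metric.ball (0 : ℝ) ε := by
    rw [Metric.mem_ball, dist_zero_right, Real.norm_eq_abs, abs_of_pos (half_pos hε)]
    exact half_lt_self hε
  have h3 : f (ε / 2) ∈ ((↑) ⁻¹' A : Set (affineSpan ℝ A)) := interior_subset (hb h2)
  change AffineMap.lineMap (x' : Fin n → ℝ) y (-(ε / 2)) ∈ A at h3
  rw [AffineMap.lineMap_apply_module] at h3
  convert h3 using 1
  module

namespace NormalLatticePolytope

variable {n : ℕ} {P : NormalLatticePolytope n}

lemma Face.isCompact (σ : P.Face) : IsCompact σ.1 := σ.2.2.isCompact P.isCompact_carrier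

lemma Face.convex (σ : P.Face) : Convex ℝ σ.1 := σ.2.2.convex P.convex_carrier

/-- A point in the relative interior of a face `σ` lies in no face which does not contain `σ`. -/
lemma Face.le_of_mem_intrinsicInterior {σ τ : P.Face} {x : Fin n → ℝ}
    (hx : x ∈ intrinsicInterior ℝ σ.1) (hτ : x ∈ τ.1) : σ ≤ τ := by
  intro y hy
  obtain ⟨g, hg, hgτ⟩ := exists_functional τ
  obtain ⟨ε, hε, hz⟩ := exists_add_smul_mem hx hy
  -- The functional of `τ` vanishes at `x`, so at the prolonged point it equals `-ε * g (1, y)`.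
  -- Both this and `g (1, y)` are nonnegative.
  have h1 := hg _ (σ.subset hz)
  have h2 := hg _ (σ.subset hy)
  have h3 := (hgτ x (τ.subset hτ)).mp hτ
  have h4 : ((1, x + ε • (x - y)) : ℝ × (Fin n → ℝ)) = (1 + ε) • (1, x) - ε • (1, y) := by
    ext
    · simp
    · simp
      ring
  rw [h4, map_sub, map_smul, map_smul, h3, smul_zero, zero_sub, smul_eq_mul] at h1
  exact (hgτ y (σ.subset hy)).mpr (le_antisymm (by nlinarith) h2)

section Marking

/-! In this section `u σ` is a point of the face `σ` which lies in no proper subface of `σ`. -/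

variable {u : P.Face → Fin n → ℝ}

/-- The hyperplane `l = 0` is turned within the pencil `l + t • m` until it first meets a point of
`F` in `σ` where `m` is negative, which happens at the smallest ratio `l / -m`. The resulting
hyperplane supports `σ`, contains the old subface and a point with `l ≠ 0`, and avoids `u σ` since
`m` vanishes there. -/
lemma exists_lt_face_of_neg (hu : ∀ σ : P.Face, u σ ∈ σ.1) {F : Finset (Fin n → ℝ)}
    (hF : P.carrier = convexHull ℝ (F : Set (Fin n → ℝ))) {σ : P.Face}
    {l m : ℝ × (Fin n → ℝ) →ₗ[ℝ] ℝ} (hl : ∀ x ∈ σ.1, 0 ≤ l (1, x))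
    (hm : ∀ x ∈ σ.1, l (1, x) = 0 → m (1, x) = 0) (hlu : 0 < l (1, u σ)) (hmu : m (1, u σ) = 0)
    (hv : ∃ v ∈ F, v ∈ σ.1 ∧ m (1, v) < 0) :
    ∃ τ < σ, (∀ x ∈ σ.1, l (1, x) = 0 → x ∈ τ.1) ∧ ∃ v ∈ τ.1, l (1, v) ≠ 0 := by
  classical
  obtain ⟨v, hvF, hvσ, hvm⟩ := hv
  obtain ⟨v₀, hv₀, hmin⟩ := (F.filter fun v => v ∈ σ.1 ∧ m (1, v) < 0).exists_min_image
    (fun v => l (1, v) / -m (1, v)) ⟨v, Finset.mem_filter.mpr ⟨hvF, hvσ, hvm⟩⟩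
  obtain ⟨-, h₀σ, h₀m⟩ := Finset.mem_filter.mp hv₀
  set t := l (1, v₀) / -m (1, v₀) with ht
  have ht0 : 0 ≤ t := div_nonneg (hl _ h₀σ) (neg_pos.mpr h₀m).le
  have hg : ∀ x, (l + t • m) (1, x) = l (1, x) + t * m (1, x) := fun x => by simp
  have h₀ : (l + t • m) (1, v₀) = 0 := by
    rw [hg, ht, div_neg, neg_mul, div_mul_cancel₀ _ h₀m.ne, add_neg_cancel]
  obtain ⟨-, h⟩ := exists_subface hF σ (l + t • m) fun v hv hvσ => by
    rw [hg]
    rcases le_or_gt 0 (m (1, v)) with h | h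
    · have := hl v hvσ
      positivity
    · have := hmin v (Finset.mem_filter.mpr ⟨hv, hvσ, h⟩)
      rw [le_div_iff₀ (neg_pos.mpr h)] at this
      linarith
  obtain ⟨τ, hτ⟩ := h v₀ h₀σ h₀
  refine ⟨τ, lt_of_le_of_ne (fun x hx => ((hτ x).mp hx).1) ?_, fun x hx hlx => ?_, v₀, ?_, ?_⟩
  · rintro rfl
    have := ((hτ _).mp (hu τ)).2
    rw [hg, hmu, mul_zero, add_zero] at this
    exact hlu.ne' this
  · exact (hτ x).mpr ⟨hx, by rw [hg, hlx, hm x hx hlx, mul_zero, add_zero]⟩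
  · exact (hτ _).mpr ⟨h₀σ, h₀⟩
  · exact fun h => h₀m.ne (hm _ h₀σ h)

/-- If a functional `m` vanishes on the subface `{l = 0}` of `σ` and at `u σ`, but not on `σ`, then
there is a face strictly between `{l = 0}` and `σ`. -/
lemma exists_lt_face (hu : ∀ σ : P.Face, u σ ∈ σ.1) {σ : P.Face}
    {l m : ℝ × (Fin n → ℝ) →ₗ[ℝ] ℝ} (hl : ∀ x ∈ σ.1, 0 ≤ l (1, x))
    (hm : ∀ x ∈ σ.1, l (1, x) = 0 → m (1, x) = 0) (hlu : 0 < l (1, u σ)) (hmu : m (1, u σ) = 0)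
    {x : Fin n → ℝ} (hx : x ∈ σ.1) (hmx : m (1, x) ≠ 0) :
    ∃ τ < σ, (∀ x ∈ σ.1, l (1, x) = 0 → x ∈ τ.1) ∧ ∃ v ∈ τ.1, l (1, v) ≠ 0 := by
  obtain ⟨F, hF⟩ := P.exists_finset
  by_cases h1 : ∃ v ∈ F, v ∈ σ.1 ∧ m (1, v) < 0
  · exact exists_lt_face_of_neg hu hF hl hm hlu hmu h1
  by_cases h2 : ∃ v ∈ F, v ∈ σ.1 ∧ (-m) (1, v) < 0
  · exact exists_lt_face_of_neg hu hF hl (fun x hx h => by simpa using hm x hx h) hlu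
      (by simpa using hmu) h2
  push Not at h1 h2
  have h3 := (exists_subface hF σ m h1).1 x hx
  have h4 := (exists_subface hF σ (-m) h2).1 x hx
  exact absurd (le_antisymm (by simpa using h4) h3) hmx

/-- For a face `σ` in a flag, a functional defining the next smaller face of the flag. -/
lemma exists_functional_flag (C : Flag P.Face) {σ : P.Face} :
    ∃ l : ℝ × (Fin n → ℝ) →ₗ[ℝ] ℝ, (∀ x ∈ P.carrier, 0 ≤ l (1, x)) ∧
      (∀ ρ ∈ C, ρ < σ → ∀ x ∈ ρ.1, l (1, x) = 0) ∧
      ∀ x ∈ P.carrier, (∀ ρ ∈ C, ρ < σ → x ∉ ρ.1) → 0 < l (1, x) := by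
  rcases Set.eq_empty_or_nonempty {ρ | ρ ∈ C ∧ ρ < σ} with he | hne
  -- With no member of the flag below `σ`, the subface to be cut out is empty, and the height,
  -- constantly 1 on the polytope, does it.
  · refine ⟨LinearMap.fst ℝ ℝ _, fun x _ => by simp, fun ρ hρ hρσ => ?_, fun x _ _ => by simp⟩
    exact absurd (show ρ ∈ {ρ | ρ ∈ C ∧ ρ < σ} from ⟨hρ, hρσ⟩) (he ▸ Set.notMem_empty ρ)
  · obtain ⟨ρ₀, hρ₀⟩ := (Set.toFinite {ρ | ρ ∈ C ∧ ρ < σ}).exists_maximal hne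
    obtain ⟨l, hl, hlρ⟩ := exists_functional ρ₀
    refine ⟨l, hl, fun ρ hρ hρσ x hx => ?_, fun x hx h => ?_⟩
    · have : ρ ≤ ρ₀ := (C.le_or_le hρ hρ₀.1.1).elim id fun h => hρ₀.2 ⟨hρ, hρσ⟩ h
      exact (hlρ x (ρ.subset hx)).mp (this hx)
    · exact (hl x hx).lt_of_ne' fun h0 => h ρ₀ hρ₀.1.1 hρ₀.1.2 ((hlρ x hx).mpr h0)

/-- A functional vanishing at the marked points of the faces `ρ ≤ σ` of a flag vanishes on `σ`. -/
lemma eq_zero_of_flag (hu : ∀ σ : P.Face, u σ ∈ σ.1) (hu' : ∀ σ τ : P.Face, u σ ∈ τ.1 → σ ≤ τ)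
    (C : Flag P.Face) {m : ℝ × (Fin n → ℝ) →ₗ[ℝ] ℝ} (σ : P.Face) (hσ : σ ∈ C)
    (hm : ∀ ρ ∈ C, ρ ≤ σ → m (1, u ρ) = 0) : ∀ x ∈ σ.1, m (1, x) = 0 := by
  induction σ using WellFoundedLT.induction with
  | ind σ ih =>
    intro x hx
    obtain ⟨l, hl, hl0, hl1⟩ := exists_functional_flag C (σ := σ)
    by_contra hmx
    obtain ⟨τ, hτσ, hlτ, v, hvτ, hlv⟩ := exists_lt_face hu (l := l) (m := m) (σ := σ)
      (fun x hx => hl x (σ.subset hx)) (fun y hy hly => by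
        by_contra hmy
        refine (hl1 y (σ.subset hy) fun ρ hρ hρσ hyρ => hmy ?_).ne' hly
        exact ih ρ hρσ hρ (fun π hπ hπρ => hm π hπ (hπρ.trans hρσ.le)) y hyρ)
      (hl1 _ (σ.subset (hu σ)) fun ρ _ hρσ hρ => (hu' σ ρ hρ).not_gt hρσ) (hm σ hσ le_rfl) hx hmx
    -- The face `τ` contains the members of the flag below `σ` and is contained in all others. By
    -- maximality it belongs to the flag, so `l` vanishes on it.
    refine hlv (hl0 τ (Flag.mem_iff_forall_le_or_ge.mpr fun ρ hρ => ?_) hτσ v hvτ)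
    by_cases hρσ : ρ < σ
    · exact Or.inr fun y hy => hlτ y (hρσ.le hy) (hl0 ρ hρ hρσ y hy)
    · exact Or.inl (hτσ.le.trans
        ((C.le_or_le hσ hρ).elim id fun h => (eq_of_le_of_not_lt h hρσ).ge))

lemma mem_span_flag (hu : ∀ σ : P.Face, u σ ∈ σ.1) (hu' : ∀ σ τ : P.Face, u σ ∈ τ.1 → σ ≤ τ)
    (C : Flag P.Face) {σ : P.Face} (hσ : σ ∈ C) {x : Fin n → ℝ} (hx : x ∈ σ.1) :
    ((1, x) : ℝ × (Fin n → ℝ)) ∈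
      Submodule.span ℝ (Set.range fun ρ : (C : Set P.Face) => ((1, u ρ) : ℝ × (Fin n → ℝ))) := by
  by_contra h
  obtain ⟨m, hm, hle⟩ := Submodule.exists_le_ker_of_notMem h
  exact hm (eq_zero_of_flag hu hu' C σ hσ
    (fun ρ hρ _ => hle (Submodule.subset_span ⟨⟨ρ, hρ⟩, rfl⟩)) x hx)

lemma exists_top_mem (C : Flag P.Face) : ∃ σ ∈ C, σ.1 = P.carrier := by
  obtain ⟨y, hy⟩ := P.carrier_nonempty
  obtain ⟨σ, hσ⟩ := exists_face (P := P) 0 (fun _ _ => le_rfl) hy rfl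
  have h : σ.1 = P.carrier := Set.ext fun x => (hσ x).trans (and_iff_left rfl)
  exact ⟨σ, Flag.mem_iff_forall_le_or_ge.mpr fun ρ _ => Or.inr (ρ.subset.trans h.ge), h⟩

/-- The polytope itself is the largest member of every flag. A functional killing all marked points
thus vanishes on the polytope, hence on its affine span, which is everything. -/
lemma span_flag (hu : ∀ σ : P.Face, u σ ∈ σ.1) (hu' : ∀ σ τ : P.Face, u σ ∈ τ.1 → σ ≤ τ)
    (C : Flag P.Face) :
    Submodule.span ℝ (Set.range fun ρ : (C : Set P.Face) => ((1, u ρ) : ℝ × (Fin n → ℝ))) = ⊤ := by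
  by_contra h
  obtain ⟨m, hm, hle⟩ := Submodule.exists_le_ker_of_lt_top _ (lt_top_iff_ne_top.mpr h)
  obtain ⟨σ, hσ, hσP⟩ := exists_top_mem C
  have h0 : ∀ x ∈ P.carrier, m (1, x) = 0 := fun x hx =>
    hle (mem_span_flag hu hu' C hσ (hσP.ge hx))
  let f : (Fin n → ℝ) →ᵃ[ℝ] ℝ := AffineMap.const ℝ _ (m (1, 0)) +
    (m ∘ₗ LinearMap.inr ℝ ℝ (Fin n → ℝ)).toAffineMap
  have hf : ∀ x, f x = m (1, x) := fun x => by
    simp only [f, AffineMap.coe_add, Pi.add_apply, AffineMap.const_apply, LinearMap.coe_toAffineMap,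
      LinearMap.comp_apply, LinearMap.inr_apply, ← map_add]
    simp
  have hf0 : ∀ x, f x = 0 := by
    have h1 : affineSpan ℝ P.carrier ≤ (AffineSubspace.mk' (0 : ℝ) ⊥).comap f := by
      refine affineSpan_le.mpr fun x hx => ?_
      simp [hf, h0 x hx]
    rw [P.full_dim] at h1
    intro x
    have := h1 (AffineSubspace.mem_top ℝ _ x)
    simpa using this
  refine hm (LinearMap.ext fun z => ?_)
  have h1 : z = z.1 • ((1, 0) : ℝ × (Fin n → ℝ)) + ((1, z.2) - (1, 0)) := by
    ext <;> simp
  rw [h1, map_add, map_smul, map_sub, ← hf, ← hf, hf0, hf0]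
  simp

/-- The triangularity behind independence and the sign of leading coordinates: `l` kills the marked
points below `σ`, and the coefficients above `σ` are zero. -/
lemma apply_sum_flag (C : Flag P.Face) [Fintype (C : Set P.Face)]
    (hu : ∀ σ : P.Face, u σ ∈ σ.1)
    {σ : (C : Set P.Face)} {l : ℝ × (Fin n → ℝ) →ₗ[ℝ] ℝ}
    (hl : ∀ ρ ∈ C, ρ < σ.1 → ∀ x ∈ ρ.1, l (1, x) = 0) {c : ↥(C : Set P.Face) → ℝ}
    (hc : ∀ ρ, σ < ρ → c ρ = 0) :
    l (∑ ρ, c ρ • ((1, u ρ) : ℝ × (Fin n → ℝ))) = c σ * l (1, u σ) := by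
  rw [map_sum, Finset.sum_eq_single σ]
  · rw [map_smul, smul_eq_mul]
  · intro ρ _ hρ
    rw [map_smul, smul_eq_mul]
    rcases (C.le_or_le ρ.2 σ.2) with h | h
    · rw [hl ρ ρ.2 (lt_of_le_of_ne h fun h' => hρ (Subtype.ext h')) _ (hu _), mul_zero]
    · rw [hc ρ (lt_of_le_of_ne h fun h' => hρ h'.symm), zero_mul]
  · simp

lemma linearIndependent_flag (hu : ∀ σ : P.Face, u σ ∈ σ.1)
    (hu' : ∀ σ τ : P.Face, u σ ∈ τ.1 → σ ≤ τ) (C : Flag P.Face) :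
    LinearIndependent ℝ fun ρ : (C : Set P.Face) => ((1, u ρ) : ℝ × (Fin n → ℝ)) := by
  have := Fintype.ofFinite (C : Set P.Face)
  refine Fintype.linearIndependent_iff.mpr fun c hc σ => ?_
  induction σ using WellFoundedGT.induction with
  | ind σ ih =>
    obtain ⟨l, hl, hl0, hl1⟩ := exists_functional_flag C (σ := σ.1)
    have h := apply_sum_flag C hu hl0 ih
    rw [hc, map_zero] at h
    exact (mul_eq_zero.mp h.symm).resolve_right (hl1 _ (σ.1.subset (hu σ))
      fun ρ _ hρσ hρ => (hu' σ ρ hρ).not_gt hρσ).ne'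

/-- The coordinates, with respect to a flag `C`, of the marked point of a face `τ` not in `C`: the
leading coordinate is positive and belongs to a face larger than `τ`. -/
lemma coord_flag (hu : ∀ σ : P.Face, u σ ∈ σ.1) (hu' : ∀ σ τ : P.Face, u σ ∈ τ.1 → σ ≤ τ)
    (C : Flag P.Face) [Fintype (C : Set P.Face)] {τ : P.Face} (hτ : τ ∉ C)
    {c : ↥(C : Set P.Face) → ℝ}
    (hc : ∑ ρ, c ρ • ((1, u ρ) : ℝ × (Fin n → ℝ)) = (1, u τ)) :
    ∃ σ : (C : Set P.Face), τ < σ.1 ∧ 0 < c σ ∧ ∀ ρ, σ < ρ → c ρ = 0 := by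
  obtain ⟨π, hπ, hπP⟩ := exists_top_mem C
  -- The leading coordinate belongs to the smallest member of the flag containing `τ`. Functionals
  -- of larger members vanish on it, hence at `u τ`; its own functional is positive at `u τ`, which
  -- lies in no smaller member.
  obtain ⟨σ, hσ⟩ := (Set.toFinite {ρ : (C : Set P.Face) | τ ≤ ρ.1}).exists_minimal
    ⟨⟨π, hπ⟩, show τ.1 ⊆ π.1 from τ.subset.trans hπP.ge⟩
  have hτσ : τ < σ.1 := lt_of_le_of_ne hσ.1 fun h => hτ (h ▸ σ.2)
  have h0 : ∀ ρ, σ < ρ → c ρ = 0 := by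
    intro ρ
    induction ρ using WellFoundedGT.induction with
    | ind ρ ih =>
      intro hσρ
      obtain ⟨l, hl, hl0, hl1⟩ := exists_functional_flag C (σ := ρ.1)
      have h := apply_sum_flag C hu hl0 (c := c) fun π hπ => ih π hπ (hσρ.trans hπ)
      rw [hc, hl0 σ σ.2 hσρ _ (hτσ.le (hu τ))] at h
      exact (mul_eq_zero.mp h.symm).resolve_right (hl1 _ (ρ.1.subset (hu ρ))
        fun π _ hπρ hπ => (hu' ρ π hπ).not_gt hπρ).ne'
  refine ⟨σ, hτσ, ?_, h0⟩
  obtain ⟨l, hl, hl0, hl1⟩ := exists_functional_flag C (σ := σ.1)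
  have h := apply_sum_flag C hu hl0 h0
  rw [hc] at h
  have h1 : 0 < l (1, u τ) := hl1 _ (τ.subset (hu τ)) fun ρ hρ hρσ hτρ =>
    hρσ.not_ge (hσ.2 (y := ⟨ρ, hρ⟩) (hu' τ ρ hτρ) hρσ.le)
  have h2 : 0 < l (1, u σ) := hl1 _ (σ.1.subset (hu σ))
    fun ρ _ hρσ hρ => (hu' σ ρ hρ).not_gt hρσ
  rw [h] at h1
  exact pos_of_mul_pos_left h1 h2.le

end Marking
end NormalLatticePolytope
end SeshadriToric

/-! ### Covering the polytope by the simplices of the flags -/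

namespace SeshadriToric

open MvPolynomial
open scoped Pointwise

namespace NormalLatticePolytope

variable {n : ℕ} {P : NormalLatticePolytope n}

section Marking

variable {u : P.Face → Fin n → ℝ}

/-- The ray from the marked point of `σ` through another point `x` of `σ` leaves `σ` in a proper
subface. -/
lemma exists_exit (hu : ∀ σ : P.Face, u σ ∈ σ.1) {σ : P.Face} {x : Fin n → ℝ} (hx : x ∈ σ.1)
    (hxu : x ≠ u σ) : ∃ τ < σ, ∃ y ∈ τ.1, x ∈ segment ℝ (u σ) y := by
  classical
  -- Pairs of an end point in `σ` and the ratio at which `x` divides the segment from `u σ` to it.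
  -- The smallest ratio gives the point where the ray leaves `σ`.
  let A : Set ((Fin n → ℝ) × ℝ) :=
    (σ.1 ×ˢ Set.Icc 0 1) ∩ {p | (1 - p.2) • u σ + p.2 • p.1 = x}
  have hA : IsCompact A := by
    refine (σ.isCompact.prod isCompact_Icc).inter_right (isClosed_eq ?_ continuous_const)
    fun_prop
  obtain ⟨⟨y, c⟩, ⟨⟨hy, hc0, hc1⟩, hyc⟩, hmin⟩ := hA.exists_isMinOn
    ⟨(x, 1), ⟨hx, zero_le_one, le_rfl⟩, by simp⟩ continuous_snd.continuousOn
  simp only [Set.mem_ofPred_eq] at hy hc0 hc1 hyc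
  have hcpos : 0 < c := hc0.lt_of_ne fun h => hxu (by rw [← hyc, ← h]; simp)
  obtain ⟨F, hF⟩ := P.exists_finset
  have hyu : y ≠ u σ := by
    rintro rfl
    rw [← add_smul, sub_add_cancel, one_smul] at hyc
    exact hxu hyc.symm
  -- Farkas' lemma is applied to the `(1, v)`, `v` in `F` and `σ`, together with `-(1, y)`, encoded
  -- by `none`. If `-(1, u σ)` were a conic combination, `y` would be `u σ` or lie strictly between
  -- `u σ` and another point of `σ`, and that point would have the smaller ratio `c * (L / (1 +
  -- L))`. The separating functional defines a face containing `y` but not `u σ`.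
  let v : Option (Fin n → ℝ) → ℝ × (Fin n → ℝ) := fun o => o.elim (-(1, y)) fun v => (1, v)
  have key : ∃ g : ℝ × (Fin n → ℝ) →ₗ[ℝ] ℝ, (∀ v ∈ F, v ∈ σ.1 → 0 ≤ g (1, v)) ∧ g (1, y) ≤ 0 ∧
      0 < g (1, u σ) := by
    rcases farkas (insert none ((F.filter (· ∈ σ.1)).map Function.Embedding.some)) v
      (-(1, u σ)) with ⟨a, ha, hsum⟩ | ⟨g, hg, hgu⟩
    · exfalso
      rw [Finset.sum_insert (by simp), Finset.sum_map] at hsum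
      simp only [v, Option.elim, Function.Embedding.some_apply] at hsum
      have ha' : ∀ v ∈ F.filter (· ∈ σ.1), 0 ≤ a (some v) := fun v hv =>
        ha _ (Finset.mem_insert_of_mem (Finset.mem_map_of_mem _ hv))
      set s := F.filter (· ∈ σ.1) with hs
      set L := ∑ v ∈ s, a (some v) with hL
      have h1 : a none = 1 + L := by
        have := congrArg Prod.fst hsum
        simp only [Prod.fst_add, Prod.smul_fst, Prod.fst_neg, Prod.fst_sum, smul_eq_mul,
          mul_one] at this
        linarith
      have h2 : (1 + L) • y = u σ + ∑ v ∈ s, a (some v) • v := by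
        have := congrArg Prod.snd hsum
        simp only [Prod.snd_add, Prod.smul_snd, Prod.snd_neg, Prod.snd_sum, h1] at this
        rw [smul_neg, neg_add_eq_iff_eq_add] at this
        rw [this]
        abel_nf
      have hL0 : 0 ≤ L := Finset.sum_nonneg ha'
      rcases hL0.eq_or_lt with hL0 | hL0
      · have h3 : ∑ v ∈ s, a (some v) • v = 0 := Finset.sum_eq_zero fun v hv => by
          rw [(Finset.sum_eq_zero_iff_of_nonneg ha').mp hL0.symm v hv, zero_smul]
        rw [h3, ← hL0, add_zero, add_zero, one_smul] at h2
        exact hyu h2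
      · have hz : L⁻¹ • ∑ v ∈ s, a (some v) • v ∈ σ.1 := by
          have := σ.convex.centerMass_mem ha' hL0 fun v hv => (Finset.mem_filter.mp hv).2
          simpa [Finset.centerMass] using this
        have hlt : c * (L / (1 + L)) < c := by
          refine mul_lt_of_lt_one_right hcpos ?_
          rw [div_lt_one (by positivity)]
          linarith
        refine (hmin (a := (L⁻¹ • ∑ v ∈ s, a (some v) • v, c * (L / (1 + L))))
          ⟨⟨hz, by positivity, hlt.le.trans hc1⟩, ?_⟩).not_gt hlt
        change (1 - c * (L / (1 + L))) • u σ + (c * (L / (1 + L))) • _ = x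
        have h4 : y = (1 + L)⁻¹ • (u σ + ∑ v ∈ s, a (some v) • v) := by
          rw [← h2, smul_smul, inv_mul_cancel₀ (by positivity), one_smul]
        rw [← hyc, h4, smul_smul]
        match_scalars
        · field_simp
          ring
        · field_simp
    · refine ⟨g, fun v hv hvσ => ?_, ?_, ?_⟩
      · exact hg (some v) (Finset.mem_insert_of_mem (Finset.mem_map_of_mem
          Function.Embedding.some (Finset.mem_filter.mpr ⟨hv, hvσ⟩)))
      · have := hg none (Finset.mem_insert_self _ _)
        change 0 ≤ g (-(1, y)) at this
        rw [map_neg] at this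
        linarith
      · rw [map_neg] at hgu
        linarith
  obtain ⟨g, hg, hgy, hgu⟩ := key
  obtain ⟨hgσ, hface⟩ := exists_subface hF σ g hg
  obtain ⟨τ, hτ⟩ := hface y hy (le_antisymm hgy (hgσ y hy))
  refine ⟨τ, lt_of_le_of_ne (fun z hz => ((hτ z).mp hz).1) ?_, y,
    (hτ y).mpr ⟨hy, le_antisymm hgy (hgσ y hy)⟩, 1 - c, c, by linarith, hc0, by ring, hyc⟩
  rintro rfl
  exact hgu.ne' ((hτ _).mp (hu τ)).2

/-- The simplices of the flags cover the polytope. -/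
lemma exists_chain (hu : ∀ σ : P.Face, u σ ∈ σ.1) (σ : P.Face) : ∀ x ∈ σ.1,
    ∃ s : Set P.Face, IsChain (· ≤ ·) s ∧ (∀ ρ ∈ s, ρ ≤ σ) ∧ x ∈ convexHull ℝ (u '' s) := by
  induction σ using WellFoundedLT.induction with
  | ind σ ih =>
    intro x hx
    by_cases hxu : x = u σ
    · exact ⟨{σ}, IsChain.singleton, by simp, by simp [hxu]⟩
    · obtain ⟨τ, hτσ, y, hy, hxy⟩ := exists_exit hu hx hxu
      obtain ⟨s, hs, hsτ, hys⟩ := ih τ hτσ y hy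
      refine ⟨insert σ s, hs.insert fun ρ hρ _ => Or.inr ((hsτ ρ hρ).trans hτσ.le), ?_, ?_⟩
      · rintro ρ (rfl | hρ)
        · exact le_rfl
        · exact (hsτ ρ hρ).trans hτσ.le
      · refine (convex_convexHull ℝ _).segment_subset (subset_convexHull ℝ _ ?_)
          (convexHull_mono (Set.image_mono (Set.subset_insert σ s)) hys) hxy
        exact ⟨σ, Set.mem_insert σ s, rfl⟩

lemma exists_flag (hu : ∀ σ : P.Face, u σ ∈ σ.1) {x : Fin n → ℝ} (hx : x ∈ P.carrier) :
    ∃ C : Flag P.Face, x ∈ convexHull ℝ (u '' (C : Set P.Face)) := by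
  obtain ⟨C₀⟩ : Nonempty (Flag P.Face) := inferInstance
  obtain ⟨σ, -, hσ⟩ := exists_top_mem C₀
  obtain ⟨s, hs, -, hxs⟩ := exists_chain hu σ x (hσ.ge hx)
  obtain ⟨C, hC⟩ := hs.exists_subset_flag
  exact ⟨C, convexHull_mono (Set.image_mono hC) hxs⟩

end Marking
end NormalLatticePolytope
end SeshadriToric

/-! ### Coordinates with respect to a flag, cones, and the valuations of flags -/

namespace SeshadriToric

open MvPolynomial
open scoped Pointwise

lemma toReal_injective {n : ℕ} : Function.Injective (toReal (n := n)) := by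
  intro x y h
  funext i
  have := congrFun h i
  simp only [toReal] at this
  exact_mod_cast this

namespace CombinatorialSeshadriStratification

variable {n : ℕ} {K : Type*} [Field K] [CharZero K] {P : NormalLatticePolytope n}
  (S : CombinatorialSeshadriStratification K P)

lemma marking_mem (σ : P.Face) : S.marking σ ∈ σ.1 := intrinsicInterior_subset (S.mem_interior σ)

lemma le_of_marking_mem (σ τ : P.Face) (h : S.marking σ ∈ τ.1) : σ ≤ τ :=
  NormalLatticePolytope.Face.le_of_mem_intrinsicInterior (S.mem_interior σ) h

/-- The inclusion `M̂_ℚ → M̂_ℝ`. -/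
noncomputable def ratToReal : ℚ × (Fin n → ℚ) →ₗ[ℚ] ℝ × (Fin n → ℝ) :=
  LinearMap.prodMap (Algebra.linearMap ℚ ℝ) ((Algebra.linearMap ℚ ℝ).compLeft (Fin n))

lemma ratToReal_smul (q : ℚ) (z : ℚ × (Fin n → ℚ)) : ratToReal (q • z) = (q : ℝ) • ratToReal z := by
  ext <;> simp [ratToReal, Rat.smul_def]

lemma ratToReal_toRat (μ : ℤ × (Fin n → ℤ)) :
    ratToReal (toRat μ) = ((μ.1 : ℝ), toReal μ.2) := by
  ext <;> simp [ratToReal, toRat, toReal]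

lemma toRat_injective : Function.Injective (toRat (n := n)) := by
  intro μ ν h
  have h' := congrArg ratToReal h
  rw [ratToReal_toRat, ratToReal_toRat, Prod.ext_iff] at h'
  exact Prod.ext (by simpa using h'.1) (toReal_injective h'.2)

/-- The basis `(1, u_σ)`, `σ ∈ C`, of `M̂_ℝ`. -/
noncomputable def flagBasis (C : Flag P.Face) :
    Module.Basis (C : Set P.Face) ℝ (ℝ × (Fin n → ℝ)) :=
  Module.Basis.mk
    (NormalLatticePolytope.linearIndependent_flag S.marking_mem S.le_of_marking_mem C)
    (NormalLatticePolytope.span_flag S.marking_mem S.le_of_marking_mem C).ge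

lemma flagBasis_apply (C : Flag P.Face) (σ : (C : Set P.Face)) :
    S.flagBasis C σ = (1, S.marking σ) := by
  simp [flagBasis]

variable {S} (hlin : ∀ σ : P.Face, S.degree σ = 1)
include hlin

lemma weight_fst (σ : P.Face) : (S.weight σ).1 = -1 := by
  have := hlin σ
  rw [degree] at this
  omega

lemma marking_eq (σ : P.Face) : S.marking σ = toReal (-(S.weight σ).2) := by
  rw [marking, hlin]
  simp

lemma ratToReal_weight (σ : P.Face) : ratToReal (toRat (S.weight σ)) = -(1, S.marking σ) := by
  rw [ratToReal_toRat, marking_eq hlin, weight_fst hlin]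
  ext <;> simp [toReal]

/-- Independence over ℚ follows from that over ℝ, and the real basis has the right number of
elements. Hence `chainCoord` never takes its default value. -/
lemma exists_ratBasis (C : Flag P.Face) :
    ∃ b : Module.Basis (C : Set P.Face) ℚ (ℚ × (Fin n → ℚ)),
      ∀ σ, b σ = toRat (S.weight σ.1) := by
  have := Fintype.ofFinite (C : Set P.Face)
  have hli : LinearIndependent ℚ fun σ : (C : Set P.Face) => toRat (S.weight σ.1) := by
    refine Fintype.linearIndependent_iff.mpr fun c hc σ => ?_
    have h := congrArg ratToReal hc
    simp only [map_sum, ratToReal_smul, ratToReal_weight hlin, map_zero, smul_neg,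
      Finset.sum_neg_distrib, neg_eq_zero] at h
    have := Fintype.linearIndependent_iff.mp (S.flagBasis C).linearIndependent
      (fun ρ => (c ρ : ℝ)) (by simpa only [flagBasis_apply] using h) σ
    exact_mod_cast this
  have hcard : Fintype.card (C : Set P.Face) = Module.finrank ℚ (ℚ × (Fin n → ℚ)) := by
    rw [← Module.finrank_eq_card_basis (S.flagBasis C)]
    simp
  exact ⟨basisOfLinearIndependentOfCardEqFinrank' _ hli hcard, fun σ => by simp⟩

lemma chainCoord_weight (C : Flag P.Face) (σ : (C : Set P.Face)) :
    S.chainCoord C (toRat (S.weight σ.1)) = Finsupp.single σ 1 := by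
  have h := exists_ratBasis hlin C
  rw [chainCoord, dif_pos h, ← h.choose_spec σ]
  exact h.choose.repr_self σ

lemma sum_chainCoord (C : Flag P.Face) [Fintype (C : Set P.Face)] (z : ℚ × (Fin n → ℚ)) :
    ∑ σ : (C : Set P.Face), S.chainCoord C z σ • toRat (S.weight σ.1) = z := by
  have h := exists_ratBasis hlin C
  rw [chainCoord, dif_pos h]
  conv_rhs => rw [← h.choose.sum_repr z]
  exact Finset.sum_congr rfl fun σ _ => by rw [h.choose_spec σ]; rfl

/-- The weight of `f_σ` is `-(1, u_σ)`, so the sign in `-s` cancels. This ties the values of the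
valuations to the geometry of the simplices. -/
lemma chainCoord_cast (C : Flag P.Face) (s : ℤ × (Fin n → ℤ)) (σ : (C : Set P.Face)) :
    ((S.chainCoord C (toRat (-s)) σ : ℚ) : ℝ) =
      (S.flagBasis C).repr ((s.1 : ℝ), toReal s.2) σ := by
  have := Fintype.ofFinite (C : Set P.Face)
  have h := congrArg ratToReal (sum_chainCoord hlin C (toRat (-s)))
  have h1 : ∑ σ : (C : Set P.Face), ((S.chainCoord C (toRat (-s)) σ : ℚ) : ℝ) •
      S.flagBasis C σ = ((s.1 : ℝ), toReal s.2) := by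
    have h2 : ratToReal (toRat (-s)) = -((s.1 : ℝ), toReal s.2) := by
      rw [map_neg, map_neg, ratToReal_toRat]
    rw [← neg_inj, ← h2, ← h, map_sum, ← Finset.sum_neg_distrib]
    refine Finset.sum_congr rfl fun σ _ => ?_
    rw [ratToReal_smul, ratToReal_weight hlin, smul_neg, flagBasis_apply]
  rw [← h1, Module.Basis.repr_sum_self]

omit hlin
variable (S)

/-- The weight `s ∈ M̂` lies in the cone over the simplex of `C`. -/
def InCone (C : Flag P.Face) (s : ℤ × (Fin n → ℤ)) : Prop :=
  ∀ σ, 0 ≤ S.chainCoord C (toRat (-s)) σ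

variable {S}

lemma InCone.add {C : Flag P.Face} {s s' : ℤ × (Fin n → ℤ)} (h : S.InCone C s)
    (h' : S.InCone C s') : S.InCone C (s + s') := fun σ => by
  rw [neg_add, map_add, map_add, Finsupp.add_apply]
  exact add_nonneg (h σ) (h' σ)

lemma inCone_zero (C : Flag P.Face) : S.InCone C 0 := fun σ => by simp

include hlin

lemma inCone_iff (C : Flag P.Face) (s : ℤ × (Fin n → ℤ)) :
    S.InCone C s ↔ ∀ σ, 0 ≤ (S.flagBasis C).repr ((s.1 : ℝ), toReal s.2) σ := by
  refine forall_congr' fun σ => ?_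
  rw [← chainCoord_cast hlin]
  exact Rat.cast_nonneg.symm

omit hlin in
lemma repr_nonneg_of_mem_simplex {C : Flag P.Face} {x : Fin n → ℝ} (hx : x ∈ S.simplex C)
    (σ : (C : Set P.Face)) : 0 ≤ (S.flagBasis C).repr (1, x) σ := by
  classical
  refine convexHull_min ?_ (NormalLatticePolytope.convex_nonneg ((S.flagBasis C).coord σ)) hx
  rintro _ ⟨ρ, hρ, rfl⟩
  have := S.flagBasis_apply C ⟨ρ, hρ⟩
  simp only [Set.mem_ofPred_eq, Module.Basis.coord_apply]
  rw [← this, Module.Basis.repr_self, Finsupp.single_apply]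
  split_ifs <;> simp

omit hlin in
-- The coordinates are barycentric: comparing first components in the expansion of `(1, x)` shows
-- that they sum to 1.
lemma mem_simplex_iff {C : Flag P.Face} {x : Fin n → ℝ} :
    x ∈ S.simplex C ↔ ∀ σ, 0 ≤ (S.flagBasis C).repr (1, x) σ := by
  have := Fintype.ofFinite (C : Set P.Face)
  refine ⟨fun h => repr_nonneg_of_mem_simplex h, fun h => ?_⟩
  have h1 := (S.flagBasis C).sum_repr (1, x)
  simp only [flagBasis_apply] at h1
  refine mem_convexHull_of_exists_fintype ((S.flagBasis C).repr (1, x))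
    (fun σ => S.marking σ) h ?_ (fun σ => ⟨σ, σ.2, rfl⟩) ?_
  · simpa [Prod.fst_sum] using congrArg Prod.fst h1
  · simpa [Prod.snd_sum] using congrArg Prod.snd h1

lemma mem_simplex_iff_inCone {C : Flag P.Face} {χ : Fin n → ℤ} :
    toReal χ ∈ S.simplex C ↔ S.InCone C (1, χ) := by
  rw [inCone_iff hlin, mem_simplex_iff]
  simp

omit hlin in
lemma _root_.SeshadriToric.NormalLatticePolytope.exists_smul_of_mem_weightMonoid
    {s : ℤ × (Fin n → ℤ)} (hs : s ∈ P.weightMonoid) :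
    ∃ r : ℝ, 0 ≤ r ∧ ∃ x ∈ P.carrier, (((s.1 : ℝ), toReal s.2) : ℝ × (Fin n → ℝ)) = r • (1, x) := by
  induction hs using AddSubmonoid.closure_induction with
  | mem s hs =>
    obtain ⟨χ, rfl⟩ := hs
    exact ⟨1, zero_le_one, toReal χ.1, χ.2, by simp [NormalLatticePolytope.pt]⟩
  | zero =>
    obtain ⟨x, hx⟩ := P.carrier_nonempty
    refine ⟨0, le_rfl, x, hx, ?_⟩
    ext <;> simp [toReal]
  | add s s' _ _ h h' =>
    obtain ⟨r, hr, x, hx, h⟩ := h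
    obtain ⟨r', hr', x', hx', h'⟩ := h'
    have hadd : ((((s + s').1 : ℤ) : ℝ), toReal (s + s').2) =
        ((s.1 : ℝ), toReal s.2) + ((s'.1 : ℝ), toReal s'.2) := by
      ext <;> simp [toReal]
    rw [hadd, h, h']
    rcases (add_nonneg hr hr').eq_or_lt with h0 | h0
    · have h1 : r = 0 := by linarith
      have h2 : r' = 0 := by linarith
      exact ⟨0, le_rfl, x, hx, by rw [h1, h2]; simp⟩
    · refine ⟨r + r', h0.le, (r / (r + r')) • x + (r' / (r + r')) • x',
        P.convex_carrier hx hx' (by positivity) (by positivity) (by field_simp), ?_⟩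
      ext
      · simp
      · simp
        field_simp

lemma exists_inCone {s : ℤ × (Fin n → ℤ)} (hs : s ∈ P.weightMonoid) : ∃ C, S.InCone C s := by
  obtain ⟨r, hr, x, hx, h⟩ := NormalLatticePolytope.exists_smul_of_mem_weightMonoid hs
  obtain ⟨C, hC⟩ := NormalLatticePolytope.exists_flag S.marking_mem hx
  refine ⟨C, (inCone_iff hlin C s).mpr fun σ => ?_⟩
  rw [h, map_smul, Finsupp.smul_apply, smul_eq_mul]
  exact mul_nonneg hr (repr_nonneg_of_mem_simplex hC σ)

/-- Denominators of the coordinates are cleared by taking for `k` their product. Questions about `s`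
are thereby reduced to the weights of the extremal functions. -/
lemma exists_nsmul_eq {C : Flag P.Face} [Fintype (C : Set P.Face)] {s : ℤ × (Fin n → ℤ)}
    (hs : S.InCone C s) : ∃ k : ℕ, 0 < k ∧ ∃ m : ↥(C : Set P.Face) → ℕ,
      k • s = ∑ σ, m σ • -S.weight σ := by
  classical
  set q := fun σ => S.chainCoord C (toRat (-s)) σ with hq
  have h1 : ∀ σ, ∃ m : ℕ, ((∏ ρ, (q ρ).den : ℕ) : ℚ) * q σ = m := fun σ => by
    obtain ⟨d, hd⟩ := Finset.dvd_prod_of_mem (fun ρ => (q ρ).den) (Finset.mem_univ σ)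
    obtain ⟨a, ha⟩ := Int.eq_ofNat_of_zero_le (Rat.num_nonneg.mpr (hs σ))
    refine ⟨d * a, ?_⟩
    have h2 : (q σ) * (q σ).den = a := by
      rw [Rat.mul_den_eq_num, ha]
      simp
    rw [hd]
    push_cast
    rw [← h2]
    ring
  choose m hm using h1
  refine ⟨∏ ρ, (q ρ).den, Finset.prod_pos fun ρ _ => (q ρ).den_pos, m, ?_⟩
  refine toRat_injective ?_
  rw [← neg_inj, ← map_neg, ← smul_neg, map_nsmul, ← sum_chainCoord hlin C (toRat (-s)),
    Finset.smul_sum, map_sum, ← Finset.sum_neg_distrib]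
  refine Finset.sum_congr rfl fun σ _ => ?_
  rw [map_nsmul, map_neg toRat (S.weight σ), smul_neg, neg_neg, ← Nat.cast_smul_eq_nsmul ℚ, smul_smul,
    ← Nat.cast_smul_eq_nsmul ℚ (m σ)]
  congr 1
  exact hm σ

variable {N : ℕ} {t : P.Face ≃ Fin N}

omit hlin in
lemma nuWeight_apply (C : Flag P.Face) (μ : ℤ × (Fin n → ℤ)) (σ : P.Face) :
    open Classical in
    ofLex (S.nuWeight t C μ) (t σ) =
      if h : σ ∈ (C : Set P.Face) then S.chainCoord C (toRat μ) ⟨σ, h⟩ else 0 := by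
  classical
  change (if h : t.symm (t σ) ∈ (C : Set P.Face) then
    S.chainCoord C (toRat μ) ⟨t.symm (t σ), h⟩ else 0) = _
  simp only [Equiv.symm_apply_apply]

/-- Comparison of the weights `ν_C(f_τ)` and `e_τ`. -/
lemma single_le_nuWeight (ht : StrictAnti t) (C : Flag P.Face) (τ : P.Face) :
    toLex (Pi.single (t τ) 1) ≤ S.nuWeight t C (S.weight τ) ∧
      (τ ∈ C → S.nuWeight t C (S.weight τ) = toLex (Pi.single (t τ) 1)) := by
  classical
  have := Fintype.ofFinite (C : Set P.Face)
  have heq : τ ∈ C → S.nuWeight t C (S.weight τ) = toLex (Pi.single (t τ) 1) := fun hτ => by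
    refine ofLex.injective (funext fun i => ?_)
    obtain ⟨σ, rfl⟩ := t.surjective i
    rw [nuWeight_apply, chainCoord_weight hlin C ⟨τ, hτ⟩]
    simp only [ofLex_toLex, Finsupp.single_apply, Pi.single_apply, t.injective.eq_iff,
      Subtype.mk.injEq]
    split_ifs with h1 h2 h3 h3 h3 <;> first | rfl | exact absurd h2.symm h3 | skip
    all_goals first | exact absurd h3.symm h2 | exact absurd (h3 ▸ hτ) h1
  refine ⟨?_, heq⟩
  by_cases hτ : τ ∈ C
  · exact (heq hτ).ge
  obtain ⟨σ, hτσ, hpos, hzero⟩ := NormalLatticePolytope.coord_flag S.marking_mem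
    S.le_of_marking_mem C hτ (c := fun ρ => ((S.chainCoord C (toRat (S.weight τ)) ρ : ℚ) : ℝ)) (by
      have h := congrArg ratToReal (sum_chainCoord hlin C (toRat (S.weight τ)))
      simp only [map_sum, ratToReal_smul, ratToReal_weight hlin, smul_neg,
        Finset.sum_neg_distrib, neg_inj] at h
      exact h)
  -- As `t` reverses the order and `τ < σ`, position `t σ` comes before `t τ`. Both vectors vanish
  -- before `t σ`; at `t σ` the entry of `e_τ` is zero and the other one is positive.
  refine le_of_lt ⟨t σ, fun j hj => ?_, ?_⟩
  · obtain ⟨ρ, rfl⟩ := t.surjective j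
    have h1 : ofLex (S.nuWeight t C (S.weight τ)) (t ρ) = 0 := by
      rw [nuWeight_apply]
      split_ifs with hρ
      · rcases C.le_or_le hρ σ.2 with h | h
        · exact absurd (ht.antitone h) hj.not_ge
        · have := hzero ⟨ρ, hρ⟩ (lt_of_le_of_ne h fun h' => by
            have := congrArg Subtype.val h'
            simp only at this
            exact hj.ne (by rw [this]))
          exact_mod_cast this
      · rfl
    rw [show (S.nuWeight t C (S.weight τ)) (t ρ) = 0 from h1]
    exact Pi.single_eq_of_ne (hj.trans (ht hτσ)).ne _
  · have h1 : ofLex (S.nuWeight t C (S.weight τ)) (t σ) = S.chainCoord C (toRat (S.weight τ)) σ := by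
      rw [nuWeight_apply, dif_pos σ.2]
    have h2 : (toLex (Pi.single (t τ) 1 : Fin N → ℚ)) (t σ) = 0 :=
      Pi.single_eq_of_ne (ht hτσ).ne _
    rw [h2, show (S.nuWeight t C (S.weight τ)) (t σ) = _ from h1]
    exact_mod_cast hpos

/-- On the cone of `C`, the valuation `ν_C` is the smallest one. -/
lemma InCone.nuWeight_le (ht : StrictAnti t) {C : Flag P.Face} {s : ℤ × (Fin n → ℤ)}
    (hs : S.InCone C s) (C' : Flag P.Face) : S.nuWeight t C (-s) ≤ S.nuWeight t C' (-s) := by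
  have := Fintype.ofFinite (C : Set P.Face)
  -- By additivity, after passing to a multiple of `s`, it suffices to compare the values at the
  -- weights of the `f_σ`, `σ ∈ C`.
  obtain ⟨k, hk, m, hm⟩ := exists_nsmul_eq hlin hs
  have h : ∀ C', k • S.nuWeight t C' (-s) = ∑ σ, m σ • S.nuWeight t C' (S.weight σ) := fun C' => by
    rw [← map_nsmul, smul_neg, hm, ← Finset.sum_neg_distrib, map_sum]
    refine Finset.sum_congr rfl fun σ _ => ?_
    rw [smul_neg, neg_neg, map_nsmul]
  refine le_of_nsmul_le_nsmul_right hk.ne' ?_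
  rw [h, h]
  refine Finset.sum_le_sum fun σ _ => nsmul_le_nsmul_right ?_ _
  rw [(single_le_nuWeight hlin ht C σ).2 σ.2]
  exact (single_le_nuWeight hlin ht C' σ).1

omit hlin in
-- The coordinates of `-s` for `C'` are entries of the common value vector, whose entries are
-- coordinates for `C` or zero, so none is negative.
lemma InCone.of_nuWeight_eq {C C' : Flag P.Face} {s : ℤ × (Fin n → ℤ)} (hs : S.InCone C s)
    (h : S.nuWeight t C' (-s) = S.nuWeight t C (-s)) : S.InCone C' s := fun σ => by
  have h1 := nuWeight_apply (S := S) (t := t) C' (-s) σ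
  rw [dif_pos σ.2, h, nuWeight_apply] at h1
  rw [← h1]
  split_ifs with h2
  · exact hs _
  · exact le_rfl

end CombinatorialSeshadriStratification
end SeshadriToric

namespace SeshadriToric

open MvPolynomial
open scoped Pointwise

/-! ### Sums of coefficients -/

section CoeffSum

variable {σ K : Type*} [Field K]

open Classical in
/-- The sum of the coefficients of the monomials whose exponent satisfies `p`. -/
noncomputable def coeffSum (p : (σ →₀ ℕ) → Prop) : MvPolynomial σ K →ₗ[K] K :=
  (basisMonomials σ K).constr K fun α => if p α then 1 else 0

open Classical in
lemma coeffSum_monomial (p : (σ →₀ ℕ) → Prop) (α : σ →₀ ℕ) (r : K) :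
    coeffSum p (monomial α r) = if p α then r else 0 := by
  have h : monomial α r = r • basisMonomials σ K α := by
    rw [coe_basisMonomials, smul_monomial, smul_eq_mul, mul_one]
  rw [h, coeffSum, map_smul, Module.Basis.constr_basis]
  split_ifs <;> simp

open Classical in
lemma coeffSum_eq (p : (σ →₀ ℕ) → Prop) (f : MvPolynomial σ K) :
    coeffSum p f = ∑ α ∈ f.support with p α, f.coeff α := by
  conv_lhs => rw [f.as_sum]
  rw [map_sum, Finset.sum_filter]
  exact Finset.sum_congr rfl fun α _ => coeffSum_monomial p α _

lemma linearMap_ext_monomial {M : Type*} [AddCommMonoid M] [Module K M]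
    {F G : MvPolynomial σ K →ₗ[K] M} (h : ∀ α, F (monomial α 1) = G (monomial α 1)) : F = G :=
  (basisMonomials σ K).ext fun α => by simpa using h α

lemma coeffSum_congr {p q : (σ →₀ ℕ) → Prop} {f : MvPolynomial σ K}
    (h : ∀ α ∈ f.support, p α ↔ q α) : coeffSum p f = coeffSum q f := by
  classical
  rw [coeffSum_eq, coeffSum_eq]
  exact Finset.sum_congr (Finset.filter_congr h) fun _ _ => rfl

lemma coeffSum_eq_zero {p : (σ →₀ ℕ) → Prop} {f : MvPolynomial σ K}
    (h : ∀ α ∈ f.support, ¬p α) : coeffSum p f = 0 := by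
  classical
  rw [coeffSum_eq, Finset.filter_false_of_mem h, Finset.sum_empty]

/-- A linear map which kills the monomials outside `p`, and whose values at the monomials in `p`
depend only on `wt`, kills the polynomials for which all sums of coefficients over the fibres of
`wt` in `p` vanish. -/
lemma apply_eq_zero_of_coeffSum {M D : Type*} [AddCommGroup M] [Module K M]
    {p : (σ →₀ ℕ) → Prop} {wt : (σ →₀ ℕ) → D} (Φ : MvPolynomial σ K →ₗ[K] M)
    (h0 : ∀ α, ¬p α → Φ (monomial α 1) = 0)
    (h1 : ∀ α β, p α → p β → wt α = wt β → Φ (monomial α 1) = Φ (monomial β 1))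
    {f : MvPolynomial σ K} (hf : ∀ d, coeffSum (fun α => p α ∧ wt α = d) f = 0) : Φ f = 0 := by
  classical
  have hmon : ∀ α r, Φ (monomial α r) = r • Φ (monomial α 1) := fun α r => by
    rw [← map_smul, smul_monomial, smul_eq_mul, mul_one]
  have hs : Φ f = ∑ α ∈ f.support with p α, f.coeff α • Φ (monomial α 1) := by
    conv_lhs => rw [f.as_sum]
    rw [map_sum, Finset.sum_filter]
    refine Finset.sum_congr rfl fun α _ => ?_
    split_ifs with h
    · exact hmon _ _
    · rw [hmon, h0 α h, smul_zero]
  rw [hs, ← Finset.sum_fiberwise_of_maps_to (g := wt)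
    (fun α hα => Finset.mem_image_of_mem wt hα)]
  refine Finset.sum_eq_zero fun d hd => ?_
  obtain ⟨β, hβ, rfl⟩ := Finset.mem_image.mp hd
  have h2 := hf (wt β)
  rw [coeffSum_eq] at h2
  rw [Finset.filter_filter]
  rw [Finset.sum_congr rfl (g := fun α => f.coeff α • Φ (monomial β 1)), ← Finset.sum_smul]
  · convert zero_smul K (Φ (monomial β 1))
    convert h2
  intro α hα
  obtain ⟨-, hα, hαβ⟩ := Finset.mem_filter.mp hα
  rw [h1 α β hα (Finset.mem_filter.mp hβ).2 hαβ]

end CoeffSum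

/-! ### Equations of toric varieties -/

section Toric

variable {n : ℕ} {ι K : Type*} [Field K] [CharZero K] (a : ι → Fin n → ℤ)

/-- Characters of the torus are linearly independent, so vanishing can be tested on each weight
component; at the identity such a component takes as value the sum of its coefficients. -/
lemma eval_torus_eq_zero_iff (f : MvPolynomial ι K) :
    (∀ t : Kˣ × (Fin n → Kˣ), eval (fun i => (characterHat (coordWeight a i) t : K)) f = 0) ↔
      ∀ μ, coeffSum (fun α => Finsupp.weight (coordWeight a) α = μ) f = 0 := by
  classical
  constructor
  · intro h μ
    have h1 := eval_component a f h μ 1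
    have hone : ∀ ν, characterHat ν (1 : Kˣ × (Fin n → Kˣ)) = 1 := fun ν => by
      simp [characterHat, character]
    rw [weightedHomogeneousComponent_apply, map_sum] at h1
    simp only [eval_monomial, hone, Units.val_one] at h1
    rw [← h1, coeffSum_eq]
    congr!
    simp [Finsupp.prod]
  · intro h t
    refine apply_eq_zero_of_coeffSum (p := fun _ => True) (wt := Finsupp.weight (coordWeight a))
      (aeval fun i => (characterHat (coordWeight a i) t : K)).toLinearMap (by simp) ?_ (f := f)
      (fun μ => by simpa using h μ)
    intro α β _ _ hαβ
    simp only [AlgHom.toLinearMap_apply, aeval_monomial, map_one, one_mul, prod_characterHat, hαβ]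

omit [CharZero K] in
lemma vanishesAt_mk_iff {v : ι → K} (hv : v ≠ 0) {f : MvPolynomial ι K} {d : ℕ}
    (hf : f.IsHomogeneous d) : VanishesAt f (Projectivization.mk K v hv) ↔ eval v f = 0 := by
  refine ⟨fun h => h v hv rfl, fun h w hw hwv => ?_⟩
  obtain ⟨c, rfl⟩ := (Projectivization.mk_eq_mk_iff' K _ _ hw hv).mp hwv
  have : eval (c • v) f = c ^ d * eval v f := by
    rw [eval_eq, eval_eq, Finset.mul_sum]
    refine Finset.sum_congr rfl fun α hα => ?_
    have h1 : ∑ i ∈ α.support, α i = d := by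
      rw [← hf (mem_support_iff.mp hα), Finsupp.weight_apply, Finsupp.sum]
      simp
    simp only [Pi.smul_apply, smul_eq_mul, mul_pow, Finset.prod_mul_distrib,
      Finset.prod_pow_eq_pow_sum, h1]
    ring
  rw [this, h, mul_zero]

omit [CharZero K] in
lemma isHomogeneous_of_weight {f : MvPolynomial ι K} {μ : ℤ × (Fin n → ℤ)}
    (hf : IsWeightedHomogeneous (coordWeight a) f μ) : f.IsHomogeneous (-μ.1).toNat := by
  intro d hd
  have h2 := weight_coordWeight_fst a d
  rw [hf hd] at h2
  rw [h2, neg_neg, Int.toNat_natCast, Finsupp.degree_eq_weight_one]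
  rfl

/-- A homogeneous polynomial vanishing on `T̂ · (1, …, 1)` vanishes on the orbit. -/
lemma vanishesAt_orbit {f : MvPolynomial ι K}
    (hf : ∀ μ, coeffSum (fun α => Finsupp.weight (coordWeight a) α = μ) f = 0) :
    ∀ p ∈ torusOrbit K a, VanishesAt f p := by
  rintro _ ⟨t, h0, rfl⟩ v hv hvp
  obtain ⟨c, hc⟩ := (Projectivization.mk_eq_mk_iff K _ _ hv h0).mp hvp
  have h := (eval_torus_eq_zero_iff a f).mpr hf (c⁻¹, t⁻¹)
  rw [characterHat_coordWeight] at h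
  simp only [inv_inv] at h
  rw [← hc]
  exact h

variable [Nonempty ι]

omit [CharZero K] in
lemma orbitVector_ne_zero (t : Fin n → Kˣ) : orbitVector K a t ≠ 0 := fun h =>
  (character (a (Classical.arbitrary ι)) t).ne_zero (congrFun h _)

omit [CharZero K] in
lemma eval_torus_of_mem {f : MvPolynomial ι K} (hf : f ∈ vanishingIdeal (torusOrbit K a))
    (t : Kˣ × (Fin n → Kˣ)) : eval (fun i => (characterHat (coordWeight a i) t : K)) f = 0 := by
  have hle : vanishingIdeal (torusOrbit K a) ≤
      RingHom.ker (eval (fun i => (characterHat (coordWeight a i) t : K))) := by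
    refine Ideal.span_le.mpr ?_
    rintro g ⟨d, hg, hv⟩
    have h1 : (fun i => (characterHat (coordWeight a i) t : K)) ≠ 0 := fun h =>
      (characterHat (coordWeight a (Classical.arbitrary ι)) t).ne_zero (congrFun h _)
    refine hv _ ⟨t.2⁻¹, orbitVector_ne_zero a _, rfl⟩ _ h1 ?_
    exact (Projectivization.mk_eq_mk_iff' K _ _ h1 (orbitVector_ne_zero a _)).mpr
      ⟨_, (characterHat_coordWeight a t).symm⟩
  exact hle hf

lemma coeffSum_of_mem_orbit {f : MvPolynomial ι K} (hf : f ∈ vanishingIdeal (torusOrbit K a))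
    (μ : ℤ × (Fin n → ℤ)) : coeffSum (fun α => Finsupp.weight (coordWeight a) α = μ) f = 0 :=
  (eval_torus_eq_zero_iff a f).mp (eval_torus_of_mem a hf) μ

/-- Monomials of equal weight agree modulo the ideal, their difference being homogeneous and zero on
the orbit. Hence the class of a polynomial depends only on its coefficient sums. -/
lemma mem_vanishingIdeal_iff {f : MvPolynomial ι K} :
    f ∈ vanishingIdeal (toricVariety K a) ↔
      ∀ μ, coeffSum (fun α => Finsupp.weight (coordWeight a) α = μ) f = 0 := by
  refine ⟨fun hf => (eval_torus_eq_zero_iff a f).mp (eval_of_mem a hf), fun hf => ?_⟩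
  rw [← Ideal.Quotient.eq_zero_iff_mem, ← Ideal.Quotient.mkₐ_eq_mk K]
  refine apply_eq_zero_of_coeffSum (p := fun _ => True) (wt := Finsupp.weight (coordWeight a))
    (Ideal.Quotient.mkₐ K (vanishingIdeal (toricVariety K a))).toLinearMap (by simp)
    (fun α β _ _ hαβ => ?_) (f := f) (fun μ => by simpa using hf μ)
  have hhom := isHomogeneous_of_weight a ((isWeightedHomogeneous_monomial _ α (1 : K) rfl).sub
    (isWeightedHomogeneous_monomial _ β (1 : K) hαβ.symm))
  refine Ideal.Quotient.eq.mpr (Ideal.subset_span ⟨_, hhom, fun p hp => hp _ _ ?_ hhom⟩)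
  refine Ideal.subset_span ⟨_, hhom, vanishesAt_orbit a fun μ => ?_⟩
  rw [map_sub, coeffSum_monomial, coeffSum_monomial, hαβ, sub_self]

/-- Points of a toric variety are characterized by the binomial equations. -/
lemma mk_mem_toricVariety_iff {v : ι → K} (hv : v ≠ 0) :
    Projectivization.mk K v hv ∈ toricVariety K a ↔
      ∀ α β, Finsupp.weight (coordWeight a) α = Finsupp.weight (coordWeight a) β →
        eval v (monomial α 1) = eval v (monomial β 1) := by
  constructor
  · intro h α β hαβ
    have hhom := isHomogeneous_of_weight a ((isWeightedHomogeneous_monomial _ α (1 : K) rfl).sub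
        (isWeightedHomogeneous_monomial _ β (1 : K) hαβ.symm))
    rw [← sub_eq_zero, ← map_sub]
    refine h _ _ (Ideal.subset_span ⟨_, hhom, vanishesAt_orbit a fun μ => ?_⟩) hhom v hv rfl
    rw [map_sub, coeffSum_monomial, coeffSum_monomial, hαβ, sub_self]
  · intro h d f hf hd
    refine (vanishesAt_mk_iff hv hd).mpr ?_
    refine apply_eq_zero_of_coeffSum (p := fun _ => True) (wt := Finsupp.weight (coordWeight a))
      (aeval v).toLinearMap (by simp) (fun α β _ _ hαβ => ?_) (f := f)
      (fun μ => by simpa using coeffSum_of_mem_orbit a hf μ)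
    simpa [aeval_eq_eval] using h α β hαβ

end Toric
end SeshadriToric

/-! ### The coordinate ring as a semigroup algebra -/

namespace SeshadriToric

open MvPolynomial
open scoped Pointwise

section CoeffAt

variable {n : ℕ} {ι K : Type*} [Field K] [CharZero K] (a : ι → Fin n → ℤ) [Nonempty ι]

/-- The coefficient of an element of the homogeneous coordinate ring at a character. -/
noncomputable def coeffAt (μ : ℤ × (Fin n → ℤ)) : CoordRing K a →ₗ[K] K :=
  Submodule.liftQ ((vanishingIdeal (toricVariety K a)).restrictScalars K)
    (coeffSum fun α => Finsupp.weight (coordWeight a) α = μ)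
    fun _ hf => (mem_vanishingIdeal_iff a).mp hf μ

lemma coeffAt_mk (μ : ℤ × (Fin n → ℤ)) (f : MvPolynomial ι K) :
    coeffAt a μ (Ideal.Quotient.mk _ f) =
      coeffSum (fun α => Finsupp.weight (coordWeight a) α = μ) f := rfl

lemma eq_zero_iff_coeffAt {g : CoordRing K a} : g = 0 ↔ ∀ μ, coeffAt a μ g = 0 := by
  obtain ⟨f, rfl⟩ := Ideal.Quotient.mk_surjective g
  rw [Ideal.Quotient.eq_zero_iff_mem, mem_vanishingIdeal_iff]
  rfl

/-- The component of weight `μ` has zero coefficient at every other character, so it is nonzero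
exactly when its coefficient at `μ` is. -/
lemma mem_eigenSupport_iff_coeffAt {μ : ℤ × (Fin n → ℤ)} {g : CoordRing K a} :
    μ ∈ eigenSupport a g ↔ coeffAt a μ g ≠ 0 := by
  classical
  obtain ⟨f, rfl⟩ := Ideal.Quotient.mk_surjective g
  rw [mem_eigenSupport, not_iff_not, eigenComponent_mk, eq_zero_iff_coeffAt]
  have h : ∀ μ', coeffSum (fun α => Finsupp.weight (coordWeight a) α = μ')
      (weightedHomogeneousComponent (coordWeight a) μ f) =
      if μ' = μ then coeffSum (fun α => Finsupp.weight (coordWeight a) α = μ) f else 0 := by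
    intro μ'
    refine LinearMap.congr_fun (f := coeffSum (fun α => Finsupp.weight (coordWeight a) α = μ') ∘ₗ
      weightedHomogeneousComponent (coordWeight a) μ)
      (g := if μ' = μ then coeffSum (fun α => Finsupp.weight (coordWeight a) α = μ) else 0)
      (linearMap_ext_monomial fun α => ?_) f |>.trans (by split_ifs <;> rfl)
    have hα := isWeightedHomogeneous_monomial (coordWeight a) α (1 : K) rfl
    rw [LinearMap.comp_apply]
    by_cases hμ : Finsupp.weight (coordWeight a) α = μ
    · rw [hμ] at hα
      rw [hα.weightedHomogeneousComponent_same, coeffSum_monomial, hμ]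
      by_cases h : μ' = μ
      · rw [if_pos h.symm, if_pos h, coeffSum_monomial, if_pos hμ]
      · rw [if_neg (Ne.symm h), if_neg h, LinearMap.zero_apply]
    · rw [hα.weightedHomogeneousComponent_ne μ (Ne.symm hμ), map_zero]
      split_ifs with h
      · rw [coeffSum_monomial, if_neg hμ]
      · rfl
  simp only [coeffAt_mk, h]
  exact ⟨fun h => by simpa using h μ, fun h μ' => by split_ifs <;> first | exact h | rfl⟩

lemma exists_weight_eq_of_mem_eigenSupport {μ : ℤ × (Fin n → ℤ)} {g : CoordRing K a}
    (h : μ ∈ eigenSupport a g) : ∃ α : ι →₀ ℕ, Finsupp.weight (coordWeight a) α = μ := by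
  obtain ⟨f, rfl⟩ := Ideal.Quotient.mk_surjective g
  rw [mem_eigenSupport_iff_coeffAt, coeffAt_mk] at h
  by_contra! hα
  exact h (coeffSum_eq_zero fun α _ => hα α)

end CoeffAt

namespace NormalLatticePolytope

variable {n : ℕ} (P : NormalLatticePolytope n)

instance nonempty_pts : Nonempty P.Pts := by
  obtain ⟨F, hF⟩ := P.lattice
  obtain ⟨x, hx⟩ := P.carrier_nonempty
  have hne : (convexHull ℝ (toReal '' (F : Set (Fin n → ℤ)))).Nonempty := ⟨x, hF.le hx⟩
  obtain ⟨_, χ, hχ, rfl⟩ := convexHull_nonempty_iff.mp hne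
  exact ⟨χ, hF.ge (subset_convexHull ℝ _ ⟨χ, hχ, rfl⟩)⟩

instance finite_pts : Finite P.Pts := by
  obtain ⟨r, hr⟩ := P.isCompact_carrier.isBounded.exists_norm_le
  refine ((Set.finite_Icc (fun _ => -⌈r⌉ : Fin n → ℤ) fun _ => ⌈r⌉).subset fun χ hχ => ?_).to_subtype
  have h : ∀ i, |(χ i : ℝ)| ≤ ⌈r⌉ := fun i =>
    (norm_le_pi_norm (toReal χ) i).trans ((hr _ hχ).trans (Int.le_ceil r))
  exact ⟨fun i => by exact_mod_cast (abs_le.mp (h i)).1,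
    fun i => by exact_mod_cast (abs_le.mp (h i)).2⟩

variable {P}

lemma weight_coordWeight (α : P.Pts →₀ ℕ) : Finsupp.weight (coordWeight P.pt) α =
    -(α.sum fun χ k => k • ((1, P.pt χ) : ℤ × (Fin n → ℤ))) := by
  rw [Finsupp.weight_apply, Finsupp.sum, Finsupp.sum, ← Finset.sum_neg_distrib]
  refine Finset.sum_congr rfl fun χ _ => ?_
  rw [← smul_neg]
  rfl

lemma neg_weight_mem (α : P.Pts →₀ ℕ) :
    -(Finsupp.weight (coordWeight P.pt) α) ∈ P.weightMonoid := by
  rw [weight_coordWeight, neg_neg]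
  exact AddSubmonoid.sum_mem _ fun χ _ => AddSubmonoid.nsmul_mem _ (P.degreeOne χ).2 _

/-- The exponent of the chosen monomial of weight `-s`. -/
noncomputable def decomposition (s : P.weightMonoid) : P.Pts →₀ ℕ :=
  (P.exists_decomposition s).choose

lemma weight_decomposition (s : P.weightMonoid) :
    Finsupp.weight (coordWeight P.pt) (decomposition s) = -s.1 := by
  rw [weight_coordWeight, decomposition, (P.exists_decomposition s).choose_spec]

lemma coeffAt_basisFun {K : Type*} [Field K] [CharZero K] (s : P.weightMonoid)
    (μ : ℤ × (Fin n → ℤ)) [Decidable (μ = -s.1)] :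
    coeffAt P.pt μ (P.basisFun K s) = if μ = -s.1 then 1 else 0 := by
  classical
  refine (coeffAt_mk P.pt μ (monomial (decomposition s) 1)).trans ?_
  rw [coeffSum_monomial, weight_decomposition]
  congr 1
  exact propext eq_comm

lemma eigenSupport_basisFun {K : Type*} [Field K] [CharZero K] (s : P.weightMonoid) :
    eigenSupport P.pt (P.basisFun K s) = {-s.1} := by
  classical
  ext μ
  rw [mem_eigenSupport_iff_coeffAt, coeffAt_basisFun, Finset.mem_singleton]
  simp

end NormalLatticePolytope

/-! ### Values of the quasi-valuation and standard monomials -/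

namespace CombinatorialSeshadriStratification

variable {n : ℕ} {K : Type*} [Field K] [CharZero K] {P : NormalLatticePolytope n}
  (S : CombinatorialSeshadriStratification K P)
  {N : ℕ} (t : P.Face ≃ Fin N) (H : Finset P.weightMonoid)

open Classical in
/-- The value of `ν` at the functions of weight `-s`. -/
noncomputable def coneWeight (s : ℤ × (Fin n → ℤ)) : Lex (Fin N → ℚ) :=
  if h : ∃ C, S.InCone C s then S.nuWeight t h.choose (-s) else 0

/-- The weight in `M̂` of a monomial in the generators. -/
noncomputable def genWeight : ((P.Pts ⊕ H) →₀ ℕ) →+ ℤ × (Fin n → ℤ) :=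
  Finsupp.weight fun i => (gen H i).1

/-- The sum of the values of the factors of a monomial in the generators. -/
noncomputable def genValue : ((P.Pts ⊕ H) →₀ ℕ) →+ Lex (Fin N → ℚ) :=
  Finsupp.weight fun i => S.coneWeight t (gen H i).1

/-- The weights of the factors of a monomial in the generators lie in a common cone. -/
def IsStandard (α : (P.Pts ⊕ H) →₀ ℕ) : Prop :=
  ∃ C, ∀ i ∈ α.support, S.InCone C (gen H i).1

variable {S t H}

lemma genWeight_mem (α : (P.Pts ⊕ H) →₀ ℕ) : genWeight H α ∈ P.weightMonoid := by
  rw [genWeight, Finsupp.weight_apply]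
  exact AddSubmonoid.sum_mem _ fun i _ => AddSubmonoid.nsmul_mem _ (gen H i).2 _

lemma InCone.nsmul {C : Flag P.Face} {s : ℤ × (Fin n → ℤ)} (h : S.InCone C s) (k : ℕ) :
    S.InCone C (k • s) := by
  induction k with
  | zero => simpa using inCone_zero C
  | succ k ih => rw [succ_nsmul]; exact ih.add h

lemma inCone_sum {ι : Type*} {C : Flag P.Face} {A : Finset ι} {s : ι → ℤ × (Fin n → ℤ)}
    (h : ∀ i ∈ A, S.InCone C (s i)) : S.InCone C (∑ i ∈ A, s i) := by
  classical
  induction A using Finset.induction_on with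
  | empty => simpa using inCone_zero C
  | insert i A hi ih =>
    rw [Finset.sum_insert hi]
    exact (h i (Finset.mem_insert_self i A)).add
      (ih fun j hj => h j (Finset.mem_insert_of_mem hj))

lemma inCone_genWeight {C : Flag P.Face} {α : (P.Pts ⊕ H) →₀ ℕ}
    (h : ∀ i ∈ α.support, S.InCone C (gen H i).1) : S.InCone C (genWeight H α) := by
  rw [genWeight, Finsupp.weight_apply]
  exact inCone_sum fun i hi => (h i hi).nsmul _

variable (hlin : ∀ σ : P.Face, S.degree σ = 1) (ht : StrictAnti t)
include hlin ht

/-- The choice in `coneWeight` is immaterial: for two cones containing `s`, each value is at most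
the other. -/
lemma InCone.coneWeight_eq {C : Flag P.Face} {s : ℤ × (Fin n → ℤ)} (h : S.InCone C s) :
    S.coneWeight t s = S.nuWeight t C (-s) := by
  have h' : ∃ C, S.InCone C s := ⟨C, h⟩
  rw [coneWeight, dif_pos h']
  exact le_antisymm (h'.choose_spec.nuWeight_le hlin ht C) (h.nuWeight_le hlin ht _)

lemma le_coneWeight_iff {s : ℤ × (Fin n → ℤ)} (hs : s ∈ P.weightMonoid) {a : Lex (Fin N → ℚ)} :
    a ≤ S.coneWeight t s ↔ ∀ C, a ≤ S.nuWeight t C (-s) := by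
  obtain ⟨C, hC⟩ := exists_inCone hlin hs
  rw [hC.coneWeight_eq hlin ht]
  exact ⟨fun h C' => h.trans (hC.nuWeight_le hlin ht C'), fun h => h C⟩

lemma nuFun_eq (g : CoordRing K P.pt) : S.nuFun t g =
    (eigenSupport P.pt g).inf fun μ => ((S.coneWeight t (-μ) : Lex (Fin N → ℚ)) : WithTop _) := by
  have hmem : ∀ μ ∈ eigenSupport P.pt g, -μ ∈ P.weightMonoid := fun μ hμ => by
    obtain ⟨α, rfl⟩ := exists_weight_eq_of_mem_eigenSupport P.pt hμ
    exact NormalLatticePolytope.neg_weight_mem α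
  refine eq_of_forall_le_iff fun a => ?_
  rw [le_nuFun_iff, Finset.le_inf_iff, forall_comm]
  refine forall_congr' fun μ => ?_
  rw [forall_comm]
  refine forall_congr' fun hμ => ?_
  cases a with
  | top => simp
  | coe a =>
    simp only [WithTop.coe_le_coe]
    rw [le_coneWeight_iff hlin ht (hmem μ hμ)]
    simp only [neg_neg]

lemma mem_filtrationGT_iff {a : Lex (Fin N → ℚ)} {g : CoordRing K P.pt} :
    g ∈ (S.nu t).filtrationGT a ↔ ∀ s, coeffAt P.pt (-s) g ≠ 0 → a < S.coneWeight t s := by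
  rw [QuasiValuation.mem_filtrationGT]
  change _ < S.nuFun t g ↔ _
  rw [nuFun_eq hlin ht, Finset.lt_inf_iff (WithTop.coe_lt_top a)]
  simp only [WithTop.coe_lt_coe, mem_eigenSupport_iff_coeffAt]
  exact ⟨fun h s hs => neg_neg s ▸ h (-s) hs, fun h μ hμ => h (-μ) (by rwa [neg_neg])⟩

lemma value_basisFun (s : P.weightMonoid) :
    (S.nu t).value (P.basisFun K s) = S.coneWeight t s.1 := by
  rw [QuasiValuation.value]
  change (S.nuFun t _).untopD 0 = _
  rw [nuFun_eq hlin ht, NormalLatticePolytope.eigenSupport_basisFun, Finset.inf_singleton, neg_neg]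
  rfl

/-- The value of a generator is at most its value for `C`, with equality exactly when the cone of
`C` contains its weight. Since the latter values are additive, the inequalities add up, and equality
of the sums forces equality for every factor. -/
lemma genValue_le_nuWeight {C : Flag P.Face} (α : (P.Pts ⊕ H) →₀ ℕ) :
    S.genValue t H α ≤ S.nuWeight t C (-genWeight H α) ∧
      (S.genValue t H α = S.nuWeight t C (-genWeight H α) ↔
        ∀ i ∈ α.support, S.InCone C (gen H i).1) := by
  have h1 : S.nuWeight t C (-genWeight H α) =
      ∑ i ∈ α.support, α i • S.nuWeight t C (-(gen H i).1) := by
    rw [genWeight, Finsupp.weight_apply, Finsupp.sum, ← Finset.sum_neg_distrib, map_sum]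
    exact Finset.sum_congr rfl fun i _ => by rw [← smul_neg, map_nsmul]
  have h2 : S.genValue t H α = ∑ i ∈ α.support, α i • S.coneWeight t (gen H i).1 := by
    rw [genValue, Finsupp.weight_apply, Finsupp.sum]
  have h3 : ∀ i, S.coneWeight t (gen H i).1 ≤ S.nuWeight t C (-(gen H i).1) := fun i =>
    (le_coneWeight_iff hlin ht (gen H i).2).mp le_rfl C
  have h4 : ∀ i ∈ α.support, α i • S.coneWeight t (gen H i).1 ≤
      α i • S.nuWeight t C (-(gen H i).1) := fun i _ => nsmul_le_nsmul_right (h3 i) _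
  rw [h1, h2]
  refine ⟨Finset.sum_le_sum h4, (Finset.sum_eq_sum_iff_of_le h4).trans
    (forall₂_congr fun i hi => ⟨fun h => ?_, fun h => ?_⟩)⟩
  · have h5 := nsmul_right_injective (Finsupp.mem_support_iff.mp hi) h
    obtain ⟨C', hC'⟩ := exists_inCone hlin (gen H i).2
    exact hC'.of_nuWeight_eq (t := t) (by rw [← h5, hC'.coneWeight_eq hlin ht])
  · rw [h.coneWeight_eq hlin ht]

lemma genValue_le (α : (P.Pts ⊕ H) →₀ ℕ) :
    S.genValue t H α ≤ S.coneWeight t (genWeight H α) := by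
  obtain ⟨C, hC⟩ := exists_inCone hlin (genWeight_mem α)
  rw [hC.coneWeight_eq hlin ht]
  exact (genValue_le_nuWeight hlin ht α).1

/-- For the converse, the comparison is made in a cone containing the total weight, where the value
of the product is attained. -/
lemma isStandard_iff {α : (P.Pts ⊕ H) →₀ ℕ} :
    S.IsStandard H α ↔ S.genValue t H α = S.coneWeight t (genWeight H α) := by
  constructor
  · rintro ⟨C, hC⟩
    rw [(inCone_genWeight hC).coneWeight_eq hlin ht]
    exact (genValue_le_nuWeight hlin ht α).2.mpr hC
  · intro h
    obtain ⟨C, hC⟩ := exists_inCone hlin (genWeight_mem α)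
    rw [hC.coneWeight_eq hlin ht] at h
    exact ⟨C, (genValue_le_nuWeight hlin ht α).2.mp h⟩

lemma IsStandard.inCone {α : (P.Pts ⊕ H) →₀ ℕ} (hα : S.IsStandard H α) {C : Flag P.Face}
    (hC : S.InCone C (genWeight H α)) : ∀ i ∈ α.support, S.InCone C (gen H i).1 := by
  refine (genValue_le_nuWeight hlin ht α).2.mp ?_
  rw [← hC.coneWeight_eq hlin ht]
  exact (isStandard_iff hlin ht).mp hα

lemma degA_eq (α : (P.Pts ⊕ H) →₀ ℕ) :
    S.degA t H α = toLex ((genWeight H α).1, OrderDual.toDual (S.genValue t H α)) := by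
  rw [degA, genWeight, genValue, Finsupp.weight_apply, Finsupp.weight_apply, Finsupp.sum,
    Finsupp.sum, Finsupp.sum, Finsupp.sum, Prod.fst_sum]
  simp only [value_basisFun hlin ht]
  rfl

omit hlin ht

/-! ### The kernels of `θ` and `θ̄` -/

omit [CharZero K] in
lemma theta_eq (f : MvPolynomial (P.Pts ⊕ H) K) : theta K H f = P.thetaV K
    (aeval (fun i => monomial (NormalLatticePolytope.decomposition (gen H i)) (1 : K)) f) := by
  refine AlgHom.congr_fun (φ₁ := theta K H) (φ₂ := (P.thetaV K).comp
    (aeval fun i => monomial (NormalLatticePolytope.decomposition (gen H i)) (1 : K)))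
    (algHom_ext fun i => ?_) f
  rw [AlgHom.comp_apply, theta, aeval_X, aeval_X]
  rfl

omit [CharZero K] in
lemma weight_decomposition_monomial (α : (P.Pts ⊕ H) →₀ ℕ) : ∃ β : P.Pts →₀ ℕ,
    Finsupp.weight (coordWeight P.pt) β = -genWeight H α ∧
    aeval (fun i => monomial (NormalLatticePolytope.decomposition (gen H i)) (1 : K))
      (monomial α (1 : K)) = monomial β 1 := by
  induction α using Finsupp.induction_linear with
  | zero => exact ⟨0, by simp, by simp⟩
  | add α α' h h' =>
    obtain ⟨β, hβ, h⟩ := h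
    obtain ⟨β', hβ', h'⟩ := h'
    refine ⟨β + β', by rw [map_add, map_add, hβ, hβ', neg_add], ?_⟩
    have hmul : monomial (α + α') (1 : K) = monomial α 1 * monomial α' 1 := by
      rw [monomial_mul, one_mul]
    rw [hmul, map_mul, h, h', monomial_mul, one_mul]
  | single i k =>
    refine ⟨k • NormalLatticePolytope.decomposition (gen H i), ?_, ?_⟩
    · rw [map_nsmul, NormalLatticePolytope.weight_decomposition, genWeight,
        Finsupp.weight_single, smul_neg]
    · rw [← X_pow_eq_monomial, map_pow, aeval_X, monomial_pow, one_pow]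

lemma coeffAt_theta (s : ℤ × (Fin n → ℤ)) (f : MvPolynomial (P.Pts ⊕ H) K) :
    coeffAt P.pt (-s) (theta K H f) = coeffSum (fun α => genWeight H α = s) f := by
  classical
  refine LinearMap.congr_fun (f := coeffAt P.pt (-s) ∘ₗ (theta K H).toLinearMap)
    (linearMap_ext_monomial fun α => ?_) f
  obtain ⟨β, hβ, h⟩ := weight_decomposition_monomial (K := K) α
  rw [LinearMap.comp_apply, AlgHom.toLinearMap_apply, theta_eq, h]
  refine (coeffAt_mk P.pt (-s) (monomial β 1)).trans ?_
  rw [coeffSum_monomial, coeffSum_monomial, hβ, neg_inj]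

lemma mem_ker_theta_iff {f : MvPolynomial (P.Pts ⊕ H) K} :
    f ∈ RingHom.ker (theta K H) ↔ ∀ s, coeffSum (fun α => genWeight H α = s) f = 0 := by
  rw [RingHom.mem_ker, eq_zero_iff_coeffAt]
  exact ⟨fun h s => (coeffAt_theta s f).symm.trans (h _),
    fun h μ => by rw [← neg_neg μ, coeffAt_theta, h]⟩

variable (S t H) in
/-- The lift of `θ̄` to the Rees algebra. -/
noncomputable def thetaRees : MvPolynomial (P.Pts ⊕ H) K →ₐ[K] (S.nu t).rees :=
  aeval fun i => ⟨AddMonoidAlgebra.single ((S.nu t).value (P.basisFun K (gen H i)))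
    (P.basisFun K (gen H i)), fun a => by
      classical
      rw [AddMonoidAlgebra.coeff_single, Finsupp.single_apply]
      split_ifs with h
      · subst h
        rw [QuasiValuation.mem_filtrationGE, QuasiValuation.value]
        cases (S.nu t).toFun (P.basisFun K (gen H i)) <;> simp
      · exact zero_mem _⟩

lemma thetaBar_eq (f : MvPolynomial (P.Pts ⊕ H) K) :
    S.thetaBar t H f = Ideal.Quotient.mk _ (S.thetaRees t H f) := by
  refine AlgHom.congr_fun (φ₁ := S.thetaBar t H)
    (φ₂ := (Ideal.Quotient.mkₐ K (S.nu t).reesIdeal).comp (S.thetaRees t H))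
    (algHom_ext fun i => ?_) f
  rw [AlgHom.comp_apply, thetaBar, thetaRees, aeval_X, aeval_X]
  rfl

include hlin ht

lemma thetaRees_monomial (α : (P.Pts ⊕ H) →₀ ℕ) :
    (S.thetaRees t H (monomial α 1) : AddMonoidAlgebra (CoordRing K P.pt) (Lex (Fin N → ℚ))) =
      AddMonoidAlgebra.single (S.genValue t H α) (theta K H (monomial α 1)) := by
  induction α using Finsupp.induction_linear with
  | zero =>
    rw [← C_apply, map_one, map_one, map_one, map_zero]
    rfl
  | add α α' h h' =>
    rw [← one_mul (1 : K), ← monomial_mul, map_mul, map_mul, map_add, Subalgebra.coe_mul, h, h',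
      AddMonoidAlgebra.single_mul_single]
  | single i k =>
    rw [← X_pow_eq_monomial, map_pow, map_pow, Subalgebra.coe_pow, thetaRees, theta, aeval_X,
      aeval_X, AddMonoidAlgebra.single_pow, genValue, Finsupp.weight_single,
      value_basisFun hlin ht]

lemma coeffAt_thetaRees (s : ℤ × (Fin n → ℤ)) (a : Lex (Fin N → ℚ))
    (f : MvPolynomial (P.Pts ⊕ H) K) :
    coeffAt P.pt (-s)
      ((S.thetaRees t H f : AddMonoidAlgebra (CoordRing K P.pt) (Lex (Fin N → ℚ))).coeff a) =
      coeffSum (fun α => S.genValue t H α = a ∧ genWeight H α = s) f := by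
  classical
  induction f using MvPolynomial.induction_on' with
  | monomial α r =>
    have h : monomial α r = r • monomial α (1 : K) := by
      rw [smul_monomial, smul_eq_mul, mul_one]
    rw [h, map_smul, map_smul, coeffSum_monomial, Subalgebra.coe_smul,
      thetaRees_monomial hlin ht, AddMonoidAlgebra.coeff_smul, Finsupp.smul_apply, map_smul,
      AddMonoidAlgebra.coeff_single, Finsupp.single_apply]
    by_cases h1 : S.genValue t H α = a
    · rw [if_pos h1, coeffAt_theta, coeffSum_monomial]
      simp only [h1, true_and]
      congr
    · rw [if_neg h1, map_zero]
      simp only [h1, false_and, if_false]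
  | add p q hp hq =>
    rw [map_add, Subalgebra.coe_add, AddMonoidAlgebra.coeff_add, Finsupp.add_apply, map_add, hp, hq,
      map_add]

/-- The monomials of value `a` and weight `s` contribute the sum of their coefficients times `f_s`
in degree `a`, which is zero in the graded algebra if `a` is below the value of `f_s`. It is never
above by `genValue_le`, and equality means standard, so only standard monomials impose conditions.
-/
lemma mem_ker_thetaBar_iff {f : MvPolynomial (P.Pts ⊕ H) K} :
    f ∈ RingHom.ker (S.thetaBar t H) ↔
      ∀ s, coeffSum (fun α => S.IsStandard H α ∧ genWeight H α = s) f = 0 := by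
  have hstd : ∀ s, coeffSum (fun α => S.IsStandard H α ∧ genWeight H α = s) f =
      coeffSum (fun α => S.genValue t H α = S.coneWeight t s ∧ genWeight H α = s) f := fun s =>
    coeffSum_congr fun α _ => by
      rw [isStandard_iff hlin ht]
      exact and_congr_left fun h => by rw [h]
  have h : f ∈ RingHom.ker (S.thetaBar t H) ↔ ∀ a s,
      coeffSum (fun α => S.genValue t H α = a ∧ genWeight H α = s) f ≠ 0 →
        a < S.coneWeight t s := by
    rw [RingHom.mem_ker, thetaBar_eq, Ideal.Quotient.eq_zero_iff_mem]
    refine forall_congr' fun a => ?_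
    rw [mem_filtrationGT_iff hlin ht]
    simp only [coeffAt_thetaRees hlin ht]
  rw [h]
  simp only [hstd]
  constructor
  · intro h s
    by_contra hs
    exact lt_irrefl _ (h _ s hs)
  · intro h a s hs
    have hex : ∃ α, S.genValue t H α = a ∧ genWeight H α = s := by
      by_contra! hα
      exact hs (coeffSum_eq_zero fun α _ h => hα α h.1 h.2)
    obtain ⟨α, rfl, rfl⟩ := hex
    exact (genValue_le hlin ht α).lt_of_ne fun h' => hs (h' ▸ h _)

/-- If the generators generate the associated graded algebra, every weight is the weight of a
standard monomial. -/
lemma exists_isStandard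
    (hgen : Algebra.adjoin K (Set.range fun i : P.Pts ⊕ H => S.genClass t i) = ⊤)
    {s : ℤ × (Fin n → ℤ)} (hs : s ∈ P.weightMonoid) :
    ∃ α, S.IsStandard H α ∧ genWeight H α = s := by
  classical
  rw [Algebra.adjoin_range_eq_range_aeval K fun i => S.genClass t i] at hgen
  obtain ⟨f, hf⟩ : (S.nu t).symb (P.basisFun K ⟨s, hs⟩) ∈ (S.thetaBar t H).range :=
    hgen.ge Algebra.mem_top
  by_contra! hno
  replace hf : S.thetaBar t H f = (S.nu t).symb (P.basisFun K ⟨s, hs⟩) := hf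
  rw [thetaBar_eq] at hf
  -- In the degree of the value of `f_s`, the coefficient at `s` of the difference is 1 when no
  -- standard monomial has weight `s`, although the difference should have larger value.
  have h := (Ideal.Quotient.eq.mp hf.symm) (S.coneWeight t s)
  rw [mem_filtrationGT_iff hlin ht] at h
  refine lt_irrefl _ (h s ?_)
  rw [Subalgebra.coe_sub, AddMonoidAlgebra.coeff_sub, Finsupp.sub_apply, map_sub,
    coeffAt_thetaRees hlin ht, AddMonoidAlgebra.coeff_single, value_basisFun hlin ht,
    Finsupp.single_eq_same, NormalLatticePolytope.coeffAt_basisFun, if_pos rfl,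
    coeffSum_eq_zero, sub_zero]
  · exact one_ne_zero
  · rintro α - ⟨h1, h2⟩
    exact hno α ((isStandard_iff hlin ht).mpr (by rw [h1, h2])) h2

end CombinatorialSeshadriStratification
end SeshadriToric

namespace SeshadriToric

open MvPolynomial
open scoped Pointwise

/-! ### Initial forms and initial ideals -/

section Initial

variable {σ K D : Type*} [Field K] [LinearOrder D] {deg : (σ →₀ ℕ) → D}

lemma coeff_initialForm (g : MvPolynomial σ K) (α : σ →₀ ℕ)
    [Decidable (α ∈ g.support ∧ ∀ β ∈ g.support, deg β ≤ deg α)] :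
    (initialForm deg g).coeff α =
      if α ∈ g.support ∧ ∀ β ∈ g.support, deg β ≤ deg α then g.coeff α else 0 := by
  classical
  rw [initialForm, coeff_sum]
  simp only [coeff_monomial]
  rw [Finset.sum_ite_eq']
  simp only [Finset.mem_filter]

lemma coeffSum_eq_coeffSum {p q : (σ →₀ ℕ) → Prop} {f g : MvPolynomial σ K}
    (h1 : ∀ α, p α → q α → f.coeff α = g.coeff α) (h2 : ∀ α, p α → ¬q α → f.coeff α = 0)
    (h3 : ∀ α, q α → ¬p α → g.coeff α = 0) : coeffSum p f = coeffSum q g := by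
  classical
  have key : ∀ (p : (σ →₀ ℕ) → Prop) (f : MvPolynomial σ K) (A : Finset (σ →₀ ℕ)),
      f.support ⊆ A → coeffSum p f = ∑ α ∈ A, if p α then f.coeff α else 0 := by
    intro p f A hA
    rw [coeffSum_eq, Finset.sum_filter]
    refine Finset.sum_subset hA fun α _ hα => ?_
    rw [notMem_support_iff.mp hα, ite_self]
  rw [key p f _ Finset.subset_union_left, key q g _ Finset.subset_union_right]
  refine Finset.sum_congr rfl fun α _ => ?_
  split_ifs with hp hq hq
  · exact h1 α hp hq
  · exact h2 α hp hq
  · exact (h3 α hq hp).symm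
  · rfl

lemma initialForm_eq_self {g : MvPolynomial σ K}
    (h : ∀ α ∈ g.support, ∀ β ∈ g.support, deg β ≤ deg α) : initialForm deg g = g := by
  classical
  ext α
  rw [coeff_initialForm]
  split_ifs with h1
  · rfl
  · by_contra h2
    have h3 := mem_support_iff.mpr (Ne.symm h2)
    exact h1 ⟨h3, h α h3⟩

lemma mem_pair_of_mem_support {α β γ : σ →₀ ℕ}
    (h : γ ∈ (monomial α (1 : K) - monomial β 1).support) : γ = α ∨ γ = β := by
  classical
  rw [mem_support_iff, coeff_sub, coeff_monomial, coeff_monomial] at h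
  by_contra! h'
  exact h (by rw [if_neg h'.1.symm, if_neg h'.2.symm, sub_zero])

lemma initialForm_binomial {α β : σ →₀ ℕ} (h : deg β < deg α) :
    initialForm deg (monomial α (1 : K) - monomial β 1) = monomial α 1 := by
  classical
  have hne : β ≠ α := fun h' => h.ne (by rw [h'])
  have hα : (monomial α (1 : K) - monomial β 1).coeff α = 1 := by
    rw [coeff_sub, coeff_monomial, coeff_monomial, if_pos rfl, if_neg hne, sub_zero]
  have hαs : α ∈ (monomial α (1 : K) - monomial β 1).support := by
    rw [mem_support_iff, hα]
    exact one_ne_zero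
  ext γ
  rw [coeff_initialForm, coeff_monomial]
  by_cases hγ : α = γ
  · subst hγ
    have hmax : ∀ δ ∈ (monomial α (1 : K) - monomial β 1).support, deg δ ≤ deg α := fun δ hδ => by
      rcases mem_pair_of_mem_support hδ with rfl | rfl
      · exact le_rfl
      · exact h.le
    rw [if_pos rfl, if_pos ⟨hαs, hmax⟩, hα]
  · rw [if_neg hγ, if_neg]
    rintro ⟨h1, h2⟩
    rcases mem_pair_of_mem_support h1 with rfl | rfl
    · exact hγ rfl
    · exact (h2 α hαs).not_gt h

variable {I : Ideal (MvPolynomial σ K)}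

lemma monomial_mem_initialIdeal {α β : σ →₀ ℕ} (h : deg β < deg α)
    (hI : monomial α (1 : K) - monomial β 1 ∈ I) : monomial α 1 ∈ initialIdeal deg I := by
  refine Ideal.subset_span ⟨_, hI, fun h0 => ?_, (initialForm_binomial h).symm⟩
  have h1 := sub_eq_zero.mp h0
  rw [monomial_left_inj one_ne_zero] at h1
  exact h.ne (by rw [h1])

lemma binomial_mem_initialIdeal {α β : σ →₀ ℕ} (h : deg α = deg β)
    (hI : monomial α (1 : K) - monomial β 1 ∈ I) :
    monomial α 1 - monomial β 1 ∈ initialIdeal deg I := by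
  by_cases h0 : monomial α (1 : K) - monomial β 1 = 0
  · rw [h0]
    exact zero_mem _
  · refine Ideal.subset_span ⟨_, hI, h0, (initialForm_eq_self fun γ hγ δ hδ => ?_).symm⟩
    rcases mem_pair_of_mem_support hγ with rfl | rfl <;>
      rcases mem_pair_of_mem_support hδ with rfl | rfl <;> simp [h]

end Initial

section Weight

variable {σ τ K : Type*} [Field K]

lemma weightDeg_eq_weight (w : σ → ℤ) (α : σ →₀ ℕ) : weightDeg w α = Finsupp.weight w α := by
  simp [weightDeg, Finsupp.weight_apply]

lemma weightDeg_mapDomain {e : τ → σ} (he : Function.Injective e) (w : σ → ℤ) (α : τ →₀ ℕ) :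
    weightDeg w (α.mapDomain e) = weightDeg (w ∘ e) α := by
  rw [weightDeg, Finsupp.sum_mapDomain_index_inj he]
  rfl

lemma initialForm_rename {e : τ → σ} (he : Function.Injective e) (w : σ → ℤ)
    (g : MvPolynomial τ K) : initialForm (weightDeg w) (rename e g) =
      rename e (initialForm (weightDeg (w ∘ e)) g) := by
  classical
  ext α
  by_cases hα : ∃ β : τ →₀ ℕ, β.mapDomain e = α
  · obtain ⟨β, rfl⟩ := hα
    rw [coeff_rename_mapDomain e he, coeff_initialForm, coeff_initialForm,
      coeff_rename_mapDomain e he]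
    refine if_congr ?_ rfl rfl
    rw [support_rename_of_injective he]
    simp only [Finset.mem_image, forall_exists_index, and_imp, forall_apply_eq_imp_iff₂,
      weightDeg_mapDomain he]
    refine and_congr_left fun _ => ⟨?_, fun h => ⟨β, h, rfl⟩⟩
    rintro ⟨γ, hγ, h⟩
    rwa [← Finsupp.mapDomain_injective he h]
  · push Not at hα
    rw [coeff_rename_eq_zero e _ _ fun β hβ => absurd hβ (hα β), coeff_initialForm, if_neg]
    rintro ⟨h, -⟩
    rw [mem_support_iff, coeff_rename_eq_zero e _ _ fun β hβ => absurd hβ (hα β)] at h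
    exact h rfl

lemma coeffSum_rename {e : τ → σ} (p : (σ →₀ ℕ) → Prop) (f : MvPolynomial τ K) :
    coeffSum p (rename e f) = coeffSum (fun α => p (α.mapDomain e)) f := by
  classical
  refine LinearMap.congr_fun (f := coeffSum p ∘ₗ (rename e).toLinearMap)
    (linearMap_ext_monomial fun α => ?_) f
  rw [LinearMap.comp_apply, AlgHom.toLinearMap_apply, rename_monomial, coeffSum_monomial,
    coeffSum_monomial]

variable [CharZero K]

/-- In characteristic zero the element 2 has infinite order, so its action alone separates the
integral weights. -/
lemma two_zpow_injective : Function.Injective fun k : ℤ => (2 : K) ^ k := by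
  intro k l hkl
  have h : (((2 : ℚ) ^ k : ℚ) : K) = (((2 : ℚ) ^ l : ℚ) : K) := by push_cast; exact hkl
  exact zpow_right_injective₀ (a := (2 : ℚ)) (by norm_num) (by norm_num) (by exact_mod_cast h)

variable (K) in
/-- The action of `2 ∈ 𝔾_m` with weights `w` on polynomials. -/
noncomputable def scaleTwo (w : σ → ℤ) : MvPolynomial σ K →ₐ[K] MvPolynomial σ K :=
  aeval fun i => C ((2 : K) ^ w i) * X i

lemma scaleTwo_monomial (w : σ → ℤ) (α : σ →₀ ℕ) :
    scaleTwo K w (monomial α 1) = (2 : K) ^ weightDeg w α • monomial α 1 := by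
  induction α using Finsupp.induction_linear with
  | zero => simp [weightDeg, ← C_apply]
  | add α β hα hβ =>
    have h : monomial (α + β) (1 : K) = monomial α 1 * monomial β 1 := by
      rw [monomial_mul, one_mul]
    rw [h, map_mul, hα, hβ, weightDeg_eq_weight, weightDeg_eq_weight, weightDeg_eq_weight, map_add,
      zpow_add₀ two_ne_zero, smul_mul_smul_comm]
  | single i k =>
    rw [← X_pow_eq_monomial, map_pow, scaleTwo, aeval_X, weightDeg_eq_weight,
      Finsupp.weight_single, mul_pow, ← C_pow, smul_eq_C_mul, nsmul_eq_mul, mul_comm (k : ℤ),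
      zpow_mul, zpow_natCast]

/-- All terms of an initial form have the same weight, so the generators of the ideal are
eigenvectors of the scaling. -/
lemma scaleTwo_mem {w : σ → ℤ} {I : Ideal (MvPolynomial σ K)} {f : MvPolynomial σ K}
    (hf : f ∈ initialIdeal (weightDeg w) I) : scaleTwo K w f ∈ initialIdeal (weightDeg w) I := by
  refine (Ideal.span_le (I := (initialIdeal (weightDeg w) I).comap (scaleTwo K w))).mpr ?_ hf
  rintro _ ⟨g, hg, hg0, rfl⟩
  obtain ⟨α, hα⟩ : ∃ e : ℤ, ∀ β ∈ g.support, (∀ γ ∈ g.support, weightDeg w γ ≤ weightDeg w β) →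
      weightDeg w β = e := by
    by_cases h : ∃ β ∈ g.support, ∀ γ ∈ g.support, weightDeg w γ ≤ weightDeg w β
    · obtain ⟨β, hβ, hmax⟩ := h
      exact ⟨weightDeg w β, fun γ hγ hγ' => le_antisymm (hmax γ hγ) (hγ' β hβ)⟩
    · exact ⟨0, fun β hβ hβ' => absurd ⟨β, hβ, hβ'⟩ h⟩
  have h : scaleTwo K w (initialForm (weightDeg w) g) =
      (2 : K) ^ α • initialForm (weightDeg w) g := by
    rw [initialForm, map_sum, Finset.smul_sum]
    refine Finset.sum_congr rfl fun β hβ => ?_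
    obtain ⟨hβ, hmax⟩ := Finset.mem_filter.mp hβ
    have h1 : monomial β (g.coeff β) = g.coeff β • monomial β (1 : K) := by
      rw [smul_monomial, smul_eq_mul, mul_one]
    rw [h1, map_smul, scaleTwo_monomial, hα β hβ hmax, smul_comm]
  change scaleTwo K w (initialForm (weightDeg w) g) ∈ initialIdeal (weightDeg w) I
  rw [h]
  exact Submodule.smul_of_tower_mem _ _ (Ideal.subset_span ⟨g, hg, hg0, rfl⟩)

/-- The initial ideal of a weight is homogeneous for this weight. -/
lemma weightDeg_eq_of_mem {w : σ → ℤ} {I : Ideal (MvPolynomial σ K)} {α β : σ →₀ ℕ}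
    (h : monomial α 1 - monomial β 1 ∈ initialIdeal (weightDeg w) I)
    (hβ : monomial β 1 ∉ initialIdeal (weightDeg w) I) : weightDeg w α = weightDeg w β := by
  by_contra hne
  have h1 := scaleTwo_mem h
  rw [map_sub, scaleTwo_monomial, scaleTwo_monomial] at h1
  -- Scaling the binomial and subtracting a multiple of the original cancels the monomial of `α`.
  -- What remains is a multiple of the monomial of `β`, nonzero if the weights differ.
  have h2 := Submodule.sub_mem _ h1
    (Submodule.smul_of_tower_mem (initialIdeal (weightDeg w) I) ((2 : K) ^ weightDeg w α) h)
  rw [smul_sub, sub_sub_sub_cancel_left, ← sub_smul] at h2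
  have h3 : (2 : K) ^ weightDeg w α - (2 : K) ^ weightDeg w β ≠ 0 := fun h0 =>
    hne (two_zpow_injective (sub_eq_zero.mp h0))
  refine hβ ?_
  have := Submodule.smul_of_tower_mem (initialIdeal (weightDeg w) I)
    ((2 : K) ^ weightDeg w α - (2 : K) ^ weightDeg w β)⁻¹ h2
  rwa [smul_smul, inv_mul_cancel₀ h3, one_smul] at this

end Weight

/-! ### The zero set of the radical -/

lemma zeroLocus_radical {ι K : Type*} [Field K] (I : Ideal (MvPolynomial ι K)) :
    zeroLocus I.radical = zeroLocus I := by
  refine Set.Subset.antisymm (fun p hp d f hf hd => hp d f (Ideal.le_radical hf) hd) ?_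
  rintro p hp d f ⟨k, hk⟩ hd v hv hvp
  have := hp _ _ hk (hd.pow k) v hv hvp
  rw [map_pow] at this
  exact eq_zero_of_pow_eq_zero this

/-! ### The kernel of the graded map as an initial ideal -/

namespace CombinatorialSeshadriStratification

variable {n : ℕ} {K : Type*} [Field K] [CharZero K] {P : NormalLatticePolytope n}
  {S : CombinatorialSeshadriStratification K P}
  {N : ℕ} {t : P.Face ≃ Fin N} {H : Finset P.weightMonoid}

omit [CharZero K] in
lemma coeffSum_binomial {σ : Type*} {p : (σ →₀ ℕ) → Prop} {α β : σ →₀ ℕ} (h : p α ↔ p β) :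
    coeffSum p (monomial α (1 : K) - monomial β 1) = 0 := by
  classical
  rw [map_sub, coeffSum_monomial, coeffSum_monomial]
  simp only [h, sub_self]

lemma binomial_mem_ker_theta {α β : (P.Pts ⊕ H) →₀ ℕ} (h : genWeight H α = genWeight H β) :
    monomial α 1 - monomial β 1 ∈ RingHom.ker (theta K H) :=
  mem_ker_theta_iff.mpr fun s => coeffSum_binomial (by rw [h])

variable (hlin : ∀ σ : P.Face, S.degree σ = 1) (ht : StrictAnti t)
include hlin ht

lemma binomial_mem_ker_thetaBar {α β : (P.Pts ⊕ H) →₀ ℕ} (hα : S.IsStandard H α)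
    (hβ : S.IsStandard H β) (h : genWeight H α = genWeight H β) :
    monomial α 1 - monomial β 1 ∈ RingHom.ker (S.thetaBar t H) :=
  (mem_ker_thetaBar_iff hlin ht).mpr fun s => coeffSum_binomial (by simp only [hα, hβ, h])

lemma monomial_mem_ker_thetaBar_iff {α : (P.Pts ⊕ H) →₀ ℕ} :
    monomial α 1 ∈ RingHom.ker (S.thetaBar t H) ↔ ¬S.IsStandard H α := by
  classical
  rw [mem_ker_thetaBar_iff hlin ht]
  simp only [coeffSum_monomial]
  refine ⟨fun h hα => ?_, fun h s => if_neg fun h' => h h'.1⟩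
  have := h (genWeight H α)
  rw [if_pos ⟨hα, rfl⟩] at this
  exact one_ne_zero this

omit [CharZero K] hlin ht in
/-- An ideal contains the polynomials for which the sums of the coefficients over the fibres of `wt`
in `p` vanish, if it contains the monomials outside `p` and the binomials in `p`. -/
lemma mem_ideal_of_coeffSum {σ D : Type*} {p : (σ →₀ ℕ) → Prop} {wt : (σ →₀ ℕ) → D}
    {I : Ideal (MvPolynomial σ K)} (h0 : ∀ α, ¬p α → monomial α 1 ∈ I)
    (h1 : ∀ α β, p α → p β → wt α = wt β → monomial α 1 - monomial β 1 ∈ I)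
    {f : MvPolynomial σ K} (hf : ∀ d, coeffSum (fun α => p α ∧ wt α = d) f = 0) : f ∈ I := by
  rw [← Ideal.Quotient.eq_zero_iff_mem, ← Ideal.Quotient.mkₐ_eq_mk K]
  exact apply_eq_zero_of_coeffSum (Ideal.Quotient.mkₐ K I).toLinearMap
    (fun α hα => Ideal.Quotient.eq_zero_iff_mem.mpr (h0 α hα))
    (fun α β hα hβ h => Ideal.Quotient.eq.mpr (h1 α β hα hβ h)) hf

/-- The kernel of `θ̄` is the initial ideal of the kernel of `θ`. -/
lemma initialIdeal_degA
    (hgen : Algebra.adjoin K (Set.range fun i : P.Pts ⊕ H => S.genClass t i) = ⊤) :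
    initialIdeal (S.degA t H) (RingHom.ker (theta K H)) = RingHom.ker (S.thetaBar t H) := by
  classical
  refine le_antisymm (Ideal.span_le.mpr ?_) fun f hf => ?_
  · rintro _ ⟨g, hg, -, rfl⟩
    refine (mem_ker_thetaBar_iff hlin ht).mpr fun s => ?_
    by_cases hex : ∃ α ∈ g.support, (∀ β ∈ g.support, S.degA t H β ≤ S.degA t H α) ∧
        S.IsStandard H α ∧ genWeight H α = s
    · obtain ⟨α, hα, hmax, hstd, rfl⟩ := hex
      -- Let a standard `α` be a leading exponent. Terms of `g` of the same weight have at most its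
      -- value, by standardness, and at least its value, by maximality in the reversed order. So all
      -- of them survive in the initial form and are standard, and their coefficients sum to zero
      -- because `g` is in the kernel of `θ`.
      have hdeg : ∀ β ∈ g.support, genWeight H β = genWeight H α →
          S.genValue t H β = S.genValue t H α := fun β hβ hβα => by
        refine le_antisymm ?_ ?_
        · rw [(isStandard_iff hlin ht).mp hstd, ← hβα]
          exact genValue_le hlin ht β
        · have h := hmax β hβ
          rw [degA_eq hlin ht, degA_eq hlin ht, hβα, Prod.Lex.toLex_le_toLex] at h
          exact h.elim (fun h => absurd h (lt_irrefl _)) fun h => h.2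
      have hdegA : ∀ β ∈ g.support, genWeight H β = genWeight H α →
          S.degA t H β = S.degA t H α := fun β hβ hβα => by
        rw [degA_eq hlin ht, degA_eq hlin ht, hβα, hdeg β hβ hβα]
      rw [← mem_ker_theta_iff.mp hg (genWeight H α)]
      refine coeffSum_eq_coeffSum (fun β hβ hβα => ?_) (fun β hβ hβ' => absurd hβ.2 hβ')
        fun β hβα hβ => ?_
      · rw [coeff_initialForm]
        split_ifs with h
        · rfl
        · by_contra h0
          have hβg := mem_support_iff.mpr (Ne.symm h0)
          exact h ⟨hβg, fun γ hγ => hdegA β hβg hβα ▸ hmax γ hγ⟩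
      · by_contra h0
        have hβg := mem_support_iff.mpr h0
        refine hβ ⟨(isStandard_iff hlin ht).mpr ?_, hβα⟩
        rw [hdeg β hβg hβα, hβα]
        exact (isStandard_iff hlin ht).mp hstd
    · refine coeffSum_eq_zero fun α hα h => hex ⟨α, ?_⟩
      rw [mem_support_iff, coeff_initialForm, ite_ne_right_iff] at hα
      exact ⟨hα.1.1, hα.1.2, h⟩
  · refine mem_ideal_of_coeffSum (fun α hα => ?_) (fun α β hα hβ h => ?_)
      ((mem_ker_thetaBar_iff hlin ht).mp hf)
    · obtain ⟨β, hβ, hβα⟩ := exists_isStandard hlin ht hgen (genWeight_mem α)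
      -- Nonstandard means strictly smaller value, which in the reversed order makes `α` the leading
      -- exponent.
      refine monomial_mem_initialIdeal (β := β) ?_ (binomial_mem_ker_theta hβα.symm)
      rw [degA_eq hlin ht, degA_eq hlin ht, hβα, Prod.Lex.toLex_lt_toLex]
      refine Or.inr ⟨rfl, OrderDual.toDual_lt_toDual.mpr ?_⟩
      rw [(isStandard_iff hlin ht).mp hβ, hβα]
      exact (genValue_le hlin ht α).lt_of_ne fun h => hα ((isStandard_iff hlin ht).mpr h)
    · refine binomial_mem_initialIdeal ?_ (binomial_mem_ker_theta h)
      rw [degA_eq hlin ht, degA_eq hlin ht, h, (isStandard_iff hlin ht).mp hα,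
        (isStandard_iff hlin ht).mp hβ, h]

end CombinatorialSeshadriStratification
end SeshadriToric

namespace SeshadriToric

open MvPolynomial
open scoped Pointwise

namespace CombinatorialSeshadriStratification

variable {n : ℕ} {K : Type*} [Field K] [CharZero K] {P : NormalLatticePolytope n}
  {S : CombinatorialSeshadriStratification K P}
  {N : ℕ} {t : P.Face ≃ Fin N} {H : Finset P.weightMonoid}

/-! ### Monomials in the functions of degree one -/

variable (S) in
/-- The monomial with exponent `α` involves only lattice points of the simplex of `C`. -/
def InSimplex (C : Flag P.Face) (α : P.Pts →₀ ℕ) : Prop :=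
  ∀ χ ∈ α.support, toReal χ.1 ∈ S.simplex C

omit [CharZero K] in
lemma genWeight_mapDomain (α : P.Pts →₀ ℕ) :
    genWeight H (α.mapDomain Sum.inl) = -Finsupp.weight (coordWeight P.pt) α := by
  rw [NormalLatticePolytope.weight_coordWeight, neg_neg, genWeight, Finsupp.weight_apply,
    Finsupp.sum_mapDomain_index_inj Sum.inl_injective]
  rfl

lemma mem_vanishingIdeal_variety_iff {f : MvPolynomial P.Pts K} :
    f ∈ vanishingIdeal (P.variety K) ↔
      ∀ μ, coeffSum (fun α => Finsupp.weight (coordWeight P.pt) α = μ) f = 0 :=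
  mem_vanishingIdeal_iff P.pt

lemma binomial_mem_vanishingIdeal {α β : P.Pts →₀ ℕ}
    (h : Finsupp.weight (coordWeight P.pt) α = Finsupp.weight (coordWeight P.pt) β) :
    monomial α (1 : K) - monomial β 1 ∈ vanishingIdeal (P.variety K) :=
  mem_vanishingIdeal_variety_iff.mpr fun s => coeffSum_binomial (by rw [h])

lemma rename_mem_ker_theta {f : MvPolynomial P.Pts K} (hf : f ∈ vanishingIdeal (P.variety K)) :
    rename (Sum.inl : P.Pts → P.Pts ⊕ H) f ∈ RingHom.ker (theta K H) := by
  refine mem_ker_theta_iff.mpr fun s => ?_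
  rw [coeffSum_rename, ← mem_vanishingIdeal_variety_iff.mp hf (-s)]
  refine coeffSum_congr fun α _ => ?_
  rw [genWeight_mapDomain, neg_eq_iff_eq_neg]

variable (hlin : ∀ σ : P.Face, S.degree σ = 1) (ht : StrictAnti t)
include hlin

lemma inSimplex_iff {C : Flag P.Face} {α : P.Pts →₀ ℕ} : S.InSimplex C α ↔
    ∀ i ∈ (α.mapDomain (Sum.inl : P.Pts → P.Pts ⊕ H)).support, S.InCone C (gen H i).1 := by
  classical
  rw [Finsupp.mapDomain_support_of_injective Sum.inl_injective]
  simp only [Finset.mem_image, forall_exists_index, and_imp, forall_apply_eq_imp_iff₂]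
  exact forall₂_congr fun χ _ => mem_simplex_iff_inCone hlin

lemma isStandard_mapDomain_iff {α : P.Pts →₀ ℕ} :
    S.IsStandard H (α.mapDomain Sum.inl) ↔ ∃ C, S.InSimplex C α :=
  exists_congr fun _ => (inSimplex_iff hlin).symm

include ht

variable (S t H) in
omit hlin ht in
/-- The ideal `ker θ̄ ∩ K[x_1, …, x_r]`. -/
noncomputable def kerBar : Ideal (MvPolynomial P.Pts K) :=
  (RingHom.ker (S.thetaBar t H)).comap (rename (R := K) (Sum.inl : P.Pts → P.Pts ⊕ H))

/-- The common weight lies in the cone of `C`, and a standard monomial has all its factors in every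
cone containing its weight. Only degree one generators matter, so `H` can be taken empty. -/
lemma InSimplex.of_weight_eq {C : Flag P.Face} {α β : P.Pts →₀ ℕ} (hα : S.InSimplex C α)
    (hβ : ∃ C', S.InSimplex C' β)
    (h : Finsupp.weight (coordWeight P.pt) α = Finsupp.weight (coordWeight P.pt) β) :
    S.InSimplex C β := by
  have h1 := inCone_genWeight ((inSimplex_iff (H := ∅) hlin).mp hα)
  rw [genWeight_mapDomain, h, ← genWeight_mapDomain (H := ∅)] at h1
  exact (inSimplex_iff (H := ∅) hlin).mpr
    (((isStandard_mapDomain_iff hlin).mpr hβ).inCone hlin ht h1)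

lemma mem_kerBar_iff {f : MvPolynomial P.Pts K} : f ∈ kerBar S t H ↔
    ∀ μ, coeffSum (fun α => (∃ C, S.InSimplex C α) ∧
      Finsupp.weight (coordWeight P.pt) α = μ) f = 0 := by
  rw [kerBar, Ideal.mem_comap, mem_ker_thetaBar_iff hlin ht]
  have h : ∀ s, coeffSum (fun α => S.IsStandard H α ∧ genWeight H α = s) (rename Sum.inl f) =
      coeffSum (fun α => (∃ C, S.InSimplex C α) ∧
        Finsupp.weight (coordWeight P.pt) α = -s) f := fun s => by
    rw [coeffSum_rename]
    refine coeffSum_congr fun α _ => ?_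
    rw [isStandard_mapDomain_iff hlin, genWeight_mapDomain, neg_eq_iff_eq_neg]
  simp only [h]
  exact ⟨fun h μ => neg_neg μ ▸ h (-μ), fun h s => h (-s)⟩

/-- If some monomial of a given weight is supported in the simplex of `C`, then so are all standard
ones of that weight. The conditions thus split into separate ones for each simplex. -/
lemma mem_kerBar_iff_forall_flag {f : MvPolynomial P.Pts K} : f ∈ kerBar S t H ↔
    ∀ C μ, coeffSum (fun α => S.InSimplex C α ∧
      Finsupp.weight (coordWeight P.pt) α = μ) f = 0 := by
  rw [mem_kerBar_iff hlin ht]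
  have h : ∀ C α, S.InSimplex C α → ∀ β, ((∃ C, S.InSimplex C β) ∧
      Finsupp.weight (coordWeight P.pt) β = Finsupp.weight (coordWeight P.pt) α) ↔
      S.InSimplex C β ∧
      Finsupp.weight (coordWeight P.pt) β = Finsupp.weight (coordWeight P.pt) α := fun C α hα β =>
    and_congr_left fun hβ => ⟨fun h => hα.of_weight_eq hlin ht h hβ.symm, fun h => ⟨C, h⟩⟩
  constructor
  · intro hf C μ
    by_cases hex : ∃ α, S.InSimplex C α ∧ Finsupp.weight (coordWeight P.pt) α = μ
    · obtain ⟨α, hα, rfl⟩ := hex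
      rw [← hf (Finsupp.weight (coordWeight P.pt) α)]
      exact (coeffSum_congr fun β _ => h C α hα β).symm
    · exact coeffSum_eq_zero fun α _ hα => hex ⟨α, hα⟩
  · intro hf μ
    by_cases hex : ∃ α, (∃ C, S.InSimplex C α) ∧ Finsupp.weight (coordWeight P.pt) α = μ
    · obtain ⟨α, ⟨C, hα⟩, rfl⟩ := hex
      rw [← hf C (Finsupp.weight (coordWeight P.pt) α)]
      exact coeffSum_congr fun β _ => h C α hα β
    · exact coeffSum_eq_zero fun α _ hα => hex ⟨α, hα⟩

omit [CharZero K] hlin ht in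
lemma monomial_eq_zero_of_not {σ : Type*} {v : σ → K} {α : σ →₀ ℕ} {i : σ} (hi : i ∈ α.support)
    (hv : v i = 0) : eval v (monomial α 1) = 0 := by
  rw [eval_monomial, one_mul]
  exact Finset.prod_eq_zero hi
    (by simp only [hv]; exact zero_pow (Finsupp.mem_support_iff.mp hi))

omit hlin ht in
open Classical in
/-- Setting the variables outside the simplex of `C` to zero. -/
lemma exists_restrict (C : Flag P.Face) (f : MvPolynomial P.Pts K) :
    ∃ g : MvPolynomial P.Pts K, (∀ v : P.Pts → K,
      eval v g = eval (fun χ => if toReal χ.1 ∈ S.simplex C then v χ else 0) f) ∧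
      ∀ p, coeffSum p g = coeffSum (fun α => S.InSimplex C α ∧ p α) f := by
  let φ : MvPolynomial P.Pts K →ₐ[K] MvPolynomial P.Pts K :=
    aeval fun χ => if toReal χ.1 ∈ S.simplex C then X χ else 0
  have hφ : ∀ α, φ (monomial α 1) = if S.InSimplex C α then monomial α 1 else 0 := by
    intro α
    simp only [φ, aeval_monomial, map_one, one_mul]
    split_ifs with h
    · rw [monomial_eq, C_1, one_mul]
      exact Finset.prod_congr rfl fun χ hχ => by simp only [if_pos (h χ hχ)]
    · simp only [InSimplex, not_forall] at h
      obtain ⟨χ, hχ, h⟩ := h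
      exact Finset.prod_eq_zero hχ
        (by simp only [if_neg h]; exact zero_pow (Finsupp.mem_support_iff.mp hχ))
  refine ⟨φ f, fun v => ?_, fun p => ?_⟩
  · refine RingHom.congr_fun (f := (eval v).comp φ.toRingHom) (g := eval _)
      (ringHom_ext (fun r => ?_) fun χ => ?_) f
    · simp [φ]
    · simp only [φ, AlgHom.toRingHom_eq_coe, RingHom.comp_apply, RingHom.coe_coe, aeval_X, eval_X]
      split_ifs
      · rw [eval_X]
      · rw [map_zero]
  · refine LinearMap.congr_fun (f := coeffSum p ∘ₗ φ.toLinearMap)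
      (linearMap_ext_monomial fun α => ?_) f
    rw [LinearMap.comp_apply, AlgHom.toLinearMap_apply, hφ, coeffSum_monomial]
    by_cases h : S.InSimplex C α
    · rw [if_pos h, coeffSum_monomial]
      simp only [h, true_and]
    · rw [if_neg h, map_zero]
      simp only [h, false_and, if_false]

/-- The ideal `ker θ̄ ∩ K[x_1, …, x_r]` consists of the functions vanishing at the torus orbits of
the simplices of the triangulation. -/
lemma isRadical_kerBar : (kerBar S t H).IsRadical := by
  classical
  -- The ideal is an intersection of kernels of evaluations in a field, at torus points with the
  -- coordinates outside one simplex set to zero; such an intersection is radical.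
  have h : ∀ f, f ∈ kerBar S t H ↔ ∀ C (s : Kˣ × (Fin n → Kˣ)),
      eval (fun χ : P.Pts => if toReal χ.1 ∈ S.simplex C then
        (characterHat (coordWeight P.pt χ) s : K) else 0) f = 0 := fun f => by
    rw [mem_kerBar_iff_forall_flag hlin ht]
    refine forall_congr' fun C => ?_
    obtain ⟨g, hg, hg'⟩ := exists_restrict (S := S) C f
    simp only [← hg, ← hg']
    exact (eval_torus_eq_zero_iff P.pt g).symm
  rintro f ⟨k, hk⟩
  rw [h] at hk ⊢
  intro C s
  have := hk C s
  rw [map_pow] at this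
  exact eq_zero_of_pow_eq_zero this

variable {w : P.Pts ⊕ H → ℤ}

omit ht in
/-- The face functions: every weight in the cone over the simplex of `C` has a multiple which is
the weight of a monomial in the vertices of this simplex. -/
lemma exists_inSimplex {C : Flag P.Face} {s : ℤ × (Fin n → ℤ)} (hs : S.InCone C s) :
    ∃ k : ℕ, 0 < k ∧ ∃ γ : P.Pts →₀ ℕ, S.InSimplex C γ ∧
      Finsupp.weight (coordWeight P.pt) γ = -(k • s) := by
  classical
  have := Fintype.ofFinite (C : Set P.Face)
  obtain ⟨k, hk, m, hm⟩ := exists_nsmul_eq hlin hs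
  -- Linearity of the extremal functions enters here: the vertices of the simplex are lattice points
  -- of the polytope, hence variables of degree one.
  have hvert : ∀ σ : P.Face, toReal (-(S.weight σ).2) ∈ P.carrier := fun σ =>
    marking_eq hlin σ ▸ σ.subset (S.marking_mem σ)
  let χ : P.Face → P.Pts := fun σ => ⟨-(S.weight σ).2, hvert σ⟩
  have hχ : ∀ σ, coordWeight P.pt (χ σ) = S.weight σ := fun σ =>
    Prod.ext (weight_fst hlin σ).symm (neg_neg _)
  refine ⟨k, hk, ∑ σ : (C : Set P.Face), Finsupp.single (χ σ) (m σ), fun ξ hξ => ?_, ?_⟩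
  · obtain ⟨σ, -, hσ⟩ := Finsupp.mem_support_finsetSum ξ hξ
    rw [Finset.mem_singleton.mp (Finsupp.support_single_subset hσ)]
    exact subset_convexHull ℝ _ ⟨σ, σ.2, marking_eq hlin σ⟩
  · rw [map_sum, hm, ← Finset.sum_neg_distrib]
    refine Finset.sum_congr rfl fun σ _ => ?_
    rw [Finsupp.weight_single, hχ, smul_neg, neg_neg]

/-- Monomials not supported in a common simplex are nilpotent modulo the initial ideal. -/
lemma monomial_mem_radical
    (hgen : Algebra.adjoin K (Set.range fun i : P.Pts ⊕ H => S.genClass t i) = ⊤)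
    (hw : RingHom.ker (S.thetaBar t H) =
      initialIdeal (weightDeg w) (RingHom.ker (theta K H))) {α : P.Pts →₀ ℕ}
    (hα : ¬∃ C, S.InSimplex C α) : monomial α 1 ∈
      (initialIdeal (weightDeg (w ∘ Sum.inl)) (vanishingIdeal (P.variety K))).radical := by
  set α' := α.mapDomain (Sum.inl : P.Pts → P.Pts ⊕ H) with hα'
  have hstd : ¬S.IsStandard H α' := fun h => hα ((isStandard_mapDomain_iff hlin).mp h)
  obtain ⟨β, hβ, hβα⟩ := exists_isStandard hlin ht hgen (genWeight_mem α')
  have hβmem : monomial β 1 ∉ RingHom.ker (S.thetaBar t H) := fun h =>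
    (monomial_mem_ker_thetaBar_iff hlin ht).mp h hβ
  -- Otherwise the standard monomial of `β` would lie in the kernel of `θ̄`: with equal degrees
  -- because the binomial and the nonstandard monomial do, with larger degree as an initial term.
  have hlt : weightDeg w β < weightDeg w α' := by
    rcases lt_trichotomy (weightDeg w β) (weightDeg w α') with h | h | h
    · exact h
    · refine absurd ?_ hβmem
      have h1 := binomial_mem_initialIdeal h (binomial_mem_ker_theta (K := K) hβα)
      rw [← hw] at h1
      exact (Submodule.sub_mem_iff_left _ ((monomial_mem_ker_thetaBar_iff hlin ht).mpr hstd)).mp h1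
    · exact absurd (hw ▸ monomial_mem_initialIdeal h
        (binomial_mem_ker_theta hβα.symm |> fun h => by
          have := (RingHom.ker (theta K H)).neg_mem h
          rwa [neg_sub] at this)) hβmem
  obtain ⟨C, hC⟩ := hβ
  -- The exponent `β` may involve generators from `H`. A multiple of its weight is reached by a
  -- monomial `γ` in the vertices, and `γ` can replace `k • β` because standard monomials of equal
  -- weight have equal degree for `w`. This is why only a power of the monomial is obtained.
  obtain ⟨k, hk, γ, hγ, hγk⟩ := exists_inSimplex hlin (inCone_genWeight hC)
  have hkβ : S.IsStandard H (k • β) := ⟨C, fun i hi => hC i (Finsupp.support_smul hi)⟩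
  have hγw : genWeight H (k • β) = genWeight H (γ.mapDomain Sum.inl) := by
    rw [genWeight_mapDomain, hγk, neg_neg, map_nsmul]
  have hγstd : S.IsStandard H (γ.mapDomain Sum.inl) := (isStandard_mapDomain_iff hlin).mpr ⟨C, hγ⟩
  have heq : weightDeg w (k • β) = weightDeg w (γ.mapDomain Sum.inl) := by
    refine weightDeg_eq_of_mem (K := K) (I := RingHom.ker (theta K H)) ?_ ?_
    · exact hw ▸ binomial_mem_ker_thetaBar hlin ht hkβ hγstd hγw
    · exact hw ▸ fun h => (monomial_mem_ker_thetaBar_iff hlin ht).mp h hγstd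
  refine ⟨k, ?_⟩
  rw [monomial_pow, one_pow]
  refine monomial_mem_initialIdeal (β := γ) ?_ (binomial_mem_vanishingIdeal ?_)
  · rw [← weightDeg_mapDomain Sum.inl_injective, ← heq, weightDeg_eq_weight, weightDeg_eq_weight,
      map_nsmul, map_nsmul, ← weightDeg_eq_weight, ← weightDeg_eq_weight,
      ← weightDeg_mapDomain Sum.inl_injective]
    exact nsmul_lt_nsmul_right hk.ne' hlt
  · rw [hγk, hβα, hα', genWeight_mapDomain, map_nsmul, smul_neg, neg_neg]

/-- The first part of the theorem: the radical of the initial ideal. -/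
lemma radical_initialIdeal
    (hgen : Algebra.adjoin K (Set.range fun i : P.Pts ⊕ H => S.genClass t i) = ⊤)
    (hw : RingHom.ker (S.thetaBar t H) = initialIdeal (weightDeg w) (RingHom.ker (theta K H))) :
    (initialIdeal (weightDeg (w ∘ Sum.inl)) (vanishingIdeal (P.variety K))).radical =
      kerBar S t H := by
  refine le_antisymm ((isRadical_kerBar hlin ht).radical_le_iff.mpr (Ideal.span_le.mpr ?_))
    fun f hf => ?_
  · rintro _ ⟨g, hg, hg0, rfl⟩
    change rename Sum.inl _ ∈ RingHom.ker (S.thetaBar t H)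
    rw [hw, ← initialForm_rename Sum.inl_injective]
    exact Ideal.subset_span ⟨_, rename_mem_ker_theta hg,
      fun h => hg0 (rename_injective _ Sum.inl_injective (h.trans (map_zero _).symm)), rfl⟩
  · refine mem_ideal_of_coeffSum
      (fun α hα => monomial_mem_radical hlin ht hgen hw hα) (fun α β hα hβ h => ?_)
      ((mem_kerBar_iff hlin ht).mp hf)
    -- Binomials need no power: two standard monomials of equal weight have equal degree for `w`, so
    -- their difference is its own initial form.
    refine Ideal.le_radical (binomial_mem_initialIdeal ?_ (binomial_mem_vanishingIdeal h))
    rw [← weightDeg_mapDomain Sum.inl_injective, ← weightDeg_mapDomain Sum.inl_injective]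
    refine weightDeg_eq_of_mem (K := K) (I := RingHom.ker (theta K H)) ?_ ?_
    · exact hw ▸ binomial_mem_ker_thetaBar hlin ht ((isStandard_mapDomain_iff hlin).mpr hα)
        ((isStandard_mapDomain_iff hlin).mpr hβ) (by rw [genWeight_mapDomain, genWeight_mapDomain, h])
    · exact hw ▸ fun h => (monomial_mem_ker_thetaBar_iff hlin ht).mp h
        ((isStandard_mapDomain_iff hlin).mpr hβ)

end CombinatorialSeshadriStratification
end SeshadriToric

/-! ### Points of the toric varieties of the simplices and of the limit -/

namespace SeshadriToric

open MvPolynomial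
open scoped Pointwise

namespace NormalLatticePolytope

variable {n : ℕ} {K : Type*} [Field K] [CharZero K] {P : NormalLatticePolytope n}

/-- The points of the embedded toric variety of `Q ⊆ P`. -/
lemma mk_mem_subVariety_iff {Q : Set (Fin n → ℝ)} {v : P.Pts → K} (hv : v ≠ 0) :
    Projectivization.mk K v hv ∈ P.subVariety K Q ↔
      (∀ χ, v χ ≠ 0 → toReal χ.1 ∈ Q) ∧ ∀ α β : P.Pts →₀ ℕ, (∀ χ ∈ α.support, toReal χ.1 ∈ Q) →
        (∀ χ ∈ β.support, toReal χ.1 ∈ Q) →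
        Finsupp.weight (coordWeight P.pt) α = Finsupp.weight (coordWeight P.pt) β →
        eval v (monomial α 1) = eval v (monomial β 1) := by
  classical
  let e : {χ : P.Pts // toReal χ.1 ∈ Q} → P.Pts := Subtype.val
  have he : Function.Injective e := Subtype.val_injective
  have hweight : ∀ α : {χ : P.Pts // toReal χ.1 ∈ Q} →₀ ℕ,
      Finsupp.weight (coordWeight P.pt) (α.mapDomain e) =
        Finsupp.weight (coordWeight fun χ : {χ : P.Pts // toReal χ.1 ∈ Q} => P.pt χ) α := fun α => by
    rw [Finsupp.weight_apply, Finsupp.weight_apply, Finsupp.sum_mapDomain_index_inj he]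
    rfl
  have heval : ∀ α : {χ : P.Pts // toReal χ.1 ∈ Q} →₀ ℕ,
      eval v (monomial (α.mapDomain e) 1) = eval (v ∘ e) (monomial α 1) := fun α => by
    rw [← eval_rename, rename_monomial]
  have hex : ∀ α : P.Pts →₀ ℕ, (∀ χ ∈ α.support, toReal χ.1 ∈ Q) →
      ∃ α' : {χ : P.Pts // toReal χ.1 ∈ Q} →₀ ℕ, α'.mapDomain e = α := fun α hα =>
    ⟨_, Finsupp.mapDomain_comapDomain e he α fun χ hχ => ⟨⟨χ, hα χ hχ⟩, rfl⟩⟩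
  have hbin : (∀ α β : P.Pts →₀ ℕ, (∀ χ ∈ α.support, toReal χ.1 ∈ Q) →
        (∀ χ ∈ β.support, toReal χ.1 ∈ Q) →
        Finsupp.weight (coordWeight P.pt) α = Finsupp.weight (coordWeight P.pt) β →
        eval v (monomial α 1) = eval v (monomial β 1)) ↔
      ∀ α β, Finsupp.weight (coordWeight fun χ : {χ : P.Pts // toReal χ.1 ∈ Q} => P.pt χ) α =
        Finsupp.weight (coordWeight fun χ : {χ : P.Pts // toReal χ.1 ∈ Q} => P.pt χ) β →
        eval (v ∘ e) (monomial α 1) = eval (v ∘ e) (monomial β 1) := by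
    have hsupp : ∀ α : {χ : P.Pts // toReal χ.1 ∈ Q} →₀ ℕ,
        ∀ χ ∈ (α.mapDomain e).support, toReal χ.1 ∈ Q := fun α χ hχ => by
      obtain ⟨ξ, -, rfl⟩ := Finset.mem_image.mp (Finsupp.mapDomain_support hχ)
      exact ξ.2
    constructor
    · intro h α β hαβ
      rw [← heval, ← heval]
      exact h _ _ (hsupp α) (hsupp β) (by rw [hweight, hweight, hαβ])
    · intro h α β hα hβ hαβ
      obtain ⟨α, rfl⟩ := hex α hα
      obtain ⟨β, rfl⟩ := hex β hβ
      rw [heval, heval]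
      exact h _ _ (by rwa [hweight, hweight] at hαβ)
  rw [hbin]
  have hext : ∀ (v' : {χ : P.Pts // toReal χ.1 ∈ Q} → K) (χ : {χ : P.Pts // toReal χ.1 ∈ Q}),
      Function.ExtendByZero.linearMap K e v' χ = v' χ := fun v' χ => he.extend_apply _ _ χ
  constructor
  · rintro ⟨p, hp, hpv⟩
    induction p using Projectivization.ind with
    | h v' hv' =>
      have hv0 : Function.ExtendByZero.linearMap K e v' ≠ 0 := fun h0 =>
        hv' (funext fun χ => (hext v' χ).symm.trans (congrFun h0 χ))
      have hpv' : Projectivization.mk K (Function.ExtendByZero.linearMap K e v') hv0 =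
          Projectivization.mk K v hv := hpv
      obtain ⟨c, hc⟩ := (Projectivization.mk_eq_mk_iff K _ _ hv hv0).mp hpv'.symm
      refine ⟨fun χ hχ => ?_, ?_⟩
      · by_contra hχQ
        refine hχ ?_
        rw [← hc, Pi.smul_apply]
        refine (congrArg (c • ·) (Function.extend_apply' (f := e) v' 0 χ ?_)).trans (smul_zero _)
        rintro ⟨ξ, rfl⟩
        exact hχQ ξ.2
      · have hve : v ∘ e = c • v' := funext fun χ => by
          rw [← hc]
          exact congrArg (c • ·) (hext v' χ)
        have hve0 : v ∘ e ≠ 0 := fun h0 => hv' ((smul_eq_zero_iff_eq c).mp (hve ▸ h0))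
        have hne : Nonempty {χ : P.Pts // toReal χ.1 ∈ Q} := by
          obtain ⟨χ, -⟩ := Function.ne_iff.mp hv'
          exact ⟨χ⟩
        refine (mk_mem_toricVariety_iff _ hve0).mp ?_
        rwa [(Projectivization.mk_eq_mk_iff K _ _ hve0 hv').mpr ⟨c, hve.symm⟩]
  · rintro ⟨hsupp, hbin⟩
    have hvext : Function.ExtendByZero.linearMap K e (v ∘ e) = v := funext fun χ => by
      by_cases hχ : toReal χ.1 ∈ Q
      · exact hext (v ∘ e) ⟨χ, hχ⟩
      · have h0 : v χ = 0 := not_not.mp fun h => hχ (hsupp χ h)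
        rw [h0]
        refine Function.extend_apply' (f := e) _ 0 χ ?_
        rintro ⟨ξ, rfl⟩
        exact hχ ξ.2
    obtain ⟨χ, hχ⟩ := Function.ne_iff.mp hv
    have hne : Nonempty {χ : P.Pts // toReal χ.1 ∈ Q} := ⟨⟨χ, hsupp χ hχ⟩⟩
    have hve0 : v ∘ e ≠ 0 := fun h0 => hχ (congrFun h0 ⟨χ, hsupp χ hχ⟩)
    refine ⟨Projectivization.mk K (v ∘ e) hve0, (mk_mem_toricVariety_iff _ hve0).mpr hbin, ?_⟩
    exact (Projectivization.mk_eq_mk_iff' K (Function.ExtendByZero.linearMap K e (v ∘ e)) v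
      (hvext.symm ▸ hv) hv).mpr ⟨1, by rw [one_smul, hvext]⟩

end NormalLatticePolytope

namespace CombinatorialSeshadriStratification

variable {n : ℕ} {K : Type*} [Field K] [CharZero K] {P : NormalLatticePolytope n}
  {S : CombinatorialSeshadriStratification K P}
  {N : ℕ} {t : P.Face ≃ Fin N} {H : Finset P.weightMonoid}
  (hlin : ∀ σ : P.Face, S.degree σ = 1) (ht : StrictAnti t)
include hlin ht

/-- The zero set of `ker θ̄ ∩ K[x_1, …, x_r]`. -/
lemma zeroLocus_kerBar :
    zeroLocus (kerBar S t H) = ⋃ C : Flag P.Face, P.subVariety K (S.simplex C) := by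
  classical
  ext p
  induction p using Projectivization.ind with
  | h v hv =>
    rw [Set.mem_iUnion]
    constructor
    · intro hp
      have hp' : ∀ f ∈ kerBar S t H, ∀ d, f.IsHomogeneous d → eval v f = 0 := fun f hf d hd =>
        (vanishesAt_mk_iff hv hd).mp (hp d f hf hd)
      have hmon : ∀ α : P.Pts →₀ ℕ, eval v (monomial α 1) ≠ 0 → ∃ C, S.InSimplex C α := by
        intro α hα
        by_contra hstd
        refine hα (hp' _ ((mem_kerBar_iff hlin ht).mpr fun μ => ?_) _
          (isHomogeneous_monomial 1 rfl))
        rw [coeffSum_monomial, if_neg fun h => hstd h.1]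
      -- The product of all coordinates that are nonzero at `v` does not vanish at `v`, so a single
      -- simplex contains the whole support of `v`.
      obtain ⟨C, hC⟩ := hmon (Finsupp.equivFunOnFinite.symm fun χ => if v χ = 0 then 0 else 1) (by
        rw [eval_monomial, one_mul, Finsupp.prod]
        refine Finset.prod_ne_zero_iff.mpr fun χ hχ => pow_ne_zero _ fun h0 => ?_
        rw [Finsupp.mem_support_iff] at hχ
        exact hχ (by simp [h0]))
      refine ⟨C, (NormalLatticePolytope.mk_mem_subVariety_iff hv).mpr
        ⟨fun χ hχ => hC χ ?_, fun α β hα hβ hαβ => ?_⟩⟩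
      · rw [Finsupp.mem_support_iff]
        simp [hχ]
      · rw [← sub_eq_zero, ← map_sub]
        refine hp' _ ((mem_kerBar_iff hlin ht).mpr fun μ => coeffSum_binomial ?_) _
          (isHomogeneous_of_weight P.pt ((isWeightedHomogeneous_monomial _ α (1 : K) rfl).sub
            (isWeightedHomogeneous_monomial _ β (1 : K) hαβ.symm)))
        rw [hαβ]
        exact and_congr_left fun _ => ⟨fun _ => ⟨C, hβ⟩, fun _ => ⟨C, hα⟩⟩
    · rintro ⟨C, hC⟩ d f hf hd
      obtain ⟨hsupp, hbin⟩ := (NormalLatticePolytope.mk_mem_subVariety_iff hv).mp hC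
      refine (vanishesAt_mk_iff hv hd).mpr ?_
      -- Monomials leaving the simplex of `C` vanish at `v`, and the others take values depending
      -- only on the weight, so the conditions for this one flag suffice.
      refine apply_eq_zero_of_coeffSum (aeval v).toLinearMap (fun α hα => ?_)
        (fun α β hα hβ hαβ => ?_) ((mem_kerBar_iff_forall_flag hlin ht).mp hf C)
      · simp only [InSimplex, not_forall] at hα
        obtain ⟨χ, hχ, hχC⟩ := hα
        simpa [aeval_eq_eval] using
          monomial_eq_zero_of_not hχ (not_not.mp fun h => hχC (hsupp χ h))
      · simpa [aeval_eq_eval] using hbin α β hα hβ hαβ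

end CombinatorialSeshadriStratification
end SeshadriToric

theorem mainTheorem6 {n : ℕ} {K : Type*} [Field K] [IsAlgClosed K] [CharZero K]
    (P : SeshadriToric.NormalLatticePolytope n)
    (S : SeshadriToric.CombinatorialSeshadriStratification K P)
    -- all extremal functions are linear
    (hlin : ∀ σ : P.Face, S.degree σ = 1)
    -- a linearization of the poset of faces: `t` lists the faces in decreasing order
    {N : ℕ} (t : P.Face ≃ Fin N) (ht : StrictAnti t)
    -- the degree one functions and the functions of higher degree given by `H` generate `gr_ν`
    (H : Finset P.weightMonoid) (hH : ∀ s ∈ H, 1 < s.1.1)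
    (hgen : Algebra.adjoin K (Set.range fun i : P.Pts ⊕ H => S.genClass t i) = ⊤)
    -- an integral vector `w` with `in_ν (ker θ) = in_w (ker θ)`
    (w : P.Pts ⊕ H → ℤ)
    (hw : SeshadriToric.initialIdeal (S.degA t H)
          (RingHom.ker (SeshadriToric.CombinatorialSeshadriStratification.theta K H)) =
        SeshadriToric.initialIdeal (SeshadriToric.weightDeg w)
          (RingHom.ker (SeshadriToric.CombinatorialSeshadriStratification.theta K H))) :
    (SeshadriToric.initialIdeal (SeshadriToric.weightDeg fun χ : P.Pts => w (Sum.inl χ))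
        (SeshadriToric.vanishingIdeal (P.variety K))).radical =
      (RingHom.ker (S.thetaBar t H)).comap
        (MvPolynomial.rename (R := K) (Sum.inl : P.Pts → P.Pts ⊕ H)) ∧
    SeshadriToric.limitVariety (fun χ : P.Pts => w (Sum.inl χ)) (P.variety K) =
      ⋃ C : Flag P.Face, P.subVariety K (S.simplex C) := by
  have hw' := (SeshadriToric.CombinatorialSeshadriStratification.initialIdeal_degA
    hlin ht hgen).symm.trans hw
  have h := SeshadriToric.CombinatorialSeshadriStratification.radical_initialIdeal
    hlin ht hgen hw'
  refine ⟨h, ?_⟩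
  rw [← SeshadriToric.CombinatorialSeshadriStratification.zeroLocus_kerBar (H := H) hlin ht, ← h,
    SeshadriToric.zeroLocus_radical]
  rfl
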